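/- Notation. Let $m_1,m_2,n$ be given, $m=m_1+m_2$, $j=\mathrm{diag}(I_{m_1},-I_{m_2})$; $\|\cdot\|$ is the spectral norm. A potential is a sequence $\{C_k\}_{k\ge 0}$ of positive definite $m\times m$ matrices with $C_kjC_k=j$; $W_k(z)$ is defined by $W_0=I_m$, $W_{k+1}(z)=(I_m+\mathrm{i}zjC_k)W_k(z)$; an $m_1\times m_2$ matrix function $\varphi$ on $\mathbb{C}_-$ is a Weyl function of the Dirac system $y_{k+1}=(I_m+\mathrm{i}zjC_k)y_k$ if $$\sum_{k\ge 0}(1+|z|^2)^{-k}\,[\varphi(z)^*\ \ I_{m_2}]\,W_k(z)^*C_kW_k(z)\begin{bmatrix}\varphi(z)\\ I_{m_2}\end{bmatrix}<\infty\qquad(z\in\mathbb{C}_-).$$ Let $\mathcal{G}_n$ be the class of triples $\{\mathcal{A},\mathcal{B},\mathcal{C}\}$ (of sizes $n\times n$, $n\times m_2$, $m_1\times n$) such that $\psi(z)=\mathcal{C}(zI_n-\mathcal{A})^{-1}\mathcal{B}$ is a minimal realization of a function contractive on $\mathbb{C}_-$. For a triple and a matrix $X>0$ with $$X\mathcal{B}\mathcal{B}^*X-\mathrm{i}(\mathcal{A}^*X-X\mathcal{A})+\mathcal{C}^*\mathcal{C}=0\qquad(1)$$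 put $A=\mathcal{A}-\mathrm{i}\mathcal{B}\mathcal{B}^*X$, $S_0=X^{-1}$, $\Pi_0=[\mathrm{i}X^{-1}\mathcal{C}^*\ \ \mathcal{B}]$ and, if $\det A\neq 0$, $$\Pi_{k+1}=\Pi_k+\mathrm{i}A^{-1}\Pi_kj,\qquad S_{k+1}=S_k+A^{-1}S_k(A^*)^{-1}+A^{-1}\Pi_k\Pi_k^*(A^*)^{-1},$$ $$C_k=I_m+\Pi_k^*S_k^{-1}\Pi_k-\Pi_{k+1}^*S_{k+1}^{-1}\Pi_{k+1},$$ $$R_k=(I_n+\mathrm{i}A^{-1})^{-k}S_k(I_n-\mathrm{i}(A^*)^{-1})^{-k},\qquad Q_k=(I_n-\mathrm{i}A^{-1})^{-k}S_k(I_n+\mathrm{i}(A^*)^{-1})^{-k}.$$ The triple $\{A,S_0,\Pi_0\}$ is called admissible if $\det A\ne0$, $S_0>0$ and $AS_0-S_0A^*=\mathrm{i}\Pi_0j\Pi_0^*$. For Hermitian matrices, $M_k\to+\infty$ means that for every $c\in\mathbb{R}$, $M_k\ge cI_n$ for all large $k$. Theorem. Let $\{\mathcal{A},\mathcal{B},\mathcal{C}\}\in\mathcal{G}_n$.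 Then there is exactly one $X>0$ which satisfies (1) and $$\sigma(\mathcal{A}-\mathrm{i}\mathcal{B}\mathcal{B}^*X)\subset\mathbb{C}_+\cup\mathbb{R}.\qquad(2)$$ Let $X$ be this matrix and assume that $\det A\neq 0$. Then $\{A,S_0,\Pi_0\}$ is admissible, and the sequence $\{C_k\}$ is a potential, $\varphi(z)=\psi(-1/z)$ is a Weyl function of its Dirac system, and no other potential has the Weyl function $\varphi$. Assume moreover that either $R_k\to+\infty$, or $\mathrm{i}\notin\sigma(A)$ and $Q_k\to+\infty$. Then this recovery of $\{C_k\}$ is stable in the class $\mathcal{G}_n$: for each $\varepsilon>0$ there is $\delta>0$ such that for every $\{\widetilde{\mathcal{A}},\widetilde{\mathcal{B}},\widetilde{\mathcal{C}}\}\in\mathcal{G}_n$ with $\|\mathcal{A}-\widetilde{\mathcal{A}}\|+\|\mathcal{B}-\widetilde{\mathcal{B}}\|+\|\mathcal{C}-\widetilde{\mathcal{C}}\|<\delta$: (a) there is exactly one $\widetilde X>0$ that satisfies the analogues of (1), (2) for the perturbed triple; for it $\|X-\widetilde X\|<\varepsilon$, the triple $\{\widetilde A,\widetilde S_0,\widetilde\Pi_0\}$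 is admissible, and $\|C_k-\widetilde C_k\|<\varepsilon$ for all $k\ge 0$; (b) for each Hermitian solution $\widetilde X$ of the analogue of (1) with $\|X-\widetilde X\|<\delta$, the triple $\{\widetilde A,\widetilde S_0,\widetilde\Pi_0\}$ is admissible and $\|C_k-\widetilde C_k\|<\varepsilon$ for all $k\ge 0$. -/

import Mathlib

open Matrix Filter Topology
-- matrices carry the spectral (operator) norm
open scoped Matrix.Norms.L2Operator
-- `0 ≤ x` for complex `x` means that `x` is real and non-negative (used by `Matrix.PosDef`)
open scoped ComplexOrder

noncomputable section

namespace DiscreteDirac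

/-! ### Self-adjoint discrete Dirac systems and their Weyl functions -/

/-- The signature matrix `j = diag (I_{m₁}, -I_{m₂})`. -/
def sig (m₁ m₂ : ℕ) : Matrix (Fin m₁ ⊕ Fin m₂) (Fin m₁ ⊕ Fin m₂) ℂ :=
  Matrix.fromBlocks 1 0 0 (-1)

/-- `{C_k}` is the potential of a self-adjoint discrete Dirac system
`y_{k+1}(z) = (I + i z j C_k) y_k(z)`: every `C_k` is positive definite and `j`-unitary. -/
def IsDiracPotential {m₁ m₂ : ℕ} (C : ℕ → Matrix (Fin m₁ ⊕ Fin m₂) (Fin m₁ ⊕ Fin m₂) ℂ) : Prop :=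
  ∀ k, (C k).PosDef ∧ C k * sig m₁ m₂ * C k = sig m₁ m₂

/-- The fundamental solution `W_k(z)` of the system, normalized by `W_0(z) = I`. -/
def fundSol {m₁ m₂ : ℕ} (C : ℕ → Matrix (Fin m₁ ⊕ Fin m₂) (Fin m₁ ⊕ Fin m₂) ℂ) :
    ℕ → ℂ → Matrix (Fin m₁ ⊕ Fin m₂) (Fin m₁ ⊕ Fin m₂) ℂ
  | 0, _ => 1
  | k + 1, z => (1 + (Complex.I * z) • (sig m₁ m₂ * C k)) * fundSol C k z

/-- `φ` is a Weyl function (on the open lower half-plane) of the system with potential `{C_k}`: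
the series `∑ (1 + |z|²)^{-k} [φ(z)* I] W_k(z)* C_k W_k(z) [φ(z); I]` converges whenever
`Im z < 0`. -/
def IsWeylFunction {m₁ m₂ : ℕ} (C : ℕ → Matrix (Fin m₁ ⊕ Fin m₂) (Fin m₁ ⊕ Fin m₂) ℂ)
    (φ : ℂ → Matrix (Fin m₁) (Fin m₂) ℂ) : Prop :=
  ∀ z : ℂ, z.im < 0 →
    Summable fun k : ℕ =>
      (((1 + ‖z‖ ^ 2)⁻¹ ^ k : ℝ) : ℂ) •
        ((Matrix.fromRows (φ z) (1 : Matrix (Fin m₂) (Fin m₂) ℂ))ᴴ * (fundSol C k z)ᴴ * C k *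
          fundSol C k z * Matrix.fromRows (φ z) (1 : Matrix (Fin m₂) (Fin m₂) ℂ))

/-! ### Sequences determined by parameter matrices `A`, `S₀`, `Π₀` -/

/-- The triple `{A, S₀, Π₀}` is admissible. -/
structure IsAdmissible {m₁ m₂ n : ℕ} (A S₀ : Matrix (Fin n) (Fin n) ℂ)
    (P₀ : Matrix (Fin n) (Fin m₁ ⊕ Fin m₂) ℂ) : Prop where
  det_ne_zero : A.det ≠ 0
  posDef : S₀.PosDef
  identity : A * S₀ - S₀ * Aᴴ = Complex.I • (P₀ * sig m₁ m₂ * P₀ᴴ)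

/-- `Π_{k+1} = Π_k + i A⁻¹ Π_k j`. -/
def seqP {m₁ m₂ n : ℕ} (A : Matrix (Fin n) (Fin n) ℂ) (P₀ : Matrix (Fin n) (Fin m₁ ⊕ Fin m₂) ℂ) :
    ℕ → Matrix (Fin n) (Fin m₁ ⊕ Fin m₂) ℂ
  | 0 => P₀
  | k + 1 => seqP A P₀ k + Complex.I • (A⁻¹ * seqP A P₀ k * sig m₁ m₂)

/-- `S_{k+1} = S_k + A⁻¹ S_k (A*)⁻¹ + A⁻¹ Π_k Π_k* (A*)⁻¹`. -/
def seqS {m₁ m₂ n : ℕ} (A S₀ : Matrix (Fin n) (Fin n) ℂ)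
    (P₀ : Matrix (Fin n) (Fin m₁ ⊕ Fin m₂) ℂ) : ℕ → Matrix (Fin n) (Fin n) ℂ
  | 0 => S₀
  | k + 1 => seqS A S₀ P₀ k + A⁻¹ * seqS A S₀ P₀ k * (Aᴴ)⁻¹ +
      A⁻¹ * seqP A P₀ k * (seqP A P₀ k)ᴴ * (Aᴴ)⁻¹

/-- `C_k = I + Π_k* S_k⁻¹ Π_k - Π_{k+1}* S_{k+1}⁻¹ Π_{k+1}`: the potential determined by
`{A, S₀, Π₀}`. -/
def seqC {m₁ m₂ n : ℕ} (A S₀ : Matrix (Fin n) (Fin n) ℂ)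
    (P₀ : Matrix (Fin n) (Fin m₁ ⊕ Fin m₂) ℂ) (k : ℕ) :
    Matrix (Fin m₁ ⊕ Fin m₂) (Fin m₁ ⊕ Fin m₂) ℂ :=
  1 + (seqP A P₀ k)ᴴ * (seqS A S₀ P₀ k)⁻¹ * seqP A P₀ k -
    (seqP A P₀ (k + 1))ᴴ * (seqS A S₀ P₀ (k + 1))⁻¹ * seqP A P₀ (k + 1)

/-- `R_r = (I + i A⁻¹)^{-r} S_r (I - i (A*)⁻¹)^{-r}`. -/
def seqR {m₁ m₂ n : ℕ} (A S₀ : Matrix (Fin n) (Fin n) ℂ)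
    (P₀ : Matrix (Fin n) (Fin m₁ ⊕ Fin m₂) ℂ) (r : ℕ) : Matrix (Fin n) (Fin n) ℂ :=
  ((1 + Complex.I • A⁻¹) ^ r)⁻¹ * seqS A S₀ P₀ r * ((1 - Complex.I • (Aᴴ)⁻¹) ^ r)⁻¹

/-- `Q_r = (I - i A⁻¹)^{-r} S_r (I + i (A*)⁻¹)^{-r}`. -/
def seqQ {m₁ m₂ n : ℕ} (A S₀ : Matrix (Fin n) (Fin n) ℂ)
    (P₀ : Matrix (Fin n) (Fin m₁ ⊕ Fin m₂) ℂ) (r : ℕ) : Matrix (Fin n) (Fin n) ℂ :=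
  ((1 - Complex.I • A⁻¹) ^ r)⁻¹ * seqS A S₀ P₀ r * ((1 + Complex.I • (Aᴴ)⁻¹) ^ r)⁻¹

/-- `M_k → +∞` for a sequence of Hermitian matrices: for every real `c`, eventually `M_k ≥ c I`
(equivalently, all the eigenvalues of `M_k` tend to `+∞`). -/
def TendsToPosInfinity {n : ℕ} (M : ℕ → Matrix (Fin n) (Fin n) ℂ) : Prop :=
  ∀ c : ℝ, ∀ᶠ k in atTop, (M k - (c : ℂ) • (1 : Matrix (Fin n) (Fin n) ℂ)).PosSemidef

/-! ### Realizations and the recovery procedure -/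

/-- The matrices `{𝒜, ℬ, 𝒞}` of a realization `ψ(z) = 𝒞 (z I_n - 𝒜)⁻¹ ℬ` of a strictly proper
rational `m₁ × m₂` matrix function. -/
@[ext] structure Realization (m₁ m₂ n : ℕ) where
  a : Matrix (Fin n) (Fin n) ℂ
  b : Matrix (Fin n) (Fin m₂) ℂ
  c : Matrix (Fin m₁) (Fin n) ℂ

namespace Realization

/-- `ψ(z) = 𝒞 (z I_n - 𝒜)⁻¹ ℬ` (meaningful for `z` outside the spectrum of `𝒜`). -/
def transfer {m₁ m₂ n : ℕ} (T : Realization m₁ m₂ n) (z : ℂ) : Matrix (Fin m₁) (Fin m₂) ℂ :=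
  T.c * (z • (1 : Matrix (Fin n) (Fin n) ℂ) - T.a)⁻¹ * T.b

/-- Two realizations (possibly of different sizes) realize the same rational function. -/
def SameFunction {m₁ m₂ n n' : ℕ} (T : Realization m₁ m₂ n) (T' : Realization m₁ m₂ n') : Prop :=
  ∀ z : ℂ, z ∉ spectrum ℂ T.a → z ∉ spectrum ℂ T'.a → T.transfer z = T'.transfer z

/-- The realization is minimal: no realization of the same function has a smaller size. -/
def IsMinimal {m₁ m₂ n : ℕ} (T : Realization m₁ m₂ n) : Prop :=
  ∀ (n' : ℕ) (T' : Realization m₁ m₂ n'), T.SameFunction T' → n ≤ n'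

/-- `ψ(z)* ψ(z) ≤ I` at all points of the open lower half-plane which are not eigenvalues
of `𝒜`. (Then `ψ` has no poles there.) -/
def IsContractive {m₁ m₂ n : ℕ} (T : Realization m₁ m₂ n) : Prop :=
  ∀ z : ℂ, z.im < 0 → z ∉ spectrum ℂ T.a → (1 - (T.transfer z)ᴴ * T.transfer z).PosSemidef

/-- The class `𝒢_n` of triples which determine minimal realizations of `m₁ × m₂` matrix functions
contractive on the open lower half-plane. -/
def classG (m₁ m₂ n : ℕ) : Set (Realization m₁ m₂ n) :=
  {T | T.IsMinimal ∧ T.IsContractive}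

/-- `‖𝒜 - 𝒜'‖ + ‖ℬ - ℬ'‖ + ‖𝒞 - 𝒞'‖`. -/
def distance {m₁ m₂ n : ℕ} (T T' : Realization m₁ m₂ n) : ℝ :=
  ‖T.a - T'.a‖ + ‖T.b - T'.b‖ + ‖T.c - T'.c‖

/-- The Riccati equation `X ℬ ℬ* X - i (𝒜* X - X 𝒜) + 𝒞* 𝒞 = 0`. -/
def Riccati {m₁ m₂ n : ℕ} (T : Realization m₁ m₂ n) (X : Matrix (Fin n) (Fin n) ℂ) : Prop :=
  X * T.b * T.bᴴ * X - Complex.I • (T.aᴴ * X - X * T.a) + T.cᴴ * T.c = 0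

/-- `A = 𝒜 - i ℬ ℬ* X`. -/
def recA {m₁ m₂ n : ℕ} (T : Realization m₁ m₂ n) (X : Matrix (Fin n) (Fin n) ℂ) :
    Matrix (Fin n) (Fin n) ℂ :=
  T.a - Complex.I • (T.b * T.bᴴ * X)

/-- `Π₀ = [ϑ₁ ϑ₂]` with `ϑ₁ = i X⁻¹ 𝒞*` and `ϑ₂ = ℬ`. -/
def recP {m₁ m₂ n : ℕ} (T : Realization m₁ m₂ n) (X : Matrix (Fin n) (Fin n) ℂ) :
    Matrix (Fin n) (Fin m₁ ⊕ Fin m₂) ℂ :=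
  Matrix.fromCols (Complex.I • (X⁻¹ * T.cᴴ)) T.b

/-- `{A, S₀, Π₀}`, with `S₀ = X⁻¹`, is an admissible triple. -/
def RecAdmissible {m₁ m₂ n : ℕ} (T : Realization m₁ m₂ n) (X : Matrix (Fin n) (Fin n) ℂ) : Prop :=
  IsAdmissible (T.recA X) X⁻¹ (T.recP X)

/-- The potential `{C_k}` determined by `{A, S₀, Π₀}`: the output of the recovery procedure. -/
def recC {m₁ m₂ n : ℕ} (T : Realization m₁ m₂ n) (X : Matrix (Fin n) (Fin n) ℂ) :
    ℕ → Matrix (Fin m₁ ⊕ Fin m₂) (Fin m₁ ⊕ Fin m₂) ℂ :=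
  seqC (T.recA X) X⁻¹ (T.recP X)

/-- The sequence `{R_k}` in the recovery procedure. -/
def recR {m₁ m₂ n : ℕ} (T : Realization m₁ m₂ n) (X : Matrix (Fin n) (Fin n) ℂ) :
    ℕ → Matrix (Fin n) (Fin n) ℂ :=
  seqR (T.recA X) X⁻¹ (T.recP X)

/-- The sequence `{Q_k}` in the recovery procedure. -/
def recQ {m₁ m₂ n : ℕ} (T : Realization m₁ m₂ n) (X : Matrix (Fin n) (Fin n) ℂ) :
    ℕ → Matrix (Fin n) (Fin n) ℂ :=
  seqQ (T.recA X) X⁻¹ (T.recP X)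

/-- The choice of `X` in the procedure: `X > 0` solves the Riccati equation and the spectrum of
`𝒜 - i ℬ ℬ* X` lies in the closed upper half-plane. -/
structure IsSpectralSolution {m₁ m₂ n : ℕ} (T : Realization m₁ m₂ n)
    (X : Matrix (Fin n) (Fin n) ℂ) : Prop where
  posDef : X.PosDef
  riccati : T.Riccati X
  spectrum_subset : spectrum ℂ (T.recA X) ⊆ {z : ℂ | 0 ≤ z.im}

/-- Stability, at `T` and `X`, of the recovery of the potential in the class `𝒢_n`.
For each triple `T'` of the class close to `T`: the solution `X'` chosen for `T'` by the same
spectral condition exists, is close to `X`, and the recovered potential is close to that of `T`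
uniformly in `k`; and the potentials are also uniformly close for each Hermitian solution `X'`
of the perturbed Riccati equation which is close to `X`. -/
def StableRecovery {m₁ m₂ n : ℕ} (T : Realization m₁ m₂ n)
    (X : Matrix (Fin n) (Fin n) ℂ) : Prop :=
  ∀ ε : ℝ, 0 < ε → ∃ δ : ℝ, 0 < δ ∧
    ∀ T' : Realization m₁ m₂ n, T' ∈ classG m₁ m₂ n → T.distance T' < δ →
      (∃! X' : Matrix (Fin n) (Fin n) ℂ, T'.IsSpectralSolution X') ∧
      (∀ X' : Matrix (Fin n) (Fin n) ℂ, T'.IsSpectralSolution X' →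
        ‖X - X'‖ < ε ∧ T'.RecAdmissible X' ∧ ∀ k, ‖T.recC X k - T'.recC X' k‖ < ε) ∧
      (∀ X' : Matrix (Fin n) (Fin n) ℂ, X'.IsHermitian → T'.Riccati X' → ‖X - X'‖ < δ →
        T'.RecAdmissible X' ∧ ∀ k, ‖T.recC X k - T'.recC X' k‖ < ε)

end Realization

end DiscreteDirac

end

set_option linter.unusedSectionVars false

namespace DiscreteDirac

/-! ### Matrices: eigenvectors, positivity, spectra -/

section MatrixLemmas

variable {ι κ : Type*} [Fintype ι] [DecidableEq ι] [Fintype κ] [DecidableEq κ]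

/-! The choice of X. Minimality makes the realization controllable and observable, and the
boundedness of ψ then forces σ(𝒜) into the open upper half-plane (`im_pos_of_mem_spectrum`). Replace
𝒞*𝒞 by t𝒞*𝒞. At t = 0 the solution X = 0 is stabilizing, and it can be continued through all t < 1:
the derivative of the Riccati map is an invertible Sylvester operator, solutions stay bounded by
controllability (`IsReachable.exists_bound`), and strict contractivity keeps the closed-loop
spectrum off the real axis (`Icc_subset_stabilizableLevels`). A limit t → 1 gives X. Two solutions
with the spectral condition coincide because their difference satisfies a homogeneous Sylvester
equation (`IsMinimal.riccati_unique`).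

The Weyl function. Conjugated by X⁻¹, the Riccati equation becomes the identity AS₀ − S₀A* =
iΠ₀jΠ₀*, which every step of the recursion preserves. It produces matrices w_k(λ), λ = −1/z, that
carry the free system C = I to the system with potential C_k (`darboux_step`) and satisfy w_k* j w_k
≤ j for λ in the lower half-plane (`darboux_conj`). The column [φ; I] is the image under w_0 of a
column in the negative eigenspace of j, so its energy under j stays nonpositive; a telescoping sum
then bounds the Weyl series (`isWeylFunction_recC`).

Uniqueness of the potential. At z = −i convergence of the series forces (C_0 + j)[φ; I] = 0, and
this determines C_0. Applying the first factor of the system and dividing by z + i gives the same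
data for the shifted potential (`IsWeylFamily.next`), a step of Schur algorithm type.

Stability. Write C_k − I = G_k − G_{k+1} with G_k = Π_k* S_k⁻¹ Π_k ≥ 0. Compressed to either
eigenspace of j, the sequence G_k decreases, so smallness at one index N controls every C_k with k ≥
N; the growth of R_k or Q_k supplies N. Smallness at N is an open condition on the parameters, so it
passes to perturbed triples with no growth hypothesis on them, and a positive j-unitary matrix is
governed by one diagonal block (`exists_forall_norm_sub_one_lt`). The finitely many k < N are
handled by continuity. -/

lemma mem_spectrum_iff_exists_column {M : Matrix ι ι ℂ} {μ : ℂ} :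
    μ ∈ spectrum ℂ M ↔ ∃ x : Matrix ι (Fin 1) ℂ, x ≠ 0 ∧ M * x = μ • x := by
  rw [spectrum.mem_iff, isUnit_iff_isUnit_det, isUnit_iff_ne_zero, not_not,
    ← exists_mulVec_eq_zero_iff]
  constructor
  · rintro ⟨v, hv, h⟩
    refine ⟨replicateCol (Fin 1) v, fun h0 => hv ?_, ?_⟩
    · ext i; simpa using congrFun (congrFun h0 i) 0
    · ext i j
      have := congrFun h i
      simp only [sub_mulVec, Pi.sub_apply, Pi.zero_apply, sub_eq_zero, Algebra.algebraMap_eq_smul_one,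
        smul_mulVec, one_mulVec, Pi.smul_apply] at this
      simpa [mul_apply, mulVec, dotProduct] using this.symm
  · rintro ⟨x, hx, h⟩
    refine ⟨fun i => x i 0, fun h0 => hx ?_, ?_⟩
    · ext i j
      rw [Subsingleton.elim j 0]
      exact congrFun h0 i
    · ext i
      have := congrFun (congrFun h i) 0
      simp only [sub_mulVec, Pi.sub_apply, Pi.zero_apply, sub_eq_zero, Algebra.algebraMap_eq_smul_one,
        smul_mulVec, one_mulVec, Pi.smul_apply]
      simpa [mul_apply, mulVec, dotProduct] using this.symm

lemma isUnit_det_of_notMem_spectrum {M : Matrix ι ι ℂ} {μ : ℂ} (h : μ ∉ spectrum ℂ M) :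
    IsUnit (μ • (1 : Matrix ι ι ℂ) - M).det := by
  rw [spectrum.notMem_iff, isUnit_iff_isUnit_det, Algebra.algebraMap_eq_smul_one] at h
  exact h

lemma conj_mem_spectrum_conjTranspose {M : Matrix ι ι ℂ} {μ : ℂ} :
    μ ∈ spectrum ℂ Mᴴ ↔ star μ ∈ spectrum ℂ M := by
  rw [← star_eq_conjTranspose, spectrum.map_star, Set.mem_star]

lemma _root_.Matrix.PosSemidef.mul_eq_zero_of_conj_eq_zero {H : Matrix ι ι ℂ} (hH : H.PosSemidef)
    {x : Matrix ι κ ℂ} (h : xᴴ * H * x = 0) : H * x = 0 := by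
  obtain ⟨B, rfl⟩ : ∃ B : Matrix ι ι ℂ, H = Bᴴ * B := by
    open scoped MatrixOrder in
    exact CStarAlgebra.nonneg_iff_eq_star_mul_self.mp hH.nonneg
  have : (B * x)ᴴ * (B * x) = 0 := by
    rw [← h, conjTranspose_mul]; simp only [Matrix.mul_assoc]
  rw [conjTranspose_mul_self_eq_zero] at this
  rw [Matrix.mul_assoc, this, Matrix.mul_zero]

lemma _root_.Matrix.PosDef.eq_zero_of_conj_eq_zero {H : Matrix ι ι ℂ} (hH : H.PosDef)
    {x : Matrix ι κ ℂ} (h : xᴴ * H * x = 0) : x = 0 := by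
  have h1 := hH.posSemidef.mul_eq_zero_of_conj_eq_zero h
  have h2 := hH.isUnit
  rw [isUnit_iff_isUnit_det] at h2
  have := congrArg (H⁻¹ * ·) h1
  simpa [← Matrix.mul_assoc, nonsing_inv_mul _ h2] using this

lemma _root_.Matrix.PosSemidef.eq_zero_of_neg {H : Matrix ι ι ℂ} (h1 : H.PosSemidef)
    (h2 : (-H).PosSemidef) : H = 0 := by
  open scoped MatrixOrder in
  exact le_antisymm (by rw [Matrix.le_iff, zero_sub]; exact h2) h1.nonneg

lemma isClosed_posSemidef : IsClosed {M : Matrix ι ι ℂ | M.PosSemidef} := by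
  have : {M : Matrix ι ι ℂ | M.PosSemidef} =
      {M | Mᴴ = M} ∩ ⋂ x : ι → ℂ, {M | 0 ≤ star x ⬝ᵥ (M *ᵥ x)} := by
    ext M
    simp [posSemidef_iff_dotProduct_mulVec, IsHermitian]
  rw [this]
  refine IsClosed.inter (isClosed_eq (by fun_prop) (by fun_prop)) (isClosed_iInter fun x => ?_)
  exact isClosed_le (by fun_prop) (by fun_prop)

/-- Gelfand's formula: the spectral radius is below some r < 1, hence ‖M^k‖ ≤ r^k for all large k.
-/
lemma tendsto_pow_atTop_nhds_zero_of_spectrum {M : Matrix ι ι ℂ}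
    (h : ∀ μ ∈ spectrum ℂ M, ‖μ‖ < 1) : Tendsto (fun k : ℕ => M ^ k) atTop (𝓝 0) := by
  have hr : spectralRadius ℂ M < (1 : NNReal) := by
    rcases (spectrum ℂ M).eq_empty_or_nonempty with h0 | h0
    · simp [spectralRadius, h0]
    · exact spectrum.spectralRadius_lt_of_forall_lt_of_nonempty h0 fun k hk => h k hk
  obtain ⟨r, hr1, hr2⟩ := ENNReal.lt_iff_exists_nnreal_btwn.1 hr
  have hr2 : r < 1 := by exact_mod_cast hr2
  have hg := (spectrum.pow_nnnorm_pow_one_div_tendsto_nhds_spectralRadius M).eventually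
    (gt_mem_nhds hr1)
  rw [tendsto_zero_iff_norm_tendsto_zero]
  refine squeeze_zero' (Eventually.of_forall fun _ => norm_nonneg _) ?_
    (tendsto_pow_atTop_nhds_zero_of_lt_one r.2 (by exact_mod_cast hr2))
  filter_upwards [hg, eventually_gt_atTop 0] with k hk hk0
  have hk' : (0 : ℝ) < k := by exact_mod_cast hk0
  rw [one_div, ENNReal.rpow_inv_lt_iff hk', ENNReal.rpow_natCast] at hk
  exact_mod_cast hk.le

/-- A Lyapunov type criterion for a matrix with spectrum in the open upper half-plane. -/
lemma posSemidef_of_lyapunov {M H : Matrix ι ι ℂ} (hM : ∀ μ ∈ spectrum ℂ M, 0 < μ.im)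
    (hL : (Complex.I • (Mᴴ * H - H * M)).PosSemidef) : H.PosSemidef := by
  set i := Complex.I with hi
  have hu : IsUnit (1 - i • M).det := by
    have : (-i) ∉ spectrum ℂ M := fun h => by
      have := hM _ h
      simp [hi] at this
      linarith
    have h1 := (isUnit_det_of_notMem_spectrum this)
    have h2 : (1 - i • M) = i • ((-i) • (1 : Matrix ι ι ℂ) - M) := by
      rw [smul_sub, smul_smul]; simp [hi]
    rw [h2, det_smul]
    exact (IsUnit.pow _ (by simp [hi])).mul h1
  set N := (1 - i • M)⁻¹ with hN
  have hN1 : (1 - i • M) * N = 1 := mul_nonsing_inv _ hu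
  have hN1' : Nᴴ * (1 - i • M)ᴴ = 1 := by rw [← conjTranspose_mul, hN1, conjTranspose_one]
  -- The Cayley transform maps the open upper half-plane to the open unit disc and turns the
  -- Lyapunov inequality into H ≥ K*HK. Iteration gives H ≥ (K^k)*HK^k, and K^k → 0.
  set K := (1 + i • M) * N with hK
  have hstep : (H - Kᴴ * H * K).PosSemidef := by
    have h1 : (Nᴴ * ((2 : ℂ) • (i • (Mᴴ * H - H * M))) * N).PosSemidef :=
      (hL.smul (by norm_num : (0 : ℂ) ≤ 2)).conjTranspose_mul_mul_same N
    have h2 : (2 : ℂ) • (i • (Mᴴ * H - H * M)) =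
        (1 - i • M)ᴴ * H * (1 - i • M) - (1 + i • M)ᴴ * H * (1 + i • M) := by
      simp only [conjTranspose_sub, conjTranspose_add, conjTranspose_one, conjTranspose_smul,
        hi, RCLike.star_def, Complex.conj_I, mul_add, add_mul, mul_sub, sub_mul, one_mul, mul_one,
        Matrix.smul_mul, Matrix.mul_smul, smul_sub, smul_smul, neg_smul, Matrix.neg_mul,
        smul_neg]
      module
    rw [h2] at h1
    convert h1 using 1
    calc H - Kᴴ * H * K = (Nᴴ * (1 - i • M)ᴴ) * H * ((1 - i • M) * N) - Kᴴ * H * K := by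
          rw [hN1, hN1']; simp
      _ = _ := by rw [hK, conjTranspose_mul]; noncomm_ring
  have hKs : ∀ μ ∈ spectrum ℂ K, ‖μ‖ < 1 := by
    intro μ hμ
    obtain ⟨x, hx, hx1⟩ := mem_spectrum_iff_exists_column.1 hμ
    set y := N * x with hy
    have hxy : x = (1 - i • M) * y := by rw [hy, ← Matrix.mul_assoc, hN1, Matrix.one_mul]
    have hy0 : y ≠ 0 := fun h => hx (by rw [hxy, h, Matrix.mul_zero])
    have h1 : (1 + i • M) * y = μ • ((1 - i • M) * y) := by
      rw [← hxy, ← hx1, hK, Matrix.mul_assoc]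
    have h2 : (i * (1 + μ)) • (M * y) = (μ - 1) • y := by
      simp only [Matrix.add_mul, Matrix.sub_mul, Matrix.one_mul, Matrix.smul_mul, smul_sub,
        smul_smul] at h1
      linear_combination (norm := module) h1
    have hne : 1 + μ ≠ 0 := by
      intro h
      rw [h, mul_zero, zero_smul, eq_comm, smul_eq_zero] at h2
      rcases h2 with h2 | h2
      · have : (2 : ℂ) = 0 := by linear_combination h - h2
        norm_num at this
      · exact hy0 h2
    have h3 : M * y = ((μ - 1) / (i * (1 + μ))) • y := by
      have : i * (1 + μ) ≠ 0 := mul_ne_zero (by simp [hi]) hne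
      rw [div_eq_inv_mul, ← smul_smul, ← h2, smul_smul, inv_mul_cancel₀ this, one_smul]
    have h4 := hM _ (mem_spectrum_iff_exists_column.2 ⟨y, hy0, h3⟩)
    have h5 : (μ - 1) / (i * (1 + μ)) = i * ((1 - μ) * star (1 + μ)) / (Complex.normSq (1 + μ)) := by
      rw [Complex.normSq_eq_conj_mul_self, div_eq_div_iff (mul_ne_zero (by simp [hi]) hne)]
      · rw [RCLike.star_def]
        linear_combination (1 - μ) * (starRingEnd ℂ) (1 + μ) * (1 + μ) * (-Complex.I_sq)
      · exact mul_ne_zero ((map_ne_zero _).2 hne) hne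
    rw [h5, Complex.div_ofReal_im] at h4
    have h6 : 0 < (i * ((1 - μ) * star (1 + μ))).im := by
      rcases div_pos_iff.1 h4 with h | h
      · exact h.1
      · exact absurd h.2 (not_lt.2 (Complex.normSq_nonneg _))
    have h7 : (i * ((1 - μ) * star (1 + μ))).im = 1 - (μ.re ^ 2 + μ.im ^ 2) := by
      simp [hi, Complex.mul_re, Complex.mul_im]; ring
    rw [h7] at h6
    rw [← sq_lt_one_iff₀ (norm_nonneg _), ← Complex.normSq_eq_norm_sq, Complex.normSq_apply]
    linarith
  have hk : ∀ k : ℕ, (H - (K ^ k)ᴴ * H * K ^ k).PosSemidef := by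
    intro k
    induction k with
    | zero => simpa using PosSemidef.zero
    | succ k ih =>
      have := hstep.add (ih.conjTranspose_mul_mul_same K)
      convert this using 1
      rw [pow_succ, conjTranspose_mul]
      noncomm_ring
  have hlim : Tendsto (fun k : ℕ => H - (K ^ k)ᴴ * H * K ^ k) atTop (𝓝 (H - (0 : Matrix ι ι ℂ)ᴴ * H * 0)) := by
    have h0 := tendsto_pow_atTop_nhds_zero_of_spectrum hKs
    exact ((continuous_const.sub (by fun_prop :
      Continuous fun L : Matrix ι ι ℂ => Lᴴ * H * L)).tendsto 0).comp h0
  simpa using isClosed_posSemidef.mem_of_tendsto hlim (Eventually.of_forall hk)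

/-- The Sylvester operator `H ↦ M* H - H M` is injective if the spectrum of `M` lies in the open
upper half-plane. -/
lemma eq_zero_of_lyapunov_eq_zero {M H : Matrix ι ι ℂ} (hM : ∀ μ ∈ spectrum ℂ M, 0 < μ.im)
    (h : Mᴴ * H - H * M = 0) : H = 0 := by
  refine (posSemidef_of_lyapunov hM (by rw [h, smul_zero]; exact .zero)).eq_zero_of_neg
    (posSemidef_of_lyapunov hM ?_)
  have : Mᴴ * -H - -H * M = 0 := by rw [← neg_zero, ← h]; noncomm_ring
  rw [this, smul_zero]
  exact .zero

/-- Absence of eigenvalues at z is only an open condition on M, so it is replaced by the closed one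
|Im z|^n ≤ |det(z − M)|. This holds because the determinant is the product of the factors z − μ,
each of modulus at least |Im z|. -/
lemma isClosed_spectrum_subset_im_nonneg :
    IsClosed {M : Matrix ι ι ℂ | spectrum ℂ M ⊆ {z : ℂ | 0 ≤ z.im}} := by
  have : {M : Matrix ι ι ℂ | spectrum ℂ M ⊆ {z : ℂ | 0 ≤ z.im}} =
      ⋂ z : {z : ℂ // z.im < 0}, {M | |z.1.im| ^ Fintype.card ι ≤ ‖(z.1 • (1 : Matrix ι ι ℂ) - M).det‖} := by
    ext M
    simp only [Set.mem_ofPred_eq, Set.mem_iInter, Subtype.forall]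
    constructor
    · intro h z hz
      have h1 : (z • (1 : Matrix ι ι ℂ) - M).det = M.charpoly.eval z := by
        rw [eval_charpoly]; congr 2; ext i j; simp [scalar_apply, diagonal_apply, one_apply]
      have hs : M.charpoly.Splits := IsAlgClosed.splits _
      have h2 : M.charpoly.eval z = (M.charpoly.roots.map (z - ·)).prod :=
        hs.eval_eq_prod_roots_of_monic M.charpoly_monic z
      have hc : M.charpoly.roots.card = Fintype.card ι := by
        rw [← hs.natDegree_eq_card_roots, charpoly_natDegree_eq_dim]
      rw [h1, h2, ← hc]
      have hr : ∀ μ ∈ M.charpoly.roots, |z.im| ≤ ‖z - μ‖ := by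
        intro μ hμ
        have h3 : μ ∈ spectrum ℂ M :=
          mem_spectrum_iff_isRoot_charpoly.2 (Polynomial.isRoot_of_mem_roots hμ)
        have h4 : 0 ≤ μ.im := h h3
        refine le_trans ?_ (Complex.abs_im_le_norm _)
        rw [Complex.sub_im, abs_of_neg hz, abs_of_neg (by linarith)]
        linarith
      generalize M.charpoly.roots = s at hr
      induction s using Multiset.induction_on with
      | empty => simp
      | cons a s ih =>
        simp only [Multiset.card_cons, Multiset.map_cons, Multiset.prod_cons, norm_mul, pow_succ']
        gcongr
        · exact hr a (Multiset.mem_cons_self a s)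
        · exact ih fun μ hμ => hr μ (Multiset.mem_cons_of_mem hμ)
    · intro h μ hμ
      by_contra hlt
      have hlt : μ.im < 0 := not_le.1 hlt
      have h1 := h μ hlt
      have h2 : (μ • (1 : Matrix ι ι ℂ) - M).det = 0 := by
        rw [spectrum.mem_iff, isUnit_iff_isUnit_det, isUnit_iff_ne_zero, not_not,
          Algebra.algebraMap_eq_smul_one] at hμ
        exact hμ
      rw [h2, norm_zero] at h1
      exact absurd h1 (not_le.2 (pow_pos (abs_pos.2 hlt.ne) _))
  rw [this]
  refine isClosed_iInter fun z => isClosed_le (by fun_prop) (by fun_prop)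

lemma isOpen_spectrum_subset {U : Set ℂ} (hU : IsOpen U) :
    IsOpen {M : Matrix ι ι ℂ | spectrum ℂ M ⊆ U} := by
  rw [isOpen_iff_eventually]
  intro M hM
  exact upperHemicontinuous_iff_forall_isOpen.1
    (upperHemicontinuous_spectrum ℂ (Matrix ι ι ℂ)) M U hU hM

end MatrixLemmas

/-! ### Continuity and differentiability of the inverse -/

section Inverse

variable {ι : Type*} [Fintype ι] [DecidableEq ι]

lemma continuousAt_matrix_inv {M : Matrix ι ι ℂ} (h : IsUnit M.det) :
    ContinuousAt (fun N : Matrix ι ι ℂ => N⁻¹) M := by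
  have hM : IsUnit M := (isUnit_iff_isUnit_det _).2 h
  have := NormedRing.inverse_continuousAt hM.unit
  simp_rw [nonsing_inv_eq_ringInverse]
  exact this

lemma differentiableAt_matrix_inv {M : Matrix ι ι ℂ} (h : IsUnit M.det) :
    DifferentiableAt ℂ (fun N : Matrix ι ι ℂ => N⁻¹) M := by
  have hM : IsUnit M := (isUnit_iff_isUnit_det _).2 h
  have := differentiableAt_inverse (𝕜 := ℂ) hM
  simp_rw [nonsing_inv_eq_ringInverse]
  exact this

end Inverse

namespace Realization

variable {m₁ m₂ n : ℕ}

/-! ### Minimal realizations are controllable and observable -/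

lemma transfer_eq_of_intertwining {n' : ℕ} {T : Realization m₁ m₂ n} {T' : Realization m₁ m₂ n'}
    {E : Matrix (Fin n) (Fin n') ℂ} (ha : T.a * E = E * T'.a) (hb : T.b = E * T'.b)
    (hc : T'.c = T.c * E) : T.SameFunction T' := by
  intro z hz hz'
  have h1 := isUnit_det_of_notMem_spectrum hz
  have h2 := isUnit_det_of_notMem_spectrum hz'
  have h3 : (z • (1 : Matrix (Fin n) (Fin n) ℂ) - T.a)⁻¹ * E =
      E * (z • (1 : Matrix (Fin n') (Fin n') ℂ) - T'.a)⁻¹ := by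
    have h4 : (z • (1 : Matrix (Fin n) (Fin n) ℂ) - T.a) * E =
        E * (z • (1 : Matrix (Fin n') (Fin n') ℂ) - T'.a) := by
      rw [Matrix.sub_mul, Matrix.mul_sub, ha]; simp
    calc _ = (z • (1 : Matrix (Fin n) (Fin n) ℂ) - T.a)⁻¹ *
          (E * (z • (1 : Matrix (Fin n') (Fin n') ℂ) - T'.a)) *
            (z • (1 : Matrix (Fin n') (Fin n') ℂ) - T'.a)⁻¹ := by
          rw [Matrix.mul_assoc, Matrix.mul_assoc, mul_nonsing_inv _ h2, Matrix.mul_one]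
      _ = _ := by
          rw [← h4, ← Matrix.mul_assoc (_⁻¹), nonsing_inv_mul _ h1, Matrix.one_mul]
  unfold transfer
  rw [hc, Matrix.mul_assoc T.c E, ← h3, hb]
  simp only [Matrix.mul_assoc]

/-- Restricting the realization to V, in a basis of V, realizes the same function with size dim V;
minimality gives n ≤ dim V. -/
lemma IsMinimal.eq_top {T : Realization m₁ m₂ n} (hT : T.IsMinimal)
    (V : Submodule ℂ (Matrix (Fin n) (Fin 1) ℂ)) (ha : ∀ x ∈ V, T.a * x ∈ V)
    (hb : ∀ u : Matrix (Fin m₂) (Fin 1) ℂ, T.b * u ∈ V) : V = ⊤ := by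
  let e := Module.finBasis ℂ V
  let E : Matrix (Fin n) (Fin (Module.finrank ℂ V)) ℂ := of fun i k => (e k).1 i 0
  let a' : Matrix (Fin (Module.finrank ℂ V)) (Fin (Module.finrank ℂ V)) ℂ :=
    of fun k l => e.repr ⟨T.a * (e l).1, ha _ (e l).2⟩ k
  let b' : Matrix (Fin (Module.finrank ℂ V)) (Fin m₂) ℂ :=
    of fun k l => e.repr ⟨T.b * Matrix.single l 0 1, hb _⟩ k
  have hsum : ∀ (v : V) (i : Fin n), ∑ k, (e k).1 i 0 * e.repr v k = v.1 i 0 := by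
    intro v i
    have := congrArg (fun w : V => w.1 i 0) (e.sum_repr v)
    simp only [Submodule.coe_sum, Submodule.coe_smul, Matrix.sum_apply, Matrix.smul_apply,
      smul_eq_mul] at this
    rw [← this]
    exact Finset.sum_congr rfl fun k _ => mul_comm _ _
  have h := hT (Module.finrank ℂ V) ⟨a', b', T.c * E⟩
    (transfer_eq_of_intertwining (E := E) ?_ ?_ rfl)
  · refine Submodule.eq_top_of_finrank_eq (le_antisymm (Submodule.finrank_le V) ?_)
    rw [Module.finrank_matrix]
    simpa using h
  · ext i l
    have := hsum ⟨T.a * (e l).1, ha _ (e l).2⟩ i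
    simp only [mul_apply, E, a', of_apply] at this ⊢
    exact this.symm
  · ext i l
    have := hsum ⟨T.b * Matrix.single l 0 1, hb _⟩ i
    simp only [mul_apply, E, b', of_apply] at this ⊢
    rw [this]
    simp [single_apply]

/-- The realization `{𝒜*, 𝒞*, ℬ*}` of `z ↦ ψ(z̄)*`. -/
def dual (T : Realization m₁ m₂ n) : Realization m₂ m₁ n := ⟨T.aᴴ, T.cᴴ, T.bᴴ⟩

lemma transfer_dual (T : Realization m₁ m₂ n) (z : ℂ) :
    T.dual.transfer z = (T.transfer (star z))ᴴ := by
  simp [transfer, dual, conjTranspose_nonsing_inv, Matrix.mul_assoc, conjTranspose_smul]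

lemma IsMinimal.dual {T : Realization m₁ m₂ n} (hT : T.IsMinimal) : T.dual.IsMinimal := by
  intro n' T' h
  refine hT n' T'.dual fun z hz hz' => ?_
  have h1 := h (star z) (fun hh => hz ?_) (fun hh => hz' ?_)
  · rw [transfer_dual, star_star] at h1
    rw [transfer_dual, ← h1, conjTranspose_conjTranspose]
  · simpa using conj_mem_spectrum_conjTranspose.1 hh
  · exact conj_mem_spectrum_conjTranspose.2 hh

/-- Duality: the orthogonal complement of W is 𝒜*-invariant and contains the range of 𝒞*, so it is
the whole space by the controllability of the dual realization. -/
lemma IsMinimal.eq_bot {T : Realization m₁ m₂ n} (hT : T.IsMinimal)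
    (W : Submodule ℂ (Matrix (Fin n) (Fin 1) ℂ)) (ha : ∀ x ∈ W, T.a * x ∈ W)
    (hc : ∀ x ∈ W, T.c * x = 0) : W = ⊥ := by
  let V : Submodule ℂ (Matrix (Fin n) (Fin 1) ℂ) :=
    { carrier := {y | ∀ x ∈ W, xᴴ * y = 0}
      add_mem' := fun h1 h2 x hx => by rw [Matrix.mul_add, h1 x hx, h2 x hx, add_zero]
      zero_mem' := fun x _ => Matrix.mul_zero _
      smul_mem' := fun c y h x hx => by rw [Matrix.mul_smul, h x hx, smul_zero] }
  have hV : V = ⊤ := by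
    refine hT.dual.eq_top V (fun y hy x hx => ?_) (fun u x hx => ?_)
    · have := hy _ (ha x hx)
      rwa [conjTranspose_mul, Matrix.mul_assoc] at this
    · have := congrArg conjTranspose (hc x hx)
      rw [conjTranspose_mul, conjTranspose_zero] at this
      change xᴴ * (T.cᴴ * u) = 0
      rw [← Matrix.mul_assoc, this, Matrix.zero_mul]
  rw [eq_bot_iff]
  intro x hx
  have h1 : x ∈ V := by rw [hV]; trivial
  exact conjTranspose_mul_self_eq_zero.1 (h1 x hx)

/-- The eigenvector (Hautus) test: the μ-eigenvectors of 𝒜 killed by 𝒞 form an invariant subspace of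
ker 𝒞. -/
lemma IsMinimal.observable {T : Realization m₁ m₂ n} (hT : T.IsMinimal) {μ : ℂ}
    {x : Matrix (Fin n) (Fin 1) ℂ} (ha : T.a * x = μ • x) (hc : T.c * x = 0) : x = 0 := by
  let W : Submodule ℂ (Matrix (Fin n) (Fin 1) ℂ) :=
    { carrier := {y | T.a * y = μ • y ∧ T.c * y = 0}
      add_mem' := fun h1 h2 => by
        simp [Matrix.mul_add, h1.1, h2.1, h1.2, h2.2]
      zero_mem' := by simp
      smul_mem' := fun c y h => by simp [h.1, h.2, smul_comm c μ] }
  have hW : W = ⊥ := hT.eq_bot W (fun y hy => by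
    rw [hy.1]; exact W.smul_mem _ hy) fun y hy => hy.2
  have : x ∈ W := ⟨ha, hc⟩
  rwa [hW] at this

lemma IsMinimal.controllable {T : Realization m₁ m₂ n} (hT : T.IsMinimal) {μ : ℂ}
    {x : Matrix (Fin n) (Fin 1) ℂ} (ha : T.aᴴ * x = μ • x) (hb : T.bᴴ * x = 0) : x = 0 :=
  hT.dual.observable ha hb

/-! ### Contractivity in the lower half-plane -/

lemma norm_le_one_of_posSemidef {M : Matrix (Fin m₁) (Fin m₂) ℂ} (h : (1 - Mᴴ * M).PosSemidef) :
    ‖M‖ ≤ 1 := by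
  have h1 : ‖Mᴴ * M‖ ≤ 1 := by
    open scoped MatrixOrder in
    rw [CStarAlgebra.norm_le_one_iff_of_nonneg _ (posSemidef_conjTranspose_mul_self M).nonneg]
    exact h
  rw [l2_opNorm_conjTranspose_mul_self] at h1
  nlinarith [norm_nonneg M]

lemma continuousAt_transfer (T : Realization m₁ m₂ n) {w : ℂ} (hw : w ∉ spectrum ℂ T.a) :
    ContinuousAt T.transfer w := by
  have h1 : ContinuousAt (fun z : ℂ => (z • (1 : Matrix (Fin n) (Fin n) ℂ) - T.a)⁻¹) w :=
    ContinuousAt.comp (f := fun z : ℂ => z • (1 : Matrix (Fin n) (Fin n) ℂ) - T.a)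
      (continuousAt_matrix_inv (isUnit_det_of_notMem_spectrum hw)) (by fun_prop)
  have h2 : Continuous fun M : Matrix (Fin n) (Fin n) ℂ => T.c * M * T.b := by fun_prop
  exact h2.continuousAt.comp h1

lemma eventually_notMem_spectrum (T : Realization m₁ m₂ n) (w : ℂ) :
    ∀ᶠ t : ℝ in 𝓝[>] 0, w - Complex.I * t ∉ spectrum ℂ T.a := by
  have hfin : ((spectrum ℂ T.a) \ {w}).Finite := (Matrix.finite_spectrum T.a).sdiff
  have h1 : ∀ᶠ z in 𝓝 w, z ∉ (spectrum ℂ T.a) \ {w} :=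
    hfin.isClosed.isOpen_compl.mem_nhds (by simp)
  have h2 : Tendsto (fun t : ℝ => w - Complex.I * t) (𝓝[>] 0) (𝓝 w) := by
    have : Continuous fun t : ℝ => w - Complex.I * t := by fun_prop
    simpa using (this.tendsto 0).mono_left nhdsWithin_le_nhds
  filter_upwards [h2.eventually h1, self_mem_nhdsWithin] with t ht ht0 hmem
  refine ht ⟨hmem, fun h => ?_⟩
  have ht0 : (0 : ℝ) < t := ht0
  have h : w - Complex.I * t = w := h
  have : Complex.I * t = 0 := by linear_combination -h
  simp at this
  exact ht0.ne' this

/-- Suppose Im μ ≤ 0 and approach μ vertically from below. The vectors x for which 𝒞(z − 𝒜)⁻¹x stays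
bounded form an 𝒜-invariant subspace, which contains the range of ℬ because ‖ψ‖ ≤ 1; by
controllability it is everything. For an eigenvector x at μ this quantity is (z − μ)⁻¹𝒞x, so 𝒞x = 0,
against observability. Real eigenvalues are excluded as well. -/
lemma im_pos_of_mem_spectrum {T : Realization m₁ m₂ n} (hT : T ∈ classG m₁ m₂ n) {μ : ℂ}
    (hμ : μ ∈ spectrum ℂ T.a) : 0 < μ.im := by
  by_contra hle
  rw [not_lt] at hle
  let z : ℝ → ℂ := fun t => μ - Complex.I * t
  let G : ℝ → Matrix (Fin n) (Fin n) ℂ := fun t => (z t • 1 - T.a)⁻¹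
  have hz : ∀ᶠ t in 𝓝[>] (0 : ℝ), z t ∉ spectrum ℂ T.a := T.eventually_notMem_spectrum μ
  have hzO : z =O[𝓝[>] (0 : ℝ)] (fun _ => (1 : ℝ)) := by
    have : Continuous z := by fun_prop
    exact ((this.tendsto 0).mono_left nhdsWithin_le_nhds).isBigO_one ℝ
  let V : Submodule ℂ (Matrix (Fin n) (Fin 1) ℂ) :=
    { carrier := {x | (fun t => T.c * G t * x) =O[𝓝[>] (0 : ℝ)] (fun _ => (1 : ℝ))}
      add_mem' := fun h1 h2 => by
        simpa [Matrix.mul_add] using Asymptotics.IsBigO.add h1 h2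
      zero_mem' := by
        simpa using Asymptotics.isBigO_zero (E' := Matrix (Fin m₁) (Fin 1) ℂ)
          (fun _ : ℝ => (1 : ℝ)) (𝓝[>] (0 : ℝ))
      smul_mem' := fun c y h => by
        simpa using Asymptotics.IsBigO.const_smul_left h c }
  have hV : V = ⊤ := by
    refine hT.1.eq_top V (fun x hx => ?_) fun u => ?_
    · have h1 : (fun t => z t • (T.c * G t * x) - T.c * x) =O[𝓝[>] (0 : ℝ)] (fun _ => (1 : ℝ)) := by
        refine Asymptotics.IsBigO.sub ?_ (Asymptotics.isBigO_const_const _ one_ne_zero _)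
        simpa using hzO.smul hx
      refine h1.congr' ?_ EventuallyEq.rfl
      filter_upwards [hz] with t ht
      have h2 : G t * (z t • 1 - T.a) = 1 := nonsing_inv_mul _ (isUnit_det_of_notMem_spectrum ht)
      have h3 : G t * T.a = z t • G t - 1 := by
        rw [← h2, Matrix.mul_sub, Matrix.mul_smul, Matrix.mul_one]; abel
      rw [← Matrix.mul_assoc (T.c * G t), Matrix.mul_assoc T.c (G t) T.a, h3]
      simp [Matrix.mul_sub, Matrix.sub_mul]
    · refine Asymptotics.IsBigO.of_bound ‖u‖ ?_
      filter_upwards [hz, self_mem_nhdsWithin] with t ht ht0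
      have h1 : ‖T.transfer (z t)‖ ≤ 1 := by
        refine norm_le_one_of_posSemidef (hT.2 _ ?_ ht)
        have : (0 : ℝ) < t := ht0
        simp [z]; linarith
      have h2 : T.c * G t * (T.b * u) = T.transfer (z t) * u := by
        simp [transfer, G, Matrix.mul_assoc]
      rw [h2, norm_one, mul_one]
      calc _ ≤ ‖T.transfer (z t)‖ * ‖u‖ := l2_opNorm_mul _ _
        _ ≤ 1 * ‖u‖ := by gcongr
        _ = _ := one_mul _
  obtain ⟨x, hx0, hx⟩ := mem_spectrum_iff_exists_column.1 hμ
  refine hx0 (hT.1.observable hx ?_)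
  have hxV : x ∈ V := by rw [hV]; trivial
  -- Multiplication by z − μ = −it turns boundedness into 𝒞x = O(t), and the left-hand side does not
  -- depend on t.
  have h1 : (fun t : ℝ => T.c * x) =O[𝓝[>] (0 : ℝ)] (fun t => (t : ℝ)) := by
    have h2 : (fun t : ℝ => (-Complex.I * t) • (T.c * G t * x)) =O[𝓝[>] (0 : ℝ)]
        (fun t => (t : ℝ)) := by
      have h3 : (fun t : ℝ => -Complex.I * t) =O[𝓝[>] (0 : ℝ)] (fun t => (t : ℝ)) :=
        Asymptotics.IsBigO.of_bound 1 (Eventually.of_forall fun t => by simp)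
      simpa using h3.smul hxV
    refine h2.congr' ?_ EventuallyEq.rfl
    filter_upwards [hz] with t ht
    have h4 : G t * (z t • 1 - T.a) = 1 := nonsing_inv_mul _ (isUnit_det_of_notMem_spectrum ht)
    have h5 : (z t • 1 - T.a) * x = (-Complex.I * t) • x := by
      rw [Matrix.sub_mul, hx, Matrix.smul_mul, Matrix.one_mul, ← sub_smul]
      simp [z]
    rw [← Matrix.mul_smul, ← h5, Matrix.mul_assoc T.c, ← Matrix.mul_assoc (G t), h4,
      Matrix.one_mul]
  have h2 : Tendsto (fun t : ℝ => T.c * x) (𝓝[>] (0 : ℝ)) (𝓝 0) :=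
    h1.trans_tendsto (tendsto_id.mono_left nhdsWithin_le_nhds)
  exact tendsto_nhds_unique tendsto_const_nhds h2

lemma notMem_spectrum_of_im_nonpos {T : Realization m₁ m₂ n} (hT : T ∈ classG m₁ m₂ n) {w : ℂ}
    (hw : w.im ≤ 0) : w ∉ spectrum ℂ T.a :=
  fun h => not_lt.2 hw (im_pos_of_mem_spectrum hT h)

/-- There are no poles on the real axis, so contractivity extends to it by continuity. -/
lemma posSemidef_of_im_nonpos {T : Realization m₁ m₂ n} (hT : T ∈ classG m₁ m₂ n) {w : ℂ}
    (hw : w.im ≤ 0) : (1 - (T.transfer w)ᴴ * T.transfer w).PosSemidef := by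
  have h1 : Tendsto (fun t : ℝ => T.transfer (w - Complex.I * t)) (𝓝[>] 0) (𝓝 (T.transfer w)) := by
    refine (T.continuousAt_transfer (notMem_spectrum_of_im_nonpos hT hw)).tendsto.comp ?_
    have : Continuous fun t : ℝ => w - Complex.I * t := by fun_prop
    simpa using (this.tendsto 0).mono_left nhdsWithin_le_nhds
  have h2 : Continuous fun M : Matrix (Fin m₁) (Fin m₂) ℂ => 1 - Mᴴ * M := by fun_prop
  refine isClosed_posSemidef.mem_of_tendsto ((h2.tendsto _).comp h1) ?_
  filter_upwards [self_mem_nhdsWithin] with t ht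
  have h3 : (w - Complex.I * t).im < 0 := by
    have : (0 : ℝ) < t := ht
    simp; linarith
  exact hT.2 _ h3 (notMem_spectrum_of_im_nonpos hT h3.le)

end Realization

/-! ### Invariant subspaces and intertwining relations -/

section MatrixLemmas

variable {ι : Type*} [Fintype ι] [DecidableEq ι]

lemma exists_eigenvector_of_invariant {M : Matrix ι ι ℂ} {V : Submodule ℂ (Matrix ι (Fin 1) ℂ)}
    (hV : V ≠ ⊥) (hM : ∀ x ∈ V, M * x ∈ V) : ∃ x ∈ V, x ≠ 0 ∧ ∃ μ : ℂ, M * x = μ • x := by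
  let f : Module.End ℂ V :=
    { toFun := fun x => ⟨M * x.1, hM _ x.2⟩
      map_add' := fun x y => by ext1; simp [Matrix.mul_add]
      map_smul' := fun c x => by ext1; simp }
  have : Nontrivial V := Submodule.nontrivial_iff_ne_bot.2 hV
  obtain ⟨μ, hμ⟩ := Module.End.exists_eigenvalue f
  obtain ⟨v, hv, hv0⟩ := hμ.exists_hasEigenvector
  refine ⟨v.1, v.2, fun h => hv0 (Subtype.ext h), μ, ?_⟩
  have := congrArg Subtype.val (Module.End.mem_eigenspace_iff.1 hv)
  simpa [f] using this

/-- D need not be injective, so w need not be an eigenvector of N. But D p(N) w = p(μ) D w for every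
polynomial p, and for the characteristic polynomial of N the left side vanishes by Cayley–Hamilton.
-/
lemma mem_spectrum_of_intertwining {D M N : Matrix ι ι ℂ} (h : M * D = D * N)
    {w : Matrix ι (Fin 1) ℂ} {μ : ℂ} (hw : D * w ≠ 0) (hμ : M * (D * w) = μ • (D * w)) :
    μ ∈ spectrum ℂ N := by
  have hpow : ∀ k : ℕ, D * (N ^ k * w) = μ ^ k • (D * w) := by
    intro k
    induction k with
    | zero => simp
    | succ k ih =>
      rw [pow_succ', Matrix.mul_assoc N, ← Matrix.mul_assoc D, ← h, Matrix.mul_assoc M, ih,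
        Matrix.mul_smul, hμ, smul_smul, pow_succ]
  have hp : ∀ p : Polynomial ℂ, D * (Polynomial.aeval N p * w) = p.eval μ • (D * w) := by
    intro p
    induction p using Polynomial.induction_on' with
    | add p q hp hq => simp [Matrix.add_mul, Matrix.mul_add, hp, hq, add_smul]
    | monomial k c =>
      rw [Polynomial.aeval_monomial, Polynomial.eval_monomial, Algebra.algebraMap_eq_smul_one,
        smul_mul_assoc, one_mul, Matrix.smul_mul, Matrix.mul_smul, hpow, smul_smul]
  have := hp N.charpoly
  rw [aeval_self_charpoly, Matrix.zero_mul, Matrix.mul_zero, eq_comm, smul_eq_zero] at this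
  exact mem_spectrum_iff_isRoot_charpoly.2 (this.resolve_right hw)

lemma eq_zero_of_forall_mul_column {κ : Type*} [Fintype κ] {M : Matrix κ ι ℂ}
    (h : ∀ x : Matrix ι (Fin 1) ℂ, M * x = 0) : M = 0 := by
  ext i j
  have := congrFun (congrFun (h (Matrix.single j 0 1)) i) 0
  simpa using this

end MatrixLemmas

namespace Realization

variable {m₁ m₂ n : ℕ}

/-! ### Uniqueness of the solution of the Riccati equation with the spectral condition -/

lemma riccati_iff {T : Realization m₁ m₂ n} {X : Matrix (Fin n) (Fin n) ℂ} :
    T.Riccati X ↔ Complex.I • (T.aᴴ * X - X * T.a) = X * T.b * T.bᴴ * X + T.cᴴ * T.c := by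
  unfold Riccati
  rw [sub_add_eq_add_sub, sub_eq_zero, eq_comm]

lemma conjTranspose_recA (T : Realization m₁ m₂ n) (X : Matrix (Fin n) (Fin n) ℂ) :
    (T.recA X)ᴴ = T.aᴴ + Complex.I • (Xᴴ * (T.b * T.bᴴ)) := by
  simp [recA, conjTranspose_smul, Matrix.mul_assoc]

/-- In the difference of the two Riccati equations 𝒞*𝒞 cancels, and the quadratic terms are absorbed
by the two closed-loop matrices. -/
lemma recA_intertwining {T : Realization m₁ m₂ n} {X Y : Matrix (Fin n) (Fin n) ℂ}
    (hX : X.IsHermitian) (h1 : T.Riccati X) (h2 : T.Riccati Y) :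
    (T.recA X)ᴴ * (Y - X) = (Y - X) * T.recA Y := by
  rw [riccati_iff] at h1 h2
  have h1' := congrArg (Complex.I • ·) h1
  have h2' := congrArg (Complex.I • ·) h2
  simp only [smul_smul, Complex.I_mul_I] at h1' h2'
  rw [conjTranspose_recA, hX.eq, recA]
  simp only [Matrix.add_mul, Matrix.mul_sub, Matrix.sub_mul, Matrix.smul_mul, Matrix.mul_smul,
    Matrix.mul_assoc, smul_add, smul_sub] at *
  linear_combination (norm := module) h1' - h2'

/-- If D = Y − X ≠ 0, the range of D is invariant under A_X* and contains an eigenvector Dw of it,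
with eigenvalue μ. The spectral condition for X gives Im μ ≤ 0, and by the intertwining the one for
Y gives Im μ ≥ 0, so μ is real. Comparing w*A_X*Dw with its adjoint then yields ℬ*Dw = 0, whence
𝒜*Dw = μDw, which contradicts controllability. -/
lemma IsMinimal.riccati_unique {T : Realization m₁ m₂ n} (hT : T.IsMinimal)
    {X Y : Matrix (Fin n) (Fin n) ℂ} (hX : X.IsHermitian) (hY : Y.IsHermitian)
    (hX1 : T.Riccati X) (hY1 : T.Riccati Y) (hX2 : spectrum ℂ (T.recA X) ⊆ {z : ℂ | 0 ≤ z.im})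
    (hY2 : spectrum ℂ (T.recA Y) ⊆ {z : ℂ | 0 ≤ z.im}) : X = Y := by
  obtain ⟨D, hD⟩ : ∃ D, D = Y - X := ⟨_, rfl⟩
  have hDH : Dᴴ = D := by rw [hD, conjTranspose_sub, hX.eq, hY.eq]
  have hint : (T.recA X)ᴴ * D = D * T.recA Y := by
    rw [hD]; exact recA_intertwining hX hX1 hY1
  by_contra hne
  let V : Submodule ℂ (Matrix (Fin n) (Fin 1) ℂ) :=
    { carrier := Set.range fun w => D * w
      add_mem' := by
        rintro _ _ ⟨u, rfl⟩ ⟨v, rfl⟩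
        exact ⟨u + v, Matrix.mul_add _ _ _⟩
      zero_mem' := ⟨0, Matrix.mul_zero _⟩
      smul_mem' := by
        rintro c _ ⟨u, rfl⟩
        exact ⟨c • u, Matrix.mul_smul _ _ _⟩ }
  have hV : V ≠ ⊥ := by
    intro h
    apply hne
    have : D = 0 := eq_zero_of_forall_mul_column fun x => by
      have : D * x ∈ V := ⟨x, rfl⟩
      rwa [h] at this
    exact (sub_eq_zero.1 (hD ▸ this)).symm
  obtain ⟨_, ⟨w, rfl⟩, hv0, μ, hμ⟩ := exists_eigenvector_of_invariant (M := (T.recA X)ᴴ) hV (by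
    rintro _ ⟨u, rfl⟩
    refine ⟨T.recA Y * u, ?_⟩
    change D * (T.recA Y * u) = (T.recA X)ᴴ * (D * u)
    rw [← Matrix.mul_assoc, ← Matrix.mul_assoc, hint])
  have hv0 : D * w ≠ 0 := hv0
  have hμ : (T.recA X)ᴴ * (D * w) = μ • (D * w) := hμ
  have h1 : 0 ≤ (star μ).im :=
    hX2 (conj_mem_spectrum_conjTranspose.1 (mem_spectrum_iff_exists_column.2 ⟨_, hv0, hμ⟩))
  have h2 : 0 ≤ μ.im := hY2 (mem_spectrum_of_intertwining hint hv0 hμ)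
  have h3 : star μ = μ := by
    rw [RCLike.star_def, Complex.conj_im] at h1
    exact Complex.conj_eq_iff_im.2 (by linarith)
  have h4 : T.recA Y = T.recA X - Complex.I • (T.b * T.bᴴ * D) := by
    simp only [recA, hD, Matrix.mul_sub, smul_sub]; abel
  have h5 : T.bᴴ * (D * w) = 0 := by
    rw [← conjTranspose_mul_self_eq_zero]
    have h6 : wᴴ * ((T.recA X)ᴴ * (D * w)) = μ • (wᴴ * (D * w)) := by rw [hμ, Matrix.mul_smul]
    have h7 : wᴴ * (D * (T.recA X * w)) = μ • (wᴴ * (D * w)) := by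
      have := congrArg conjTranspose h6
      rwa [conjTranspose_smul, h3, conjTranspose_mul, conjTranspose_mul, conjTranspose_mul,
        conjTranspose_conjTranspose, conjTranspose_conjTranspose, conjTranspose_mul,
        conjTranspose_mul, conjTranspose_conjTranspose, hDH, Matrix.mul_assoc, Matrix.mul_assoc,
        Matrix.mul_assoc] at this
    have h8 : wᴴ * ((T.recA X)ᴴ * (D * w)) = wᴴ * (D * (T.recA Y * w)) := by
      rw [← Matrix.mul_assoc _ D, hint, Matrix.mul_assoc D]
    rw [h6, h4, Matrix.sub_mul, Matrix.mul_sub, Matrix.mul_sub, h7, eq_comm, sub_eq_self] at h8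
    simp only [Matrix.smul_mul, Matrix.mul_smul, smul_eq_zero, Complex.I_ne_zero, false_or] at h8
    rw [← h8]
    simp only [conjTranspose_mul, conjTranspose_conjTranspose, hDH, Matrix.mul_assoc]
  refine hv0 (hT.controllable (μ := μ) ?_ h5)
  rw [← hμ, conjTranspose_recA, Matrix.add_mul, Matrix.smul_mul, Matrix.mul_assoc, Matrix.mul_assoc,
    h5]
  simp

/-! ### Compactness of sets of solutions -/

/-- Controllability: no proper `𝒜`-invariant subspace contains the range of `ℬ`. -/
def IsReachable (T : Realization m₁ m₂ n) : Prop :=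
  ∀ V : Submodule ℂ (Matrix (Fin n) (Fin 1) ℂ), (∀ x ∈ V, T.a * x ∈ V) →
    (∀ u : Matrix (Fin m₂) (Fin 1) ℂ, T.b * u ∈ V) → V = ⊤

lemma IsMinimal.isReachable {T : Realization m₁ m₂ n} (hT : T.IsMinimal) : T.IsReachable :=
  hT.eq_top

lemma tendsto_of_tendsto_distance {α : Type*} {l : Filter α} {T : Realization m₁ m₂ n}
    {U : α → Realization m₁ m₂ n} (h : Tendsto (fun k => T.distance (U k)) l (𝓝 0)) :
    Tendsto (fun k => (U k).a) l (𝓝 T.a) ∧ Tendsto (fun k => (U k).b) l (𝓝 T.b) ∧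
      Tendsto (fun k => (U k).c) l (𝓝 T.c) := by
  refine ⟨?_, ?_, ?_⟩ <;> rw [tendsto_iff_norm_sub_tendsto_zero] <;>
    refine squeeze_zero (fun _ => norm_nonneg _) (fun k => ?_) h <;> rw [norm_sub_rev, distance]
  · linarith [norm_nonneg (T.b - (U k).b), norm_nonneg (T.c - (U k).c)]
  · linarith [norm_nonneg (T.a - (U k).a), norm_nonneg (T.c - (U k).c)]
  · linarith [norm_nonneg (T.a - (U k).a), norm_nonneg (T.b - (U k).b)]

lemma distance_nonneg (T U : Realization m₁ m₂ n) : 0 ≤ T.distance U := by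
  unfold distance; positivity

instance properSpace_matrix {ι κ : Type*} [Fintype ι] [Fintype κ] [DecidableEq κ] :
    ProperSpace (Matrix ι κ ℂ) := FiniteDimensional.proper ℂ _

/-- The Hermitian solutions of the Riccati equation are locally uniformly bounded. -/
lemma IsReachable.exists_bound {T : Realization m₁ m₂ n} (hT : T.IsReachable) :
    ∃ δ > 0, ∃ R : ℝ, ∀ U : Realization m₁ m₂ n, T.distance U < δ →
      ∀ X : Matrix (Fin n) (Fin n) ℂ, X.IsHermitian → U.Riccati X → ‖X‖ ≤ R := by
  by_contra! hcon
  choose U hU X hXH hX hXn using fun k : ℕ => hcon (1 / ((k : ℝ) + 1)) (by positivity) k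
  have hd : Tendsto (fun k => T.distance (U k)) atTop (𝓝 0) :=
    squeeze_zero (fun _ => distance_nonneg _ _) (fun k => (hU k).le)
      tendsto_one_div_add_atTop_nhds_zero_nat
  obtain ⟨hta, htb, htc⟩ := tendsto_of_tendsto_distance hd
  let s : ℕ → ℂ := fun k => ((‖X k‖⁻¹ : ℝ) : ℂ)
  -- Blow-up argument: normalize the unbounded solutions and study a limit Z of norm 1;
  -- controllability will force Z = 0.
  let Y : ℕ → Matrix (Fin n) (Fin n) ℂ := fun k => s k • X k
  have hpos : ∀ k, 0 < ‖X k‖ := fun k => lt_of_le_of_lt (Nat.cast_nonneg k) (hXn k)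
  have hs0 : ∀ k, 0 ≤ s k := fun k => by simp [s]
  have hsstar : ∀ k, star (s k) = s k := fun k => by simp [s]
  have hs : Tendsto s atTop (𝓝 0) := by
    have h1 : Tendsto (fun k => ‖X k‖) atTop atTop :=
      tendsto_atTop_mono (fun k => (hXn k).le) tendsto_natCast_atTop_atTop
    have h2 := (Complex.continuous_ofReal.tendsto 0).comp h1.inv_tendsto_atTop
    simpa [s, Function.comp_def] using h2
  have hYn : ∀ k, Y k ∈ Metric.sphere (0 : Matrix (Fin n) (Fin n) ℂ) 1 := fun k => by
    simp [Y, s, norm_smul, (hpos k).ne']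
  obtain ⟨Z, hZ, φ, hφ, hlim⟩ := (isCompact_sphere (0 : Matrix (Fin n) (Fin n) ℂ) 1).tendsto_subseq hYn
  have hsφ := hs.comp hφ.tendsto_atTop
  have haφ := hta.comp hφ.tendsto_atTop
  have hbφ := htb.comp hφ.tendsto_atTop
  have hcφ := htc.comp hφ.tendsto_atTop
  have hYH : ∀ k, (Y k)ᴴ = Y k := fun k => by
    simp only [Y, conjTranspose_smul, hsstar, (hXH k).eq]
  have hZH : Zᴴ = Z := by
    refine tendsto_nhds_unique ((Continuous.matrix_conjTranspose continuous_id).tendsto Z |>.comp hlim) ?_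
    refine hlim.congr fun k => ?_
    simp [hYH]
  have hbar : Tendsto (fun k => ((U (φ k)).a, (U (φ k)).b, (U (φ k)).c, Y (φ k), s (φ k))) atTop
      (𝓝 (T.a, T.b, T.c, Z, 0)) :=
    haφ.prodMk_nhds (hbφ.prodMk_nhds (hcφ.prodMk_nhds (hlim.prodMk_nhds hsφ)))
  -- Divided by ‖X_k‖², the Riccati equation keeps only its quadratic term in the limit: Zℬℬ*Z = 0.
  have hbZ : T.bᴴ * Z = 0 := by
    let F : Matrix (Fin n) (Fin n) ℂ × Matrix (Fin n) (Fin m₂) ℂ × Matrix (Fin m₁) (Fin n) ℂ ×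
        Matrix (Fin n) (Fin n) ℂ × ℂ → Matrix (Fin n) (Fin n) ℂ := fun p =>
      p.2.2.2.1 * p.2.1 * p.2.1ᴴ * p.2.2.2.1 + p.2.2.2.2 ^ 2 • (p.2.2.1ᴴ * p.2.2.1) -
        p.2.2.2.2 • (Complex.I • (p.1ᴴ * p.2.2.2.1 - p.2.2.2.1 * p.1))
    have hF : Continuous F := by fun_prop
    have h1 := (hF.tendsto _).comp hbar
    have h2 : ∀ k, F ((U (φ k)).a, (U (φ k)).b, (U (φ k)).c, Y (φ k), s (φ k)) = 0 := by
      intro k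
      have h3 := riccati_iff.1 (hX (φ k))
      have h4 := congrArg (s (φ k) ^ 2 • ·) h3
      simp only [F, Y, Matrix.smul_mul, Matrix.mul_smul, smul_smul, smul_add, smul_sub] at h4 ⊢
      linear_combination (norm := module) -h4
    have h3 : F (T.a, T.b, T.c, Z, 0) = 0 := by
      refine tendsto_nhds_unique h1 (tendsto_const_nhds.congr fun k => ?_)
      exact (h2 k).symm
    rw [← conjTranspose_mul_self_eq_zero, ← h3]
    simp [F, hZH, Matrix.mul_assoc]
  -- Divided by ‖X_k‖ only, the equation retains the sign of its linear part. This sign makes ker Z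
  -- invariant under 𝒜 below.
  have hL : (Complex.I • (T.aᴴ * Z - Z * T.a)).PosSemidef := by
    let F : Matrix (Fin n) (Fin n) ℂ × Matrix (Fin n) (Fin n) ℂ → Matrix (Fin n) (Fin n) ℂ :=
      fun p => Complex.I • (p.1ᴴ * p.2 - p.2 * p.1)
    have hF : Continuous F := by fun_prop
    refine isClosed_posSemidef.mem_of_tendsto ((hF.tendsto (T.a, Z)).comp
      (haφ.prodMk_nhds hlim)) (Eventually.of_forall fun k => ?_)
    have h3 := riccati_iff.1 (hX (φ k))
    have h4 : F ((U (φ k)).a, Y (φ k)) = s (φ k) • (((U (φ k)).bᴴ * X (φ k))ᴴ *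
        ((U (φ k)).bᴴ * X (φ k)) + (U (φ k)).cᴴ * (U (φ k)).c) := by
      rw [conjTranspose_mul, conjTranspose_conjTranspose, (hXH _).eq, ← Matrix.mul_assoc, ← h3]
      simp only [F, Y, Matrix.mul_smul, Matrix.smul_mul, ← smul_sub]
      rw [smul_comm]
    change (F ((U (φ k)).a, Y (φ k))).PosSemidef
    rw [h4]
    exact ((posSemidef_conjTranspose_mul_self _).add
      (posSemidef_conjTranspose_mul_self _)).smul (hs0 _)
  let V : Submodule ℂ (Matrix (Fin n) (Fin 1) ℂ) :=
    { carrier := {y | Z * y = 0}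
      add_mem' := fun {x y} h1 h2 => by
        change Z * (x + y) = 0
        rw [Matrix.mul_add, h1, h2, add_zero]
      zero_mem' := Matrix.mul_zero _
      smul_mem' := fun c y h => by
        change Z * (c • y) = 0
        rw [Matrix.mul_smul, h, smul_zero] }
  have hV : V = ⊤ := by
    refine hT V (fun y hy => ?_) (fun u => ?_)
    · have hy : Z * y = 0 := hy
      have hy' : yᴴ * Z = 0 := by
        have := congrArg conjTranspose hy
        rwa [conjTranspose_mul, hZH, conjTranspose_zero] at this
      have h1 : (Complex.I • (T.aᴴ * Z - Z * T.a)) * y = 0 := by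
        refine hL.mul_eq_zero_of_conj_eq_zero ?_
        simp only [Matrix.mul_smul, Matrix.smul_mul, Matrix.mul_sub, Matrix.sub_mul,
          Matrix.mul_assoc, hy]
        rw [← Matrix.mul_assoc yᴴ Z, hy']
        simp
      simp only [Matrix.smul_mul, Matrix.sub_mul, Matrix.mul_assoc, hy, Matrix.mul_zero, zero_sub,
        smul_neg, neg_eq_zero, smul_eq_zero, Complex.I_ne_zero, false_or] at h1
      exact h1
    · have := congrArg conjTranspose hbZ
      rw [conjTranspose_mul, hZH, conjTranspose_conjTranspose, conjTranspose_zero] at this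
      change Z * (T.b * u) = 0
      rw [← Matrix.mul_assoc, this, Matrix.zero_mul]
  have hZ0 : Z = 0 := eq_zero_of_forall_mul_column fun x => by
    have : x ∈ V := by rw [hV]; trivial
    exact this
  rw [hZ0] at hZ
  simp at hZ

lemma continuous_recA (T : Realization m₁ m₂ n) : Continuous T.recA := by
  unfold recA; fun_prop

/-- The solutions are bounded, and the Riccati equation and the closed half-plane condition both
survive limits. This one compactness statement serves the continuation in t, the limit t → 1 and the
continuous dependence of X. -/
lemma IsReachable.exists_subseq_tendsto {T : Realization m₁ m₂ n} (hT : T.IsReachable)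
    {U : ℕ → Realization m₁ m₂ n} (hU : Tendsto (fun k => T.distance (U k)) atTop (𝓝 0))
    {X : ℕ → Matrix (Fin n) (Fin n) ℂ} (hXH : ∀ k, (X k).IsHermitian)
    (hX : ∀ k, (U k).Riccati (X k))
    (hs : ∀ k, spectrum ℂ ((U k).recA (X k)) ⊆ {z : ℂ | 0 ≤ z.im}) :
    ∃ Y : Matrix (Fin n) (Fin n) ℂ, Y.IsHermitian ∧ T.Riccati Y ∧
      spectrum ℂ (T.recA Y) ⊆ {z : ℂ | 0 ≤ z.im} ∧
      ∃ φ : ℕ → ℕ, StrictMono φ ∧ Tendsto (X ∘ φ) atTop (𝓝 Y) := by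
  obtain ⟨δ, hδ, R, hR⟩ := hT.exists_bound
  have h1 : ∀ᶠ k in atTop, X k ∈ Metric.closedBall (0 : Matrix (Fin n) (Fin n) ℂ) R := by
    filter_upwards [hU.eventually (gt_mem_nhds hδ)] with k hk
    simpa using hR _ hk _ (hXH k) (hX k)
  obtain ⟨Y, -, φ, hφ, hlim⟩ :=
    (isCompact_closedBall (0 : Matrix (Fin n) (Fin n) ℂ) R).tendsto_subseq' h1.frequently
  obtain ⟨hta, htb, htc⟩ := tendsto_of_tendsto_distance (hU.comp hφ.tendsto_atTop)
  have hbar : Tendsto (fun k => ((U (φ k)).a, (U (φ k)).b, (U (φ k)).c, X (φ k))) atTop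
      (𝓝 (T.a, T.b, T.c, Y)) :=
    hta.prodMk_nhds (htb.prodMk_nhds (htc.prodMk_nhds hlim))
  refine ⟨Y, ?_, ?_, ?_, φ, hφ, hlim⟩
  · refine tendsto_nhds_unique ((Continuous.matrix_conjTranspose continuous_id).tendsto Y |>.comp hlim) ?_
    refine hlim.congr fun k => ?_
    exact (hXH (φ k)).eq.symm
  · let F : Matrix (Fin n) (Fin n) ℂ × Matrix (Fin n) (Fin m₂) ℂ × Matrix (Fin m₁) (Fin n) ℂ ×
        Matrix (Fin n) (Fin n) ℂ → Matrix (Fin n) (Fin n) ℂ := fun p =>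
      p.2.2.2 * p.2.1 * p.2.1ᴴ * p.2.2.2 - Complex.I • (p.1ᴴ * p.2.2.2 - p.2.2.2 * p.1) +
        p.2.2.1ᴴ * p.2.2.1
    have hF : Continuous F := by fun_prop
    have h2 : ∀ k, F ((U (φ k)).a, (U (φ k)).b, (U (φ k)).c, X (φ k)) = 0 := fun k => hX (φ k)
    have h1 := (hF.tendsto _).comp hbar
    have h3 : F (T.a, T.b, T.c, Y) = 0 :=
      tendsto_nhds_unique h1 (tendsto_const_nhds.congr fun k => (h2 k).symm)
    exact h3
  · let F : Matrix (Fin n) (Fin n) ℂ × Matrix (Fin n) (Fin m₂) ℂ × Matrix (Fin m₁) (Fin n) ℂ ×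
        Matrix (Fin n) (Fin n) ℂ → Matrix (Fin n) (Fin n) ℂ := fun p =>
      p.1 - Complex.I • (p.2.1 * p.2.1ᴴ * p.2.2.2)
    have hF : Continuous F := by fun_prop
    have h2 : Tendsto (fun k => (U (φ k)).recA (X (φ k))) atTop (𝓝 (T.recA Y)) :=
      (hF.tendsto _).comp hbar
    exact isClosed_spectrum_subset_im_nonneg.mem_of_tendsto h2
      (Eventually.of_forall fun k => hs (φ k))

end Realization

namespace Realization

variable {m₁ m₂ n : ℕ}

/-! ### Existence of the solution of the Riccati equation with the spectral condition -/

/-- The realization `{𝒜, ℬ, √t 𝒞}` of `√t ψ`. -/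
noncomputable def scale (t : ℝ) (T : Realization m₁ m₂ n) : Realization m₁ m₂ n :=
  ⟨T.a, T.b, ((√t : ℝ) : ℂ) • T.c⟩

lemma scale_gram {t : ℝ} (ht : 0 ≤ t) (T : Realization m₁ m₂ n) :
    (T.scale t).cᴴ * (T.scale t).c = (t : ℂ) • (T.cᴴ * T.c) := by
  simp only [scale, conjTranspose_smul, RCLike.star_def, Complex.conj_ofReal, Matrix.smul_mul,
    Matrix.mul_smul, smul_smul]
  rw [← Complex.ofReal_mul, Real.mul_self_sqrt ht]

lemma tendsto_distance_scale (T : Realization m₁ m₂ n) {t : ℕ → ℝ} {t₀ : ℝ}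
    (ht : Tendsto t atTop (𝓝 t₀)) :
    Tendsto (fun k => (T.scale t₀).distance (T.scale (t k))) atTop (𝓝 0) := by
  have h1 : Continuous fun s : ℝ => (T.scale t₀).distance (T.scale s) := by
    simp only [distance, scale]
    fun_prop
  have h2 := (h1.tendsto t₀).comp ht
  simpa [distance, Function.comp_def] using h2

/-- Scaling leaves 𝒜 and ℬ alone. This is why compactness is phrased with controllability only: at t
= 0 observability, hence minimality, is lost when n > 0. -/
lemma IsReachable.scale {T : Realization m₁ m₂ n} (hT : T.IsReachable) (t : ℝ) :
    (T.scale t).IsReachable := hT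

/-- Below the critical level, the spectrum of the closed loop does not meet the real axis. -/
lemma notMem_spectrum_recA_of_scale {T : Realization m₁ m₂ n} (hT : T ∈ classG m₁ m₂ n) {t : ℝ}
    (ht0 : 0 ≤ t) (ht1 : t < 1) {X : Matrix (Fin n) (Fin n) ℂ} (hXH : X.IsHermitian)
    (hX : (T.scale t).Riccati X) {ω : ℂ} (hω : ω.im = 0) : ω ∉ spectrum ℂ (T.recA X) := by
  intro hmem
  obtain ⟨x, hx0, hx⟩ := mem_spectrum_iff_exists_column.1 hmem
  have hωs : star ω = ω := Complex.conj_eq_iff_im.2 hω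
  have hns := notMem_spectrum_of_im_nonpos hT hω.le
  have hu := isUnit_det_of_notMem_spectrum hns
  set u := T.bᴴ * (X * x) with hu_def
  have hax : T.a * x = ω • x + Complex.I • (T.b * u) := by
    rw [← hx, recA, hu_def]
    simp only [Matrix.sub_mul, Matrix.smul_mul, Matrix.mul_assoc]
    abel
  have hcx : T.c * x = (-Complex.I) • (T.transfer ω * u) := by
    have h1 : (ω • (1 : Matrix (Fin n) (Fin n) ℂ) - T.a) * x = (-Complex.I) • (T.b * u) := by
      rw [Matrix.sub_mul, hax, Matrix.smul_mul, Matrix.one_mul]; module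
    have h2 : x = (-Complex.I) • ((ω • (1 : Matrix (Fin n) (Fin n) ℂ) - T.a)⁻¹ * (T.b * u)) := by
      rw [← Matrix.mul_smul, ← h1, ← Matrix.mul_assoc, nonsing_inv_mul _ hu, Matrix.one_mul]
    conv_lhs => rw [h2]
    simp only [transfer, Matrix.mul_smul, Matrix.mul_assoc]
  -- Energy balance: the Riccati equation is evaluated at the eigenvector x. As ω is real, the terms
  -- ω x*Xx cancel.
  have huu : uᴴ * u = (t : ℂ) • ((T.c * x)ᴴ * (T.c * x)) := by
    have h1 := riccati_iff.1 hX
    rw [scale_gram ht0] at h1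
    have h2 : Complex.I • (T.aᴴ * X - X * T.a) = X * T.b * T.bᴴ * X + (t : ℂ) • (T.cᴴ * T.c) := h1
    have h3 := congrArg (fun M => xᴴ * M * x) h2
    have h4 : xᴴ * (X * (T.a * x)) = ω • (xᴴ * (X * x)) + Complex.I • (uᴴ * u) := by
      rw [hax, hu_def]
      simp only [Matrix.mul_add, Matrix.mul_smul, conjTranspose_mul, conjTranspose_conjTranspose,
        hXH.eq, Matrix.mul_assoc]
    have h5 : xᴴ * (T.aᴴ * (X * x)) = ω • (xᴴ * (X * x)) - Complex.I • (uᴴ * u) := by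
      have := congrArg conjTranspose h4
      simp only [conjTranspose_mul, conjTranspose_conjTranspose, conjTranspose_add,
        conjTranspose_smul, hωs, hXH.eq, RCLike.star_def, Complex.conj_I, Matrix.mul_assoc] at this
      rw [this]
      simp only [hu_def, conjTranspose_mul, conjTranspose_conjTranspose, hXH.eq, Matrix.mul_assoc]
      module
    have h6 : uᴴ * u = xᴴ * (X * (T.b * (T.bᴴ * (X * x)))) := by
      simp only [hu_def, conjTranspose_mul, conjTranspose_conjTranspose, hXH.eq, Matrix.mul_assoc]
    have h7 : (T.c * x)ᴴ * (T.c * x) = xᴴ * (T.cᴴ * (T.c * x)) := by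
      simp only [conjTranspose_mul, Matrix.mul_assoc]
    simp only [Matrix.mul_smul, Matrix.smul_mul, Matrix.mul_sub, Matrix.sub_mul, Matrix.mul_add,
      Matrix.add_mul, Matrix.mul_assoc, h4, h5, ← h6, ← h7] at h3
    have h8 : Complex.I • (ω • (xᴴ * (X * x)) - Complex.I • (uᴴ * u) -
        (ω • (xᴴ * (X * x)) + Complex.I • (uᴴ * u))) = (2 : ℂ) • (uᴴ * u) := by
      simp only [smul_sub, smul_add, smul_smul, Complex.I_mul_I]
      module
    rw [h8] at h3
    linear_combination (norm := module) h3
  -- Since 𝒞x = −iψ(ω)u and ψ(ω) is contractive, (𝒞x)*𝒞x ≤ u*u = t(𝒞x)*𝒞x. With t < 1 both sides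
  -- vanish, and ω would be a real eigenvalue of 𝒜.
  have hu0 : u = 0 := by
    have h1 : (uᴴ * u - (T.c * x)ᴴ * (T.c * x)).PosSemidef := by
      have := (posSemidef_of_im_nonpos hT hω.le).conjTranspose_mul_mul_same u
      convert this using 1
      rw [hcx]
      simp only [conjTranspose_smul, conjTranspose_mul, Matrix.mul_sub, Matrix.sub_mul,
        Matrix.mul_one, Matrix.smul_mul, Matrix.mul_smul, smul_smul, Matrix.mul_assoc]
      simp
    have h2 : (-((T.c * x)ᴴ * (T.c * x))).PosSemidef := by
      have h3 : uᴴ * u - (T.c * x)ᴴ * (T.c * x) =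
          (((1 - t : ℝ)) : ℂ) • (-((T.c * x)ᴴ * (T.c * x))) := by
        rw [huu]; push_cast; module
      rw [h3] at h1
      have h4 : (0 : ℂ) ≤ (((1 - t)⁻¹ : ℝ) : ℂ) := by
        rw [Complex.zero_le_real]; exact inv_nonneg.2 (by linarith)
      have h5 := h1.smul h4
      rwa [smul_smul, ← Complex.ofReal_mul, inv_mul_cancel₀ (by linarith), Complex.ofReal_one,
        one_smul] at h5
    have h3 := (posSemidef_conjTranspose_mul_self (T.c * x)).eq_zero_of_neg h2
    rw [h3, smul_zero] at huu
    exact conjTranspose_mul_self_eq_zero.1 huu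
  rw [hu0, Matrix.mul_zero, smul_zero, add_zero] at hax
  exact hns (mem_spectrum_iff_exists_column.2 ⟨x, hx0, hax⟩)

/-- The quadratic part `X ℬ ℬ* X - i (𝒜* X - X 𝒜)` of the Riccati equation. -/
noncomputable def riccatiMap (T : Realization m₁ m₂ n) (X : Matrix (Fin n) (Fin n) ℂ) :
    Matrix (Fin n) (Fin n) ℂ :=
  X * (T.b * T.bᴴ) * X - Complex.I • (T.aᴴ * X - X * T.a)

lemma riccati_scale_iff {T : Realization m₁ m₂ n} {t : ℝ} (ht : 0 ≤ t)
    {X : Matrix (Fin n) (Fin n) ℂ} :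
    (T.scale t).Riccati X ↔ T.riccatiMap X = -((t : ℂ) • (T.cᴴ * T.c)) := by
  unfold Riccati
  rw [scale_gram ht, ← eq_neg_iff_add_eq_zero, riccatiMap, ← Matrix.mul_assoc]
  rfl

/-- The Sylvester operator `H ↦ M* H - H M`. -/
noncomputable def sylvester {ι : Type*} [Fintype ι] (M : Matrix ι ι ℂ) :
    Matrix ι ι ℂ →ₗ[ℂ] Matrix ι ι ℂ where
  toFun H := Mᴴ * H - H * M
  map_add' H K := by rw [Matrix.mul_add, Matrix.add_mul]; abel
  map_smul' c H := by simp [smul_sub]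

/-- The derivative at X is −i times the Sylvester operator of A_X, which is injective and therefore
surjective in finite dimension. The map is taken on all complex matrices, so nearby preimages are
not yet known to be Hermitian. -/
lemma map_nhds_riccatiMap {T : Realization m₁ m₂ n} {X : Matrix (Fin n) (Fin n) ℂ}
    (hXH : X.IsHermitian) (hX : ∀ μ ∈ spectrum ℂ (T.recA X), 0 < μ.im) :
    map T.riccatiMap (𝓝 X) = 𝓝 (T.riccatiMap X) := by
  let L : Matrix (Fin n) (Fin n) ℂ →L[ℂ] Matrix (Fin n) (Fin n) ℂ :=
    LinearMap.toContinuousLinearMap (-Complex.I • sylvester (T.recA X))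
  have hL : ∀ H, L H = -Complex.I • ((T.recA X)ᴴ * H - H * T.recA X) := fun H => rfl
  have hd : HasStrictFDerivAt T.riccatiMap L X := by
    have hid := hasStrictFDerivAt_id (𝕜 := ℂ) X
    have h1 := ((hid.mul_const' (T.b * T.bᴴ)).mul' hid).sub
      ((((hid.const_mul T.aᴴ).sub (hid.mul_const' T.a)).const_smul Complex.I))
    refine h1.congr_fderiv ?_
    ext1 H
    change X * (T.b * T.bᴴ) * H + H * (T.b * T.bᴴ) * X - Complex.I • (T.aᴴ * H - H * T.a) = L H
    rw [hL, conjTranspose_recA, recA, hXH.eq]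
    simp only [Matrix.add_mul, Matrix.mul_sub, Matrix.smul_mul, Matrix.mul_smul, smul_sub,
      smul_add, smul_smul, neg_mul, Complex.I_mul_I, Matrix.mul_assoc]
    module
  refine hd.map_nhds_eq_of_surj ?_
  have hinj : Function.Injective (-Complex.I • sylvester (T.recA X)) := by
    rw [← LinearMap.ker_eq_bot, LinearMap.ker_eq_bot']
    intro H hH
    refine eq_zero_of_lyapunov_eq_zero hX ?_
    have : -Complex.I • ((T.recA X)ᴴ * H - H * T.recA X) = 0 := hH
    simpa using this
  exact LinearMap.range_eq_top.2 (LinearMap.injective_iff_surjective.1 hinj)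

/-- The defect X* − X solves the homogeneous Sylvester equation of A_X. -/
lemma isHermitian_of_riccatiMap {T : Realization m₁ m₂ n} {X : Matrix (Fin n) (Fin n) ℂ}
    (hX : ∀ μ ∈ spectrum ℂ (T.recA X), 0 < μ.im) (h : (T.riccatiMap X).IsHermitian) :
    X.IsHermitian := by
  have h1 : Xᴴ - X = 0 := by
    refine eq_zero_of_lyapunov_eq_zero hX ?_
    have h2 : (T.riccatiMap X)ᴴ - T.riccatiMap X = 0 := by rw [h.eq, sub_self]
    have h3 := congrArg (Complex.I • ·) h2
    rw [conjTranspose_recA, recA]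
    simp only [riccatiMap, conjTranspose_sub, conjTranspose_mul, conjTranspose_smul,
      conjTranspose_conjTranspose, RCLike.star_def, Complex.conj_I, smul_sub, smul_smul,
      Complex.I_mul_I, smul_zero, mul_neg, neg_neg, Matrix.add_mul, Matrix.mul_sub, Matrix.sub_mul,
      Matrix.smul_mul, Matrix.mul_smul, Matrix.mul_assoc] at h3 ⊢
    linear_combination (norm := module) h3
  exact sub_eq_zero.1 h1

/-- The levels `t` for which the Riccati equation of `√t ψ` has a stabilizing solution. -/
def stabilizableLevels (T : Realization m₁ m₂ n) : Set ℝ :=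
  {t | ∃ X : Matrix (Fin n) (Fin n) ℂ, X.IsHermitian ∧ (T.scale t).Riccati X ∧
    ∀ μ ∈ spectrum ℂ (T.recA X), 0 < μ.im}

/-- Method of continuity on [0, r]. Closedness: a limit solution has closed-loop spectrum in the
closed half-plane, and real points are impossible below level 1. Start: X = 0 at t = 0. Openness to
the right: the Riccati map is locally onto. -/
lemma Icc_subset_stabilizableLevels {T : Realization m₁ m₂ n} (hT : T ∈ classG m₁ m₂ n) {r : ℝ}
    (hr : r < 1) : Set.Icc 0 r ⊆ T.stabilizableLevels := by
  refine IsClosed.Icc_subset_of_forall_exists_gt ?_ ?_ ?_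
  · refine IsSeqClosed.isClosed fun t t₀ ht htl => ?_
    have ht₀ : t₀ ∈ Set.Icc 0 r := isClosed_Icc.mem_of_tendsto htl
      (Eventually.of_forall fun k => (ht k).2)
    choose X hXH hX hs using fun k => (ht k).1
    obtain ⟨Y, hYH, hY, hYs, -⟩ := (hT.1.isReachable.scale t₀).exists_subseq_tendsto
      (T.tendsto_distance_scale htl) hXH hX (fun k μ hμ => (hs k μ hμ).le)
    refine ⟨⟨Y, hYH, hY, fun μ hμ => lt_of_le_of_ne (hYs hμ) fun h => ?_⟩, ht₀⟩
    exact notMem_spectrum_recA_of_scale hT ht₀.1 (lt_of_le_of_lt ht₀.2 hr) hYH hY h.symm hμ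
  · refine ⟨0, isHermitian_zero, ?_, fun μ hμ => ?_⟩
    · rw [riccati_scale_iff le_rfl]; simp [riccatiMap]
    · refine im_pos_of_mem_spectrum hT ?_
      simpa [recA] using hμ
  · rintro t ⟨⟨X, hXH, hX, hs⟩, ht⟩ y hy
    have h1 : ∀ᶠ Z in 𝓝 (T.riccatiMap X), ∃ Y : Matrix (Fin n) (Fin n) ℂ,
        (∀ μ ∈ spectrum ℂ (T.recA Y), 0 < μ.im) ∧ T.riccatiMap Y = Z := by
      rw [← map_nhds_riccatiMap hXH hs]
      have h2 : ∀ᶠ Y in 𝓝 X, spectrum ℂ (T.recA Y) ⊆ {z : ℂ | 0 < z.im} :=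
        (continuous_recA T).continuousAt.eventually ((isOpen_spectrum_subset
          (isOpen_lt continuous_const Complex.continuous_im)).mem_nhds hs)
      rw [eventually_map]
      filter_upwards [h2] with Y hY
      exact ⟨Y, fun μ hμ => hY hμ, rfl⟩
    rw [(riccati_scale_iff ht.1).1 hX] at h1
    have h2 : Continuous fun s : ℝ => -((s : ℂ) • (T.cᴴ * T.c)) := by fun_prop
    have h3 := ((h2.tendsto t).mono_left (nhdsWithin_le_nhds (s := Set.Ioi t))).eventually h1
    have h4 : ∀ᶠ s in 𝓝[>] t, s ∈ Set.Ioc t y := Ioc_mem_nhdsGT hy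
    obtain ⟨s, ⟨Y, hYs, hY⟩, hsy⟩ := (h3.and h4).exists
    have hs0 : 0 ≤ s := ht.1.trans hsy.1.le
    refine ⟨s, ⟨Y, isHermitian_of_riccatiMap hYs ?_, (riccati_scale_iff hs0).2 hY, hYs⟩, hsy⟩
    rw [hY]
    refine IsHermitian.neg ?_
    simp [IsHermitian, conjTranspose_smul]

/-- The Riccati equation is a Lyapunov equation for 𝒜 with right-hand side Xℬℬ*X + 𝒞*𝒞 ≥ 0, hence X
≥ 0. Its kernel is 𝒜-invariant and inside ker 𝒞, so it is trivial by observability. No spectral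
condition on A is needed, which is what part (b) of the stability claim requires. -/
lemma posDef_of_riccati {T : Realization m₁ m₂ n} (hT : T ∈ classG m₁ m₂ n)
    {X : Matrix (Fin n) (Fin n) ℂ} (hXH : X.IsHermitian) (hX : T.Riccati X) : X.PosDef := by
  have hX' := riccati_iff.1 hX
  have h1 : X.PosSemidef := by
    refine posSemidef_of_lyapunov (fun μ hμ => im_pos_of_mem_spectrum hT hμ) ?_
    rw [hX']
    refine PosSemidef.add ?_ (posSemidef_conjTranspose_mul_self _)
    have := posSemidef_conjTranspose_mul_self (T.bᴴ * X)
    rwa [conjTranspose_mul, conjTranspose_conjTranspose, hXH.eq, ← Matrix.mul_assoc] at this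
  rw [h1.posDef_iff_isUnit, ← spectrum.zero_notMem_iff ℂ, mem_spectrum_iff_exists_column]
  rintro ⟨x, hx0, hx⟩
  rw [zero_smul] at hx
  have key : ∀ y : Matrix (Fin n) (Fin 1) ℂ, X * y = 0 → X * (T.a * y) = 0 ∧ T.c * y = 0 := by
    intro y hy
    have h2 := congrArg (· * y) hX'
    simp only [Matrix.smul_mul, Matrix.sub_mul, Matrix.add_mul, Matrix.mul_assoc, hy,
      Matrix.mul_zero, zero_sub, zero_add] at h2
    have hy' : yᴴ * X = 0 := by
      have := congrArg conjTranspose hy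
      rwa [conjTranspose_mul, hXH.eq, conjTranspose_zero] at this
    have h3 : T.c * y = 0 := by
      rw [← conjTranspose_mul_self_eq_zero, conjTranspose_mul, Matrix.mul_assoc, ← h2,
        Matrix.mul_smul, Matrix.mul_neg, ← Matrix.mul_assoc, hy']
      simp
    rw [h3, Matrix.mul_zero] at h2
    simp only [smul_neg, neg_eq_zero, smul_eq_zero, Complex.I_ne_zero, false_or] at h2
    exact ⟨h2, h3⟩
  let W : Submodule ℂ (Matrix (Fin n) (Fin 1) ℂ) :=
    { carrier := {y | X * y = 0}
      add_mem' := fun {x y} h1 h2 => by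
        change X * (x + y) = 0
        rw [Matrix.mul_add, h1, h2, add_zero]
      zero_mem' := Matrix.mul_zero _
      smul_mem' := fun c y h => by
        change X * (c • y) = 0
        rw [Matrix.mul_smul, h, smul_zero] }
  have hW : W = ⊥ := hT.1.eq_bot W (fun y hy => (key y hy).1) (fun y hy => (key y hy).2)
  have : x ∈ W := hx
  rw [hW] at this
  exact hx0 this

/-- X is a limit of stabilizing solutions at levels t_k = 1 − 1/(k+1). Strict spectral inequalities
become weak ones, so A may acquire real eigenvalues. -/
theorem existsUnique_isSpectralSolution {T : Realization m₁ m₂ n} (hT : T ∈ classG m₁ m₂ n) :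
    ∃! X : Matrix (Fin n) (Fin n) ℂ, T.IsSpectralSolution X := by
  have h1 : Tendsto (fun k : ℕ => 1 - 1 / ((k : ℝ) + 1)) atTop (𝓝 1) := by
    simpa using (tendsto_const_nhds (x := (1 : ℝ))).sub tendsto_one_div_add_atTop_nhds_zero_nat
  have h2 : ∀ k : ℕ, 1 - 1 / ((k : ℝ) + 1) ∈ T.stabilizableLevels := fun k => by
    refine Icc_subset_stabilizableLevels hT (r := 1 - 1 / ((k : ℝ) + 1)) ?_ ⟨?_, le_rfl⟩
    · have : 0 < 1 / ((k : ℝ) + 1) := by positivity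
      linarith
    · rw [sub_nonneg, div_le_one (by positivity)]
      linarith [(Nat.cast_nonneg k : (0 : ℝ) ≤ k)]
  choose X hXH hX hs using h2
  obtain ⟨Y, hYH, hY, hYs, -⟩ := (hT.1.isReachable.scale 1).exists_subseq_tendsto
    (T.tendsto_distance_scale h1) hXH hX (fun k μ hμ => (hs k μ hμ).le)
  have h3 : T.scale 1 = T := by ext1 <;> simp [scale]
  rw [h3] at hY hYs
  refine ⟨Y, ⟨posDef_of_riccati hT hYH hY, hY, hYs⟩, fun Z hZ => ?_⟩
  exact hT.1.riccati_unique hZ.posDef.1 hYH hZ.riccati hY hZ.spectrum_subset hYs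

/-- The solution determined by the spectral condition depends continuously on the realization. -/
lemma exists_forall_norm_sub_lt {T : Realization m₁ m₂ n} (hT : T.IsMinimal)
    {X : Matrix (Fin n) (Fin n) ℂ} (hX : T.IsSpectralSolution X) {ε : ℝ} (hε : 0 < ε) :
    ∃ δ > 0, ∀ U : Realization m₁ m₂ n, T.distance U < δ → ∀ Y : Matrix (Fin n) (Fin n) ℂ,
      U.IsSpectralSolution Y → ‖X - Y‖ < ε := by
  by_contra! hcon
  choose U hU Y hY hYn using fun k : ℕ => hcon (1 / ((k : ℝ) + 1)) (by positivity)
  have hd : Tendsto (fun k => T.distance (U k)) atTop (𝓝 0) :=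
    squeeze_zero (fun _ => distance_nonneg _ _) (fun k => (hU k).le)
      tendsto_one_div_add_atTop_nhds_zero_nat
  -- Compactness together with uniqueness gives continuity: any limit of the perturbed solutions
  -- must be X.
  obtain ⟨Z, hZH, hZ, hZs, φ, hφ, hlim⟩ := hT.isReachable.exists_subseq_tendsto hd
    (fun k => (hY k).posDef.1) (fun k => (hY k).riccati) (fun k => (hY k).spectrum_subset)
  have h1 : X = Z := hT.riccati_unique hX.posDef.1 hZH hX.riccati hZ hX.spectrum_subset hZs
  have h2 : Tendsto (fun k => ‖X - Y (φ k)‖) atTop (𝓝 ‖X - Z‖) :=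
    (tendsto_const_nhds.sub hlim).norm
  rw [h1, sub_self, norm_zero] at h2
  obtain ⟨k, hk⟩ := (h2.eventually (gt_mem_nhds hε)).exists
  rw [← h1] at hk
  exact absurd hk (not_lt.2 (hYn (φ k)))

end Realization

/-! ### One step of the discrete Bäcklund–Darboux transformation -/

section Step

variable {ι κ : Type*} [Fintype ι] [DecidableEq ι] [Fintype κ] [DecidableEq κ]
  {A S : Matrix ι ι ℂ} {P : Matrix ι κ ℂ} {J : Matrix κ κ ℂ}

/-- `Π + i A⁻¹ Π J`. -/
noncomputable def stepP (J : Matrix κ κ ℂ) (A : Matrix ι ι ℂ) (P : Matrix ι κ ℂ) : Matrix ι κ ℂ :=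
  P + Complex.I • (A⁻¹ * P * J)

/-- `S + A⁻¹ S (A*)⁻¹ + A⁻¹ Π Π* (A*)⁻¹`. -/
noncomputable def stepS (A S : Matrix ι ι ℂ) (P : Matrix ι κ ℂ) : Matrix ι ι ℂ :=
  S + A⁻¹ * S * (Aᴴ)⁻¹ + A⁻¹ * P * Pᴴ * (Aᴴ)⁻¹

/-- `I + Π* S⁻¹ Π - Π₊* S₊⁻¹ Π₊`. -/
noncomputable def stepC (J : Matrix κ κ ℂ) (A S : Matrix ι ι ℂ) (P : Matrix ι κ ℂ) :
    Matrix κ κ ℂ :=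
  1 + Pᴴ * S⁻¹ * P - (stepP J A P)ᴴ * (stepS A S P)⁻¹ * stepP J A P

/-- The transfer function `w(λ) = I - i J Π* S⁻¹ (A - λ)⁻¹ Π`. -/
noncomputable def darboux (J : Matrix κ κ ℂ) (A S : Matrix ι ι ℂ) (P : Matrix ι κ ℂ) (l : ℂ) :
    Matrix κ κ ℂ :=
  1 - Complex.I • (J * (Pᴴ * S⁻¹ * ((A - l • 1)⁻¹ * P)))

lemma stepS_eq (A S : Matrix ι ι ℂ) (P : Matrix ι κ ℂ) :
    stepS A S P = S + A⁻¹ * S * (A⁻¹)ᴴ + A⁻¹ * P * (A⁻¹ * P)ᴴ := by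
  simp only [stepS, conjTranspose_mul, conjTranspose_nonsing_inv, Matrix.mul_assoc]

lemma posDef_stepS (hS : S.PosDef) : (stepS A S P).PosDef := by
  rw [stepS_eq]
  exact (hS.add_posSemidef (hS.posSemidef.mul_mul_conjTranspose_same _)).add_posSemidef
    (posSemidef_self_mul_conjTranspose _)

lemma mul_stepP (hA : IsUnit A.det) : A * stepP J A P = A * P + Complex.I • (P * J) := by
  rw [stepP, Matrix.mul_add, Matrix.mul_smul, Matrix.mul_assoc A⁻¹, ← Matrix.mul_assoc A,
    mul_nonsing_inv _ hA, Matrix.one_mul]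

lemma step_identity (hA : IsUnit A.det) (hJ : J * J = 1) (hJH : Jᴴ = J)
    (h : A * S - S * Aᴴ = Complex.I • (P * J * Pᴴ)) :
    A * stepS A S P - stepS A S P * Aᴴ =
      Complex.I • (stepP J A P * J * (stepP J A P)ᴴ) := by
  have hAB : A * A⁻¹ = 1 := mul_nonsing_inv _ hA
  have hBA : A⁻¹ * A = 1 := nonsing_inv_mul _ hA
  obtain ⟨B, hB⟩ : ∃ B, B = A⁻¹ := ⟨_, rfl⟩
  rw [← hB] at hAB hBA
  have hAB' : Bᴴ * Aᴴ = 1 := by rw [← conjTranspose_mul, hAB, conjTranspose_one]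
  have hBA' : Aᴴ * Bᴴ = 1 := by rw [← conjTranspose_mul, hBA, conjTranspose_one]
  have h' : S * Bᴴ - B * S = Complex.I • (B * P * J * (Pᴴ * Bᴴ)) := by
    have h1 := congrArg (fun M => B * M * Bᴴ) h
    simp only [Matrix.mul_sub, Matrix.sub_mul, Matrix.mul_smul, Matrix.smul_mul] at h1
    rw [← Matrix.mul_assoc B A S, hBA, Matrix.one_mul, Matrix.mul_assoc B (S * Aᴴ),
      Matrix.mul_assoc S, hBA', Matrix.mul_one] at h1
    rw [h1]
    simp only [Matrix.mul_assoc]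
  have h1 : ∀ M : Matrix ι ι ℂ, A * (B * M) = M := fun M => by
    rw [← Matrix.mul_assoc, hAB, Matrix.one_mul]
  have h2 : ∀ M : Matrix κ ι ℂ, J * (J * M) = M := fun M => by
    rw [← Matrix.mul_assoc, hJ, Matrix.one_mul]
  rw [stepS_eq, stepP, ← hB]
  simp only [conjTranspose_add, conjTranspose_mul, conjTranspose_smul, hJH, RCLike.star_def,
    Complex.conj_I, Matrix.mul_add, Matrix.add_mul, Matrix.mul_assoc, h1, h2, hAB', Matrix.mul_one,
    Matrix.smul_mul, Matrix.mul_smul, smul_add, smul_smul] at h h' ⊢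
  -- The new identity is the sum of the old one and its conjugate by A⁻¹; the cross terms of Π₊JΠ₊*
  -- account for the ΠΠ* term in S₊.
  linear_combination (norm := skip) h + h'
  match_scalars <;> ring_nf <;> simp only [Complex.I_sq, Complex.I_pow_three] <;> ring

lemma conjTranspose_mul_inv_eq (hS : S.PosDef)
    (h : A * S - S * Aᴴ = Complex.I • (P * J * Pᴴ)) :
    Aᴴ * S⁻¹ = S⁻¹ * A - Complex.I • (S⁻¹ * P * J * (Pᴴ * S⁻¹)) := by
  have hu : IsUnit S.det := (isUnit_iff_isUnit_det _).1 hS.isUnit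
  have h1 := congrArg (fun M => S⁻¹ * M * S⁻¹) h
  simp only [Matrix.mul_sub, Matrix.sub_mul, Matrix.mul_smul, Matrix.smul_mul, Matrix.mul_assoc,
    mul_nonsing_inv _ hu, Matrix.mul_one] at h1
  rw [← Matrix.mul_assoc S⁻¹ S, nonsing_inv_mul _ hu, Matrix.one_mul] at h1
  simp only [Matrix.mul_assoc]
  rw [← h1]; abel

/-- Everything rests on AS + A⁻¹S − iΠ₊JΠ* = S₊A*, which lets S₊⁻¹ cancel against S₊. -/
lemma stepU_recursion (hA : IsUnit A.det) (hJ : J * J = 1) (hJH : Jᴴ = J) (hS : S.PosDef)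
    (h : A * S - S * Aᴴ = Complex.I • (P * J * Pᴴ)) :
    (stepP J A P)ᴴ * (stepS A S P)⁻¹ * (A + A⁻¹) =
      Pᴴ * S⁻¹ * A - Complex.I • (stepC J A S P * J * (Pᴴ * S⁻¹)) := by
  have hu : IsUnit S.det := (isUnit_iff_isUnit_det _).1 hS.isUnit
  have hu' : IsUnit (stepS A S P).det :=
    (isUnit_iff_isUnit_det _).1 (posDef_stepS (A := A) (P := P) hS).isUnit
  have hbr : A * S + A⁻¹ * S - Complex.I • (stepP J A P * J * Pᴴ) = stepS A S P * Aᴴ := by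
    have hAA : (Aᴴ)⁻¹ * Aᴴ = 1 := nonsing_inv_mul _ (by rw [det_conjTranspose]; exact hA.star)
    have h2 : ∀ M : Matrix κ ι ℂ, J * (J * M) = M := fun M => by
      rw [← Matrix.mul_assoc, hJ, Matrix.one_mul]
    rw [stepS, stepP]
    simp only [Matrix.add_mul, Matrix.mul_assoc, hAA, Matrix.mul_one, Matrix.smul_mul, smul_add,
      smul_smul, Complex.I_mul_I, h2] at h ⊢
    linear_combination (norm := module) h
  have h1 : (stepP J A P)ᴴ * Aᴴ = Pᴴ * Aᴴ - Complex.I • (J * Pᴴ) := by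
    rw [← conjTranspose_mul, mul_stepP hA]
    simp only [conjTranspose_add, conjTranspose_mul, conjTranspose_smul, hJH, RCLike.star_def,
      Complex.conj_I]
    module
  have h2 : (stepP J A P)ᴴ * (stepS A S P)⁻¹ *
      (A * S + A⁻¹ * S - Complex.I • (stepP J A P * J * Pᴴ)) = Pᴴ * Aᴴ - Complex.I • (J * Pᴴ) := by
    rw [hbr, ← h1, Matrix.mul_assoc, ← Matrix.mul_assoc _⁻¹, nonsing_inv_mul _ hu', Matrix.one_mul]
  have h3 := congrArg (· * S⁻¹) h2
  have h4 := conjTranspose_mul_inv_eq hS h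
  simp only [Matrix.mul_sub, Matrix.sub_mul, Matrix.mul_add, Matrix.add_mul, Matrix.mul_smul,
    Matrix.smul_mul, Matrix.mul_assoc, mul_nonsing_inv _ hu, Matrix.mul_one, h4] at h3
  rw [stepC]
  simp only [Matrix.mul_add, Matrix.add_mul, Matrix.sub_mul, Matrix.one_mul, smul_add, smul_sub,
    Matrix.mul_assoc] at h3 ⊢
  linear_combination (norm := module) h3

/-- The Darboux matrices gauge the free factor I + izJ into I + izJC. The relation zλ = −1 turns
resolvent identities for A and A⁻¹ into identities in z, after which the recursion for Π*S⁻¹ closes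
the computation. -/
lemma darboux_step (hA : IsUnit A.det) (hJ : J * J = 1) (hJH : Jᴴ = J) (hS : S.PosDef)
    (h : A * S - S * Aᴴ = Complex.I • (P * J * Pᴴ)) {l z : ℂ} (hl : l ∉ spectrum ℂ A)
    (hz : z * l = -1) :
    darboux J A (stepS A S P) (stepP J A P) l * (1 + (Complex.I * z) • J) =
      (1 + (Complex.I * z) • (J * stepC J A S P)) * darboux J A S P l := by
  have hrec := stepU_recursion hA hJ hJH hS h
  obtain ⟨C, hC⟩ : ∃ C, C = stepC J A S P := ⟨_, rfl⟩
  obtain ⟨U, hU⟩ : ∃ U, U = Pᴴ * S⁻¹ := ⟨_, rfl⟩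
  obtain ⟨U', hU'⟩ : ∃ U', U' = (stepP J A P)ᴴ * (stepS A S P)⁻¹ := ⟨_, rfl⟩
  obtain ⟨B, hB⟩ : ∃ B, B = A⁻¹ := ⟨_, rfl⟩
  obtain ⟨G, hG⟩ : ∃ G, G = (A - l • (1 : Matrix ι ι ℂ))⁻¹ := ⟨_, rfl⟩
  have hdet : IsUnit (A - l • (1 : Matrix ι ι ℂ)).det := by
    have h1 := isUnit_det_of_notMem_spectrum hl
    rw [← neg_sub, det_neg] at h1
    exact (isUnit_of_mul_isUnit_right h1)
  have hAG : A * G = 1 + l • G := by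
    have h1 : (A - l • (1 : Matrix ι ι ℂ)) * G = 1 := by rw [hG]; exact mul_nonsing_inv _ hdet
    rw [Matrix.sub_mul, Matrix.smul_mul, Matrix.one_mul] at h1
    rw [← h1]; abel
  have hGA : G * A = 1 + l • G := by
    have h1 : G * (A - l • (1 : Matrix ι ι ℂ)) = 1 := by rw [hG]; exact nonsing_inv_mul _ hdet
    rw [Matrix.mul_sub, Matrix.mul_smul, Matrix.mul_one] at h1
    rw [← h1]; abel
  have hGB : G * B = z • B - z • G := by
    have h1 := congrArg (· * B) hGA
    simp only [Matrix.mul_assoc, Matrix.add_mul, Matrix.smul_mul, Matrix.one_mul] at h1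
    rw [hB, mul_nonsing_inv _ hA, Matrix.mul_one, ← hB] at h1
    have h2 := congrArg (z • ·) h1
    simp only [smul_add, smul_smul, hz] at h2
    linear_combination (norm := module) h2
  have hBG : B * G = z • B - z • G := by
    have h1 := congrArg (B * ·) hAG
    simp only [← Matrix.mul_assoc, Matrix.mul_add, Matrix.mul_smul, Matrix.mul_one] at h1
    rw [hB, nonsing_inv_mul _ hA, Matrix.one_mul, ← hB] at h1
    have h2 := congrArg (z • ·) h1
    simp only [smul_add, smul_smul, hz] at h2
    linear_combination (norm := module) h2
  have hAGP : A * (G * P) = P + l • (G * P) := by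
    rw [← Matrix.mul_assoc, hAG, Matrix.add_mul, Matrix.one_mul, Matrix.smul_mul]
  have hBGP : B * (G * P) = z • (B * P) - z • (G * P) := by
    rw [← Matrix.mul_assoc, hBG, Matrix.sub_mul, Matrix.smul_mul, Matrix.smul_mul]
  have hGBP : G * (B * P) = z • (B * P) - z • (G * P) := by
    rw [← Matrix.mul_assoc, hGB, Matrix.sub_mul, Matrix.smul_mul, Matrix.smul_mul]
  have hGBPJ : G * (B * (P * J)) = z • (B * (P * J)) - z • (G * (P * J)) := by
    rw [← Matrix.mul_assoc, hGB, Matrix.sub_mul, Matrix.smul_mul, Matrix.smul_mul]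
  have hGP : G * stepP J A P * (1 + (Complex.I * z) • J) =
      z • stepP J A P - z • ((A + B) * (G * P)) := by
    have hPJ : stepP J A P * J = P * J + Complex.I • (B * P) := by
      rw [stepP, ← hB, Matrix.add_mul, Matrix.smul_mul, Matrix.mul_assoc (B * P), hJ,
        Matrix.mul_one]
    have h1 : G * stepP J A P = G * P + (Complex.I * z) • (B * (P * J) - G * (P * J)) := by
      rw [stepP, ← hB, Matrix.mul_add, Matrix.mul_smul, Matrix.mul_assoc B, hGBPJ]
      module
    have h2 : G * (stepP J A P * J) = G * (P * J) + (Complex.I * z) • (B * P - G * P) := by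
      rw [hPJ, Matrix.mul_add, Matrix.mul_smul, hGBP]
      module
    rw [Matrix.mul_add, Matrix.mul_one, Matrix.mul_smul, Matrix.mul_assoc, h2, h1, Matrix.add_mul,
      hAGP, hBGP, stepP, ← hB, Matrix.mul_assoc B]
    match_scalars
    · linear_combination hz - z ^ 2 * Complex.I_sq
    · ring
    · ring
    · linear_combination z ^ 2 * Complex.I_sq
    · ring
  rw [← hU', ← hU, ← hC, ← hB] at hrec
  have hCe : C = 1 + U * P - U' * stepP J A P := by rw [hC, hU, hU', stepC]
  rw [darboux, darboux, ← hG, ← hU, ← hU', ← hC]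
  have h1 : (1 - Complex.I • (J * (U' * (G * stepP J A P)))) * (1 + (Complex.I * z) • J) =
      (1 + (Complex.I * z) • J) -
        Complex.I • (J * (U' * (G * stepP J A P * (1 + (Complex.I * z) • J)))) := by
    rw [Matrix.sub_mul, Matrix.one_mul, Matrix.smul_mul]
    simp only [Matrix.mul_assoc]
  have h2 : J * (U' * ((A + B) * (G * P))) =
      J * (U * P) + l • (J * (U * (G * P))) - Complex.I • (J * (C * (J * (U * (G * P))))) := by
    rw [← Matrix.mul_assoc U', hrec]
    simp only [Matrix.sub_mul, Matrix.smul_mul, Matrix.mul_assoc, hAGP, Matrix.mul_add,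
      Matrix.mul_sub, Matrix.mul_smul]
  rw [h1, hGP]
  have h3 : J * C = J + J * (U * P) - J * (U' * stepP J A P) := by
    rw [hCe, Matrix.mul_sub, Matrix.mul_add, Matrix.mul_one]
  simp only [Matrix.mul_sub, Matrix.mul_smul, h2]
  simp only [Matrix.add_mul, Matrix.one_mul, Matrix.mul_one, Matrix.smul_mul, smul_sub, smul_add, smul_smul]
  have h4 : (Complex.I * z) • (J * C) = (Complex.I * z) • J + (Complex.I * z) • (J * (U * P)) -
      (Complex.I * z) • (J * (U' * stepP J A P)) := by rw [h3]; module
  have h5 : J * C * (J * (U * (G * P))) = J * (C * (J * (U * (G * P)))) := Matrix.mul_assoc _ _ _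
  rw [h4, h5]
  simp only [hz]
  match_scalars <;> ring_nf

/-- Consequence of the identity for A, S, Π: w(λ) is J-unitary at real λ and satisfies w*Jw ≤ J in
the lower half-plane. The first fact gives CJC = J, the second the Weyl inequality. -/
lemma darboux_conj (hJ : J * J = 1) (hJH : Jᴴ = J) (hS : S.PosDef)
    (h : A * S - S * Aᴴ = Complex.I • (P * J * Pᴴ)) {l : ℂ} (hl : l ∉ spectrum ℂ A) :
    (darboux J A S P l)ᴴ * J * darboux J A S P l =
      J + (((2 * l.im : ℝ)) : ℂ) •
        (((A - l • 1)⁻¹ * P)ᴴ * S⁻¹ * ((A - l • 1)⁻¹ * P)) := by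
  obtain ⟨G, hG⟩ : ∃ G, G = (A - l • (1 : Matrix ι ι ℂ))⁻¹ := ⟨_, rfl⟩
  have hdet : IsUnit (A - l • (1 : Matrix ι ι ℂ)).det := by
    have h1 := isUnit_det_of_notMem_spectrum hl
    rw [← neg_sub, det_neg] at h1
    exact (isUnit_of_mul_isUnit_right h1)
  have hAG : A * (G * P) = P + l • (G * P) := by
    have h1 : (A - l • (1 : Matrix ι ι ℂ)) * (G * P) = P := by
      rw [hG, ← Matrix.mul_assoc, mul_nonsing_inv _ hdet, Matrix.one_mul]
    rw [Matrix.sub_mul, Matrix.smul_mul, Matrix.one_mul] at h1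
    linear_combination (norm := module) h1
  rw [darboux, ← hG]
  obtain ⟨Q, hQ⟩ : ∃ Q, Q = G * P := ⟨_, rfl⟩
  rw [← hQ] at hAG ⊢
  have hSH : (S⁻¹)ᴴ = S⁻¹ := hS.inv.1.eq
  have h4 := conjTranspose_mul_inv_eq hS h
  have h5 := congrArg (fun M => Qᴴ * M * Q) h4
  have h6 : Qᴴ * Aᴴ = Pᴴ + star l • Qᴴ := by
    rw [← conjTranspose_mul, hAG, conjTranspose_add, conjTranspose_smul]
  have h7 : Qᴴ * (Aᴴ * (S⁻¹ * Q)) = Pᴴ * (S⁻¹ * Q) + star l • (Qᴴ * (S⁻¹ * Q)) := by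
    rw [← Matrix.mul_assoc, h6, Matrix.add_mul, Matrix.smul_mul]
  have hJJ : ∀ M : Matrix κ κ ℂ, J * (J * M) = M := fun M => by
    rw [← Matrix.mul_assoc, hJ, Matrix.one_mul]
  simp only [Matrix.mul_assoc, Matrix.mul_sub, Matrix.sub_mul, Matrix.smul_mul, Matrix.mul_smul,
    h7, hAG, Matrix.mul_add] at h5
  simp only [conjTranspose_sub, conjTranspose_one, conjTranspose_smul, conjTranspose_mul,
    conjTranspose_conjTranspose, hJH, hSH, RCLike.star_def, Complex.conj_I, Matrix.mul_assoc,
    Matrix.mul_sub, Matrix.sub_mul, Matrix.one_mul, Matrix.mul_one, Matrix.smul_mul,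
    Matrix.mul_smul, hJ, hJJ, smul_sub, smul_smul]
  have h8 := congrArg (Complex.I • ·) h5
  simp only [smul_add, smul_sub, smul_smul, Complex.I_mul_I] at h8
  have h9 : (((2 * l.im : ℝ)) : ℂ) = Complex.I * star l - Complex.I * l := by
    apply Complex.ext <;> simp
    ring
  rw [h9]
  simp only [RCLike.star_def] at h8 ⊢
  linear_combination (norm := skip) -h8
  match_scalars <;> ring_nf
  rw [Complex.I_sq]
  ring

end Step

/-! ### Positivity and J-unitarity of the new coefficient -/

section Step

variable {ι κ : Type*} [Fintype ι] [DecidableEq ι] [Fintype κ] [DecidableEq κ]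
  {A S : Matrix ι ι ℂ} {P : Matrix ι κ ℂ} {J : Matrix κ κ ℂ}

/-- C is the Schur complement of S₊ in the block matrix with corners S₊, Π₊ and I + Π*S⁻¹Π. That
matrix is a sum of three positive terms, built on the columns [S; Π*], [A⁻¹; 0] and [A⁻¹Π; −iJ]. -/
lemma posSemidef_stepC (hJ : J * J = 1) (hJH : Jᴴ = J) (hS : S.PosDef) :
    (stepC J A S P).PosSemidef := by
  have hu : IsUnit S.det := (isUnit_iff_isUnit_det _).1 hS.isUnit
  have hS' := posDef_stepS (A := A) (P := P) hS
  have := hS'.isUnit.invertible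
  refine (PosDef.fromBlocks₁₁ (stepP J A P) (1 + Pᴴ * S⁻¹ * P) hS').1 ?_
  have h1 := hS.inv.posSemidef.mul_mul_conjTranspose_same (fromRows S Pᴴ)
  have h2 := hS.posSemidef.mul_mul_conjTranspose_same (fromRows A⁻¹ (0 : Matrix κ ι ℂ))
  have h3 := posSemidef_self_mul_conjTranspose (fromRows (A⁻¹ * P) (-Complex.I • J))
  suffices hsum : fromBlocks (stepS A S P) (stepP J A P) (stepP J A P)ᴴ (1 + Pᴴ * S⁻¹ * P) = _ by
    rw [hsum]
    exact (h1.add h2).add h3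
  rw [stepS_eq, stepP]
  rw [fromRows_mul S Pᴴ S⁻¹, fromRows_mul A⁻¹ 0 S]
  simp only [conjTranspose_fromRows_eq_fromCols_conjTranspose, fromRows_mul_fromCols,
    fromBlocks_add]
  simp only [conjTranspose_conjTranspose, mul_nonsing_inv _ hu,
    Matrix.one_mul, hS.1.eq, conjTranspose_zero, Matrix.zero_mul, Matrix.mul_zero, add_zero,
    conjTranspose_smul, hJH, Matrix.smul_mul, Matrix.mul_smul, Matrix.mul_assoc,
    nonsing_inv_mul _ hu, Matrix.mul_one, hJ, conjTranspose_add, conjTranspose_mul,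
    RCLike.star_def, Complex.conj_I, map_neg, neg_neg, smul_smul, mul_neg, Complex.I_mul_I,
    one_smul, add_comm (1 : Matrix κ κ ℂ)]

lemma conj_one_add_smul {C : Matrix κ κ ℂ} (hJ : J * J = 1) (hJH : Jᴴ = J) (hC : Cᴴ = C) (z : ℂ) :
    (1 + (Complex.I * z) • (J * C))ᴴ * J * (1 + (Complex.I * z) • (J * C)) =
      J + (((-2 * z.im : ℝ)) : ℂ) • C + (((‖z‖ ^ 2 : ℝ)) : ℂ) • (C * J * C) := by
  have h1 : (((‖z‖ ^ 2 : ℝ)) : ℂ) = star z * z := by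
    rw [RCLike.star_def, ← Complex.normSq_eq_conj_mul_self, Complex.normSq_eq_norm_sq]
  have h2 : (((-2 * z.im : ℝ)) : ℂ) = Complex.I * z - Complex.I * star z := by
    apply Complex.ext <;> simp
    ring
  have hJJ : ∀ M : Matrix κ κ ℂ, J * (J * M) = M := fun M => by
    rw [← Matrix.mul_assoc, hJ, Matrix.one_mul]
  rw [h1, h2]
  simp only [conjTranspose_add, conjTranspose_one, conjTranspose_smul, conjTranspose_mul, hJH, hC,
    star_mul', RCLike.star_def, Complex.conj_I, Matrix.add_mul, Matrix.mul_add, Matrix.one_mul,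
    Matrix.mul_one, Matrix.smul_mul, Matrix.mul_smul, Matrix.mul_assoc, hJ, hJJ]
  match_scalars <;> ring_nf
  rw [Complex.I_sq]
  ring

/-- At a real λ outside σ(A) both Darboux matrices are J-unitary. With r = −1/λ, comparing J-forms
in the Darboux step gives w*(J + r²CJC)w = (1 + r²)J, hence w*(CJC)w = J = w*Jw, and w is
invertible. -/
lemma stepC_mul_mul_stepC (hA : IsUnit A.det) (hJ : J * J = 1) (hJH : Jᴴ = J) (hS : S.PosDef)
    (h : A * S - S * Aᴴ = Complex.I • (P * J * Pᴴ)) :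
    stepC J A S P * J * stepC J A S P = J := by
  -- A positive integer outside the finite spectrum: real and nonzero, as z = −1/λ requires.
  obtain ⟨l, ⟨k, rfl⟩, hl⟩ := (Set.infinite_range_of_injective
    (f := fun k : ℕ => ((k : ℂ) + 1)) (fun a b h => by simpa using h)).exists_notMem_finite
    (Matrix.finite_spectrum A)
  have hk : ((k : ℝ) + 1) ≠ 0 := by positivity
  set l : ℂ := (k : ℂ) + 1 with hl_def
  obtain ⟨r, hr, hrk⟩ : ∃ r : ℝ, r ≠ 0 ∧ (r : ℂ) * l = -1 := by
    refine ⟨-1 / ((k : ℝ) + 1), div_ne_zero (by norm_num) hk, ?_⟩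
    have : ((k : ℂ) + 1) ≠ 0 := by exact_mod_cast hk
    push_cast
    field_simp [hl_def]
    simp [hl_def]
  have hlim : l.im = 0 := by simp [hl_def]
  have hw := darboux_conj hJ hJH hS h hl
  have hw' := darboux_conj hJ hJH (posDef_stepS (A := A) (P := P) hS)
    (step_identity hA hJ hJH h) hl
  have hstep := darboux_step hA hJ hJH hS h hl hrk
  rw [hlim, mul_zero, Complex.ofReal_zero, zero_smul, add_zero] at hw hw'
  have hC : (stepC J A S P)ᴴ = stepC J A S P := (posSemidef_stepC hJ hJH hS).1.eq
  obtain ⟨C, hCdef⟩ : ∃ C, C = stepC J A S P := ⟨_, rfl⟩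
  rw [← hCdef] at hC hstep ⊢
  obtain ⟨w, hwdef⟩ : ∃ w, w = darboux J A S P l := ⟨_, rfl⟩
  obtain ⟨w', hwdef'⟩ : ∃ w, w = darboux J A (stepS A S P) (stepP J A P) l := ⟨_, rfl⟩
  rw [← hwdef] at hw hstep
  rw [← hwdef'] at hw' hstep
  have hone : (1 : Matrix κ κ ℂ)ᴴ = 1 := conjTranspose_one
  have h1 := conj_one_add_smul hJ hJH hC r
  have h2 := conj_one_add_smul hJ hJH hone r
  rw [Matrix.mul_one] at h2
  have h3 : wᴴ * ((1 + (Complex.I * r) • (J * C))ᴴ * J * (1 + (Complex.I * r) • (J * C))) * w =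
      (1 + (Complex.I * r) • J)ᴴ * J * (1 + (Complex.I * r) • J) := by
    calc _ = ((1 + (Complex.I * r) • (J * C)) * w)ᴴ * J * ((1 + (Complex.I * r) • (J * C)) * w) := by
          rw [conjTranspose_mul]; simp only [Matrix.mul_assoc]
      _ = (1 + (Complex.I * r) • J)ᴴ * (w'ᴴ * J * w') * (1 + (Complex.I * r) • J) := by
          rw [← hstep, conjTranspose_mul]; simp only [Matrix.mul_assoc]
      _ = _ := by rw [hw']
  rw [h1, h2] at h3
  simp only [Complex.ofReal_im, mul_zero, Complex.ofReal_zero, zero_smul, add_zero, Matrix.one_mul,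
    Matrix.mul_one, Matrix.mul_add, Matrix.add_mul, hw] at h3
  rw [add_right_inj, Matrix.mul_smul, Matrix.smul_mul] at h3
  have hr2 : (((‖(r : ℂ)‖ ^ 2 : ℝ)) : ℂ) ≠ 0 := by simp [hr]
  have h4 : wᴴ * (C * J * C) * w = J := smul_right_injective _ hr2 h3
  have h5 : J * wᴴ * J * w = 1 := by
    rw [Matrix.mul_assoc, Matrix.mul_assoc, ← Matrix.mul_assoc wᴴ, hw, hJ]
  have h6 : w * (J * wᴴ * J) = 1 := mul_eq_one_comm.1 h5
  have h7 : (J * wᴴ * J)ᴴ * wᴴ = 1 := by rw [← conjTranspose_mul, h6, conjTranspose_one]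
  calc C * J * C = ((J * wᴴ * J)ᴴ * wᴴ) * (C * J * C) * (w * (J * wᴴ * J)) := by
        rw [h6, h7, Matrix.one_mul, Matrix.mul_one]
    _ = (J * wᴴ * J)ᴴ * (wᴴ * (C * J * C) * w) * (J * wᴴ * J) := by
        simp only [Matrix.mul_assoc]
    _ = (J * wᴴ * J)ᴴ * (wᴴ * J * w) * (J * wᴴ * J) := by rw [h4, hw]
    _ = ((J * wᴴ * J)ᴴ * wᴴ) * J * (w * (J * wᴴ * J)) := by simp only [Matrix.mul_assoc]
    _ = J := by rw [h6, h7, Matrix.one_mul, Matrix.mul_one]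

lemma posDef_of_mul_mul_eq {C : Matrix κ κ ℂ} (hJ : J * J = 1) (hC : C.PosSemidef)
    (h : C * J * C = J) : C.PosDef := by
  rw [hC.posDef_iff_isUnit]
  refine IsUnit.of_mul_eq_one (J * C * J) ?_
  rw [← Matrix.mul_assoc, ← Matrix.mul_assoc, h, hJ]

end Step

/-! ### The sequences determined by an admissible triple -/

section Sequences

variable {m₁ m₂ n : ℕ}

lemma sig_mul_sig : sig m₁ m₂ * sig m₁ m₂ = 1 := by
  simp [sig, fromBlocks_multiply, ← fromBlocks_one]

lemma conjTranspose_sig : (sig m₁ m₂)ᴴ = sig m₁ m₂ := by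
  simp [sig, fromBlocks_conjTranspose]

variable {A S₀ : Matrix (Fin n) (Fin n) ℂ} {P₀ : Matrix (Fin n) (Fin m₁ ⊕ Fin m₂) ℂ}

lemma seqS_succ (k : ℕ) : seqS A S₀ P₀ (k + 1) = stepS A (seqS A S₀ P₀ k) (seqP A P₀ k) := rfl

lemma seqC_eq (k : ℕ) :
    seqC A S₀ P₀ k = stepC (sig m₁ m₂) A (seqS A S₀ P₀ k) (seqP A P₀ k) := rfl

namespace IsAdmissible

lemma isUnit_det (h : IsAdmissible A S₀ P₀) : IsUnit A.det := h.det_ne_zero.isUnit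

lemma posDef_seqS (h : IsAdmissible A S₀ P₀) (k : ℕ) : (seqS A S₀ P₀ k).PosDef := by
  induction k with
  | zero => exact h.posDef
  | succ k ih => exact posDef_stepS ih

lemma seq_identity (h : IsAdmissible A S₀ P₀) (k : ℕ) :
    A * seqS A S₀ P₀ k - seqS A S₀ P₀ k * Aᴴ =
      Complex.I • (seqP A P₀ k * sig m₁ m₂ * (seqP A P₀ k)ᴴ) := by
  induction k with
  | zero => exact h.identity
  | succ k ih => exact step_identity h.isUnit_det sig_mul_sig conjTranspose_sig ih

lemma isDiracPotential (h : IsAdmissible A S₀ P₀) : IsDiracPotential (seqC A S₀ P₀) := by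
  intro k
  have h1 : seqC A S₀ P₀ k * sig m₁ m₂ * seqC A S₀ P₀ k = sig m₁ m₂ :=
    stepC_mul_mul_stepC h.isUnit_det sig_mul_sig conjTranspose_sig (h.posDef_seqS k)
      (h.seq_identity k)
  exact ⟨posDef_of_mul_mul_eq sig_mul_sig
    (posSemidef_stepC sig_mul_sig conjTranspose_sig (h.posDef_seqS k)) h1, h1⟩

lemma fundSol_mul_darboux (h : IsAdmissible A S₀ P₀) {l z : ℂ} (hl : l ∉ spectrum ℂ A)
    (hz : z * l = -1) (k : ℕ) :
    fundSol (seqC A S₀ P₀) k z * darboux (sig m₁ m₂) A S₀ P₀ l =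
      darboux (sig m₁ m₂) A (seqS A S₀ P₀ k) (seqP A P₀ k) l *
        (1 + (Complex.I * z) • sig m₁ m₂) ^ k := by
  induction k with
  | zero => simp [fundSol, seqS, seqP]
  | succ k ih =>
    rw [fundSol, Matrix.mul_assoc, ih, ← Matrix.mul_assoc, seqC_eq,
      ← darboux_step h.isUnit_det sig_mul_sig conjTranspose_sig (h.posDef_seqS k)
        (h.seq_identity k) hl hz, pow_succ', ← Matrix.mul_assoc]
    rfl

end IsAdmissible

end Sequences

/-! ### Admissibility of the recovered triple -/

namespace Realization

variable {m₁ m₂ n : ℕ}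

/-- The required identity is i times the Riccati equation conjugated by X⁻¹, with 𝒜 rewritten
through A. -/
lemma recAdmissible {T : Realization m₁ m₂ n} {X : Matrix (Fin n) (Fin n) ℂ} (hX : X.PosDef)
    (hR : T.Riccati X) (hdet : (T.recA X).det ≠ 0) : T.RecAdmissible X := by
  refine ⟨hdet, hX.inv, ?_⟩
  have hu : IsUnit X.det := (isUnit_iff_isUnit_det _).1 hX.isUnit
  have hXi : (X⁻¹)ᴴ = X⁻¹ := hX.inv.1.eq
  have h1 := congrArg (fun M => Complex.I • (X⁻¹ * M * X⁻¹)) (riccati_iff.1 hR)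
  have hb : ∀ M : Matrix (Fin n) (Fin n) ℂ, X⁻¹ * (X * M) = M := fun M => by
    rw [← Matrix.mul_assoc, nonsing_inv_mul _ hu, Matrix.one_mul]
  simp only [Matrix.mul_sub, Matrix.sub_mul, Matrix.mul_smul, Matrix.smul_mul, Matrix.mul_add,
    Matrix.add_mul, Matrix.mul_assoc, mul_nonsing_inv _ hu, Matrix.mul_one, hb, smul_smul,
    Complex.I_mul_I, smul_add] at h1
  have h2 : T.recP X * sig m₁ m₂ * (T.recP X)ᴴ = X⁻¹ * (T.cᴴ * (T.c * X⁻¹)) - T.b * T.bᴴ := by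
    simp only [recP, sig, conjTranspose_fromCols_eq_fromRows_conjTranspose, fromCols_mul_fromBlocks,
      Matrix.mul_one, Matrix.mul_zero, zero_add, add_zero, fromCols_mul_fromRows, conjTranspose_smul,
      conjTranspose_mul, conjTranspose_conjTranspose, hXi, Matrix.smul_mul, Matrix.mul_smul,
      smul_smul, RCLike.star_def, Complex.conj_I, Matrix.mul_neg, Matrix.neg_mul, Matrix.mul_assoc]
    rw [neg_mul, Complex.I_mul_I, neg_neg, one_smul, ← sub_eq_add_neg]
  rw [h2, conjTranspose_recA, hX.1.eq, recA]
  simp only [Matrix.sub_mul, Matrix.mul_smul, Matrix.smul_mul, Matrix.mul_add, Matrix.mul_assoc,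
    mul_nonsing_inv _ hu, Matrix.mul_one, hb, smul_sub]
  linear_combination (norm := module) h1

end Realization

/-! ### Weyl functions: existence -/

section Summable

variable {ι : Type*} [Fintype ι] [DecidableEq ι]

lemma _root_.Matrix.PosSemidef.norm_apply_le {M : Matrix ι ι ℂ} (hM : M.PosSemidef) (i j : ι) :
    ‖M i j‖ ≤ (M i i).re + (M j j).re := by
  have h1 := (hM.submatrix ![i, j]).det_nonneg
  rw [det_fin_two] at h1
  simp only [submatrix_apply, cons_val_zero, cons_val_one] at h1
  have hii := hM.diag_nonneg (i := i)
  have hjj := hM.diag_nonneg (i := j)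
  have h2 : M j i = star (M i j) := by
    conv_lhs => rw [← hM.1.eq]
    rfl
  rw [Complex.nonneg_iff] at hii hjj
  have hi : M i i = ((M i i).re : ℂ) := Complex.ext rfl (by simp [← hii.2])
  have hj : M j j = ((M j j).re : ℂ) := Complex.ext rfl (by simp [← hjj.2])
  rw [h2, RCLike.star_def, mul_comm (M i j), ← Complex.normSq_eq_conj_mul_self, hi, hj,
    Complex.normSq_eq_norm_sq] at h1
  have h3 : 0 ≤ (M i i).re * (M j j).re - ‖M i j‖ ^ 2 := by exact_mod_cast h1
  exact abs_le_of_sq_le_sq' (by nlinarith [sq_nonneg (M i i).re, sq_nonneg (M j j).re]) (by linarith [hii.1, hjj.1]) |>.2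

/-- Diagonal entries have bounded nonnegative partial sums, and they dominate the off-diagonal ones.
-/
lemma summable_of_posSemidef {M : ℕ → Matrix ι ι ℂ} (hM : ∀ k, (M k).PosSemidef)
    {B : Matrix ι ι ℂ} (hB : ∀ r, (B - ∑ k ∈ Finset.range r, M k).PosSemidef) : Summable M := by
  have hdiag : ∀ i, Summable fun k => (M k i i).re := by
    intro i
    refine summable_of_sum_range_le (c := (B i i).re) (fun k => ?_) (fun r => ?_)
    · exact (Complex.nonneg_iff.1 ((hM k).diag_nonneg (i := i))).1
    · have := (Complex.nonneg_iff.1 ((hB r).diag_nonneg (i := i))).1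
      rw [Matrix.sub_apply, Matrix.sum_apply, Complex.sub_re, Complex.re_sum] at this
      linarith
  refine Pi.summable.2 fun i => Pi.summable.2 fun j => ?_
  exact Summable.of_norm_bounded ((hdiag i).add (hdiag j)) fun k => (hM k).norm_apply_le i j

end Summable

/-! ### Energy identity for the fundamental solution -/

section Telescoping

variable {m₁ m₂ : ℕ} {C : ℕ → Matrix (Fin m₁ ⊕ Fin m₂) (Fin m₁ ⊕ Fin m₂) ℂ}

lemma IsDiracPotential.fundSol_succ_conj (hC : IsDiracPotential C) (k : ℕ) (z : ℂ) :
    (fundSol C (k + 1) z)ᴴ * sig m₁ m₂ * fundSol C (k + 1) z =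
      (((1 + ‖z‖ ^ 2 : ℝ)) : ℂ) • ((fundSol C k z)ᴴ * sig m₁ m₂ * fundSol C k z) +
        (((-2 * z.im : ℝ)) : ℂ) • ((fundSol C k z)ᴴ * C k * fundSol C k z) := by
  have h1 := conj_one_add_smul sig_mul_sig conjTranspose_sig (hC k).1.1.eq z
  rw [(hC k).2] at h1
  have h2 : (fundSol C (k + 1) z)ᴴ * sig m₁ m₂ * fundSol C (k + 1) z =
      (fundSol C k z)ᴴ * ((1 + (Complex.I * z) • (sig m₁ m₂ * C k))ᴴ * sig m₁ m₂ *
        (1 + (Complex.I * z) • (sig m₁ m₂ * C k))) * fundSol C k z := by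
    rw [fundSol, conjTranspose_mul]; simp only [Matrix.mul_assoc]
  rw [h2, h1]
  simp only [Matrix.mul_add, Matrix.add_mul, Matrix.mul_smul, Matrix.smul_mul]
  push_cast
  module

lemma IsDiracPotential.sum_range (hC : IsDiracPotential C) (z : ℂ) (r : ℕ) :
    (((-2 * z.im : ℝ)) : ℂ) • ∑ k ∈ Finset.range r, ((((1 + ‖z‖ ^ 2)⁻¹ ^ k : ℝ) : ℂ) •
        ((fundSol C k z)ᴴ * C k * fundSol C k z)) =
      (((1 + ‖z‖ ^ 2 : ℝ)) : ℂ) • ((((1 + ‖z‖ ^ 2)⁻¹ ^ r : ℝ) : ℂ) •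
        ((fundSol C r z)ᴴ * sig m₁ m₂ * fundSol C r z) - sig m₁ m₂) := by
  have hq : (1 + ‖z‖ ^ 2 : ℝ) ≠ 0 := by positivity
  induction r with
  | zero => simp [fundSol]
  | succ r ih =>
    rw [Finset.sum_range_succ, smul_add, ih, hC.fundSol_succ_conj, smul_add, smul_smul, smul_smul]
    have h1 : ((((1 + ‖z‖ ^ 2)⁻¹ ^ (r + 1) : ℝ) : ℂ)) * (((1 + ‖z‖ ^ 2 : ℝ)) : ℂ) =
        (((1 + ‖z‖ ^ 2)⁻¹ ^ r : ℝ) : ℂ) := by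
      rw [← Complex.ofReal_mul, pow_succ, mul_assoc, inv_mul_cancel₀ hq, mul_one]
    rw [h1]
    simp only [smul_add, smul_sub, smul_smul]
    have h2 : (((1 + ‖z‖ ^ 2 : ℝ)) : ℂ) * (((((1 + ‖z‖ ^ 2)⁻¹ ^ (r + 1) : ℝ) : ℂ)) *
        (((-2 * z.im : ℝ)) : ℂ)) = (((-2 * z.im : ℝ)) : ℂ) * (((1 + ‖z‖ ^ 2)⁻¹ ^ r : ℝ) : ℂ) := by
      rw [← h1]; ring
    rw [h2]
    module

end Telescoping

namespace Realization

variable {m₁ m₂ n : ℕ}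

/-- With R = (λ − 𝒜)⁻¹ℬ and D = I + iℬ*XR one has (A − λ)R = −ℬD, so the resolvent of A in w can be
evaluated explicitly. Thus the Weyl column comes from a column in the negative eigenspace of j. -/
lemma darboux_mul_fromRows {T : Realization m₁ m₂ n} {X : Matrix (Fin n) (Fin n) ℂ}
    (hX : X.PosDef) {l : ℂ} (hl : l ∉ spectrum ℂ T.a) (hl' : l ∉ spectrum ℂ (T.recA X)) :
    ∃ D : Matrix (Fin m₂) (Fin m₂) ℂ, darboux (sig m₁ m₂) (T.recA X) X⁻¹ (T.recP X) l *
      fromRows (0 : Matrix (Fin m₁) (Fin m₂) ℂ) D = fromRows (T.transfer l) 1 := by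
  have hu : IsUnit X.det := (isUnit_iff_isUnit_det _).1 hX.isUnit
  have h1 := isUnit_det_of_notMem_spectrum hl
  have h2 := isUnit_det_of_notMem_spectrum hl'
  obtain ⟨R, hR⟩ : ∃ R, R = (l • (1 : Matrix (Fin n) (Fin n) ℂ) - T.a)⁻¹ * T.b := ⟨_, rfl⟩
  have hRb : (l • (1 : Matrix (Fin n) (Fin n) ℂ) - T.a) * R = T.b := by
    rw [hR, ← Matrix.mul_assoc, mul_nonsing_inv _ h1, Matrix.one_mul]
  have hAR : (T.recA X - l • (1 : Matrix (Fin n) (Fin n) ℂ)) * R =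
      -(T.b * (1 + Complex.I • (T.bᴴ * X * R))) := by
    rw [recA, Matrix.mul_add, Matrix.mul_one]
    simp only [Matrix.sub_mul, Matrix.smul_mul, Matrix.one_mul, Matrix.mul_smul,
      Matrix.mul_assoc] at hRb ⊢
    linear_combination (norm := module) -hRb
  have hdet : IsUnit (T.recA X - l • (1 : Matrix (Fin n) (Fin n) ℂ)).det := by
    rw [← neg_sub, det_neg] at h2
    exact (isUnit_of_mul_isUnit_right h2)
  refine ⟨1 + Complex.I • (T.bᴴ * X * R), ?_⟩
  have h3 : (T.recA X - l • (1 : Matrix (Fin n) (Fin n) ℂ))⁻¹ *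
      (T.recP X * fromRows (0 : Matrix (Fin m₁) (Fin m₂) ℂ) (1 + Complex.I • (T.bᴴ * X * R))) = -R := by
    rw [recP, fromCols_mul_fromRows, Matrix.mul_zero, zero_add, neg_eq_iff_eq_neg.1 hAR.symm,
      Matrix.mul_neg, ← Matrix.mul_assoc, nonsing_inv_mul _ hdet, Matrix.one_mul]
  have h4 : (T.recP X)ᴴ * X = fromRows (-Complex.I • T.c) (T.bᴴ * X) := by
    rw [recP, conjTranspose_fromCols_eq_fromRows_conjTranspose, fromRows_mul]
    congr 1
    rw [conjTranspose_smul, conjTranspose_mul, conjTranspose_conjTranspose, hX.inv.1.eq,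
      Matrix.smul_mul, Matrix.mul_assoc, nonsing_inv_mul _ hu, Matrix.mul_one]
    simp
  rw [darboux, Matrix.sub_mul, Matrix.one_mul, Matrix.smul_mul, nonsing_inv_nonsing_inv _ hu]
  simp only [Matrix.mul_assoc] at h3 ⊢
  rw [h3, Matrix.mul_neg X, Matrix.mul_neg, ← Matrix.mul_assoc (T.recP X)ᴴ X, h4, Matrix.mul_neg, sig,
    fromRows_mul, fromBlocks_mul_fromRows]
  have h5 : T.transfer l = T.c * R := by rw [transfer, hR, Matrix.mul_assoc]
  rw [h5]
  ext i j
  rcases i with i | i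
  · simp [fromRows_apply_inl, ← mul_assoc]
  · simp [fromRows_apply_inr, Matrix.mul_assoc]

/-- Put λ = −1/z, again in the lower half-plane; the spectral condition ensures λ ∉ σ(A). The Weyl
solution is w_k applied to the free solution [0; (1 − iz)^k D], and w_k*jw_k ≤ j makes its j-energy
nonpositive at every k. -/
theorem isWeylFunction_recC {T : Realization m₁ m₂ n} (hT : T ∈ classG m₁ m₂ n)
    {X : Matrix (Fin n) (Fin n) ℂ} (hX : T.IsSpectralSolution X) (hadm : T.RecAdmissible X) :
    IsWeylFunction (T.recC X) (fun z => T.transfer (-1 / z)) := by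
  intro z hz
  have hz0 : z ≠ 0 := by rintro rfl; simp at hz
  obtain ⟨l, hl⟩ : ∃ l, l = -1 / z := ⟨_, rfl⟩
  have hzl : z * l = -1 := by rw [hl]; field_simp
  have hlim : l.im < 0 := by
    rw [hl, neg_div, one_div, Complex.neg_im, Complex.inv_im, neg_div, neg_neg]
    exact div_neg_of_neg_of_pos hz (Complex.normSq_pos.2 hz0)
  have hla : l ∉ spectrum ℂ T.a := notMem_spectrum_of_im_nonpos hT hlim.le
  have hlA : l ∉ spectrum ℂ (T.recA X) := fun h =>
    absurd (hX.spectrum_subset h : 0 ≤ l.im) (not_le.2 hlim)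
  obtain ⟨D, hD⟩ := darboux_mul_fromRows hX.posDef hla hlA
  have hpot : IsDiracPotential (T.recC X) := hadm.isDiracPotential
  obtain ⟨Φ, hΦ⟩ : ∃ Φ, Φ = fromRows (T.transfer l) (1 : Matrix (Fin m₂) (Fin m₂) ℂ) := ⟨_, rfl⟩
  change Summable fun k : ℕ => (((1 + ‖z‖ ^ 2)⁻¹ ^ k : ℝ) : ℂ) •
        ((fromRows (T.transfer (-1 / z)) (1 : Matrix (Fin m₂) (Fin m₂) ℂ))ᴴ *
          (fundSol (T.recC X) k z)ᴴ * (T.recC X) k *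
          fundSol (T.recC X) k z * fromRows (T.transfer (-1 / z)) (1 : Matrix (Fin m₂) (Fin m₂) ℂ))
  rw [← hl, ← hΦ]
  have hneg : ∀ r, (-(Φᴴ * ((fundSol (T.recC X) r z)ᴴ * sig m₁ m₂ * fundSol (T.recC X) r z) *
      Φ)).PosSemidef := by
    intro r
    obtain ⟨w, hw⟩ : ∃ w, w = darboux (sig m₁ m₂) (T.recA X)
      (seqS (T.recA X) X⁻¹ (T.recP X) r) (seqP (T.recA X) (T.recP X) r) l := ⟨_, rfl⟩
    have hpow : ∀ k : ℕ, (1 + (Complex.I * z) • sig m₁ m₂) ^ k *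
        fromRows (0 : Matrix (Fin m₁) (Fin m₂) ℂ) D =
          fromRows (0 : Matrix (Fin m₁) (Fin m₂) ℂ) ((1 - Complex.I * z) ^ k • D) := by
      intro k
      induction k with
      | zero => simp
      | succ k ih =>
        rw [pow_succ', Matrix.mul_assoc, ih, Matrix.add_mul, Matrix.one_mul, Matrix.smul_mul, sig,
          fromBlocks_mul_fromRows]
        ext i j
        rcases i with i | i
        · simp [fromRows_apply_inl]
        · simp [fromRows_apply_inr, pow_succ]; ring
    have h1 : fundSol (T.recC X) r z * Φ =
        w * fromRows (0 : Matrix (Fin m₁) (Fin m₂) ℂ) ((1 - Complex.I * z) ^ r • D) := by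
      rw [hΦ, ← hD, ← Matrix.mul_assoc, ← hpow, ← Matrix.mul_assoc, hw]
      congr 1
      exact hadm.fundSol_mul_darboux hlA hzl r
    obtain ⟨E, hE⟩ : ∃ E, E = (1 - Complex.I * z) ^ r • D := ⟨_, rfl⟩
    rw [← hE] at h1
    have h2 := darboux_conj sig_mul_sig conjTranspose_sig (hadm.posDef_seqS r)
      (hadm.seq_identity r) hlA
    rw [← hw] at h2
    have h3 : Φᴴ * ((fundSol (T.recC X) r z)ᴴ * sig m₁ m₂ * fundSol (T.recC X) r z) * Φ =
        (fromRows (0 : Matrix (Fin m₁) (Fin m₂) ℂ) E)ᴴ * (wᴴ * sig m₁ m₂ * w) *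
          fromRows (0 : Matrix (Fin m₁) (Fin m₂) ℂ) E := by
      calc _ = (fundSol (T.recC X) r z * Φ)ᴴ * sig m₁ m₂ * (fundSol (T.recC X) r z * Φ) := by
            rw [conjTranspose_mul]; simp only [Matrix.mul_assoc]
        _ = _ := by rw [h1, conjTranspose_mul]; simp only [Matrix.mul_assoc]
    rw [h3, h2, Matrix.mul_add, Matrix.add_mul, neg_add]
    refine PosSemidef.add ?_ ?_
    · have h4 : -((fromRows (0 : Matrix (Fin m₁) (Fin m₂) ℂ) E)ᴴ * sig m₁ m₂ *
          fromRows (0 : Matrix (Fin m₁) (Fin m₂) ℂ) E) = Eᴴ * E := by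
        rw [Matrix.mul_assoc, sig, fromBlocks_mul_fromRows,
          conjTranspose_fromRows_eq_fromCols_conjTranspose, fromCols_mul_fromRows]
        simp
      rw [h4]
      exact posSemidef_conjTranspose_mul_self E
    · rw [Matrix.mul_smul, Matrix.smul_mul, ← neg_smul, ← Complex.ofReal_neg]
      refine PosSemidef.smul ?_ (Complex.zero_le_real.2 (by linarith))
      exact ((hadm.posDef_seqS r).inv.posSemidef.conjTranspose_mul_mul_same _).conjTranspose_mul_mul_same _
  have him : 0 < -2 * z.im := by linarith
  have hq : (0 : ℝ) < 1 + ‖z‖ ^ 2 := by positivity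
  -- The bound is the initial term of the telescoped sum; the boundary term at r has a favourable
  -- sign and is dropped.
  refine summable_of_posSemidef
    (B := ((((-2 * z.im)⁻¹ * (1 + ‖z‖ ^ 2) : ℝ)) : ℂ) • -(Φᴴ * sig m₁ m₂ * Φ))
    (fun k => ?_) (fun r => ?_)
  · refine PosSemidef.smul ?_ (Complex.zero_le_real.2 (by positivity))
    have := ((hpot k).1.posSemidef.conjTranspose_mul_mul_same
      (fundSol (T.recC X) k z)).conjTranspose_mul_mul_same Φ
    simpa only [Matrix.mul_assoc] using this
  · have h1 := congrArg (fun M => ((((-2 * z.im)⁻¹ : ℝ)) : ℂ) • (Φᴴ * M * Φ)) (hpot.sum_range z r)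
    simp only [Matrix.mul_smul, Matrix.smul_mul, smul_smul, ← Complex.ofReal_mul,
      inv_mul_cancel₀ him.ne', Complex.ofReal_one, one_smul, Matrix.mul_sum, Matrix.sum_mul,
      Matrix.mul_sub, Matrix.sub_mul] at h1
    have h2 : ∑ k ∈ Finset.range r, (((1 + ‖z‖ ^ 2)⁻¹ ^ k : ℝ) : ℂ) • (Φᴴ *
        (fundSol (T.recC X) k z)ᴴ * T.recC X k * fundSol (T.recC X) k z * Φ) =
        ∑ k ∈ Finset.range r, (((1 + ‖z‖ ^ 2)⁻¹ ^ k : ℝ) : ℂ) • (Φᴴ *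
        ((fundSol (T.recC X) k z)ᴴ * T.recC X k * fundSol (T.recC X) k z) * Φ) := by
      simp only [Matrix.mul_assoc]
    rw [h2, h1]
    have h3 : (((((-2 * z.im)⁻¹ * (1 + ‖z‖ ^ 2) * (1 + ‖z‖ ^ 2)⁻¹ ^ r : ℝ)) : ℂ) •
        -(Φᴴ * ((fundSol (T.recC X) r z)ᴴ * sig m₁ m₂ * fundSol (T.recC X) r z) *
      Φ)).PosSemidef := (hneg r).smul (Complex.zero_le_real.2 (by positivity))
    convert h3 using 1
    push_cast
    module

end Realization

/-! ### Weyl functions: uniqueness of the potential -/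

section OneMatrix

variable {κ ν : Type*} [Fintype κ] [DecidableEq κ] [Fintype ν] [DecidableEq ν] {C J : Matrix κ κ ℂ}

/-- Because CJC = J, one has 2(C + J) = (C + J)(JCJ)(C + J), and JCJ ≥ 0. -/
lemma posSemidef_add_of_mul_mul_eq (hJ : J * J = 1) (hJH : Jᴴ = J) (hC : C.PosDef)
    (h : C * J * C = J) : (C + J).PosSemidef := by
  have h1 : (J * C * J).PosSemidef := by
    have := hC.posSemidef.conjTranspose_mul_mul_same J
    rwa [hJH] at this
  have h2 := (h1.conjTranspose_mul_mul_same (C + J)).smul (Complex.zero_le_real.2 (by norm_num : (0 : ℝ) ≤ 1 / 2))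
  have h3 : ∀ M : Matrix κ κ ℂ, J * (J * M) = M := fun M => by
    rw [← Matrix.mul_assoc, hJ, Matrix.one_mul]
  have h4 : ∀ M : Matrix κ κ ℂ, C * (J * (C * M)) = J * M := fun M => by
    rw [← Matrix.mul_assoc, ← Matrix.mul_assoc, h]
  have h5 : C * (J * C) = J := by rw [← Matrix.mul_assoc, h]
  convert h2 using 1
  rw [conjTranspose_add, hJH, hC.1.eq]
  simp only [Matrix.mul_add, Matrix.add_mul, Matrix.mul_assoc, h3, h4, h5, hJ, Matrix.mul_one,
    Matrix.one_mul]
  push_cast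
  module

lemma posSemidef_sub_of_mul_mul_eq (hJ : J * J = 1) (hJH : Jᴴ = J) (hC : C.PosDef)
    (h : C * J * C = J) : (C - J).PosSemidef := by
  have := posSemidef_add_of_mul_mul_eq (J := -J) (by simpa using hJ) (by simp [hJH]) hC
    (by simp [h])
  rwa [← sub_eq_add_neg] at this

lemma mul_eq_one_of_mul_mul_eq (hJ : J * J = 1) (h : C * J * C = J) : J * C * (J * C) = 1 := by
  rw [Matrix.mul_assoc, ← Matrix.mul_assoc C, h, hJ]

end OneMatrix

/-! ### Recovering one coefficient from its eigenspace -/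

section Reconstruction

variable {m₁ m₂ : ℕ} {C : Matrix (Fin m₁ ⊕ Fin m₂) (Fin m₁ ⊕ Fin m₂) ℂ}

lemma conj_sig {ν : Type*} (Φ : Matrix (Fin m₁ ⊕ Fin m₂) ν ℂ) :
    Φᴴ * sig m₁ m₂ * Φ = Φ.toRows₁ᴴ * Φ.toRows₁ - Φ.toRows₂ᴴ * Φ.toRows₂ := by
  conv_lhs => rw [← fromRows_toRows Φ]
  rw [Matrix.mul_assoc, sig, fromBlocks_mul_fromRows,
    conjTranspose_fromRows_eq_fromCols_conjTranspose, fromCols_mul_fromRows]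
  simp [sub_eq_add_neg]

/-- A `j`-unitary positive definite matrix is determined by a basis of the eigenspace of `j C`
for the eigenvalue `-1`. -/
lemma eq_of_mul_eq_neg_sig_mul {Φ : Matrix (Fin m₁ ⊕ Fin m₂) (Fin m₂) ℂ}
    (hΦ : Function.Injective Φ.mulVec) (hC : C.PosDef) (hCJ : C * sig m₁ m₂ * C = sig m₁ m₂)
    (h : C * Φ = -(sig m₁ m₂ * Φ)) :
    C = sig m₁ m₂ - (2 : ℂ) • (sig m₁ m₂ *
      (Φ * ((Φᴴ * sig m₁ m₂ * Φ)⁻¹ * (Φᴴ * sig m₁ m₂)))) := by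
  set J := sig m₁ m₂ with hJdef
  have hJ : J * J = 1 := sig_mul_sig
  have hJH : Jᴴ = J := conjTranspose_sig
  have hpos : (Φᴴ * C * Φ).PosDef := hC.conjTranspose_mul_mul_same hΦ
  have hK : Φᴴ * J * Φ = -(Φᴴ * C * Φ) := by
    rw [Matrix.mul_assoc, Matrix.mul_assoc, h, Matrix.mul_neg, neg_neg]
  have hKu : IsUnit (Φᴴ * J * Φ).det := by
    rw [hK, ← isUnit_iff_isUnit_det]
    exact hpos.isUnit.neg
  have hΦ2 : IsUnit Φ.toRows₂.det := by
    have h1 : Φ.toRows₂ᴴ * Φ.toRows₂ = Φ.toRows₁ᴴ * Φ.toRows₁ + Φᴴ * C * Φ := by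
      have := conj_sig Φ
      rw [← hJdef, hK] at this
      rw [← sub_eq_iff_eq_add', ← neg_sub, ← this, neg_neg]
    have h2 : (Φ.toRows₂ᴴ * Φ.toRows₂).PosDef := by
      rw [h1]
      exact PosDef.posSemidef_add (posSemidef_conjTranspose_mul_self _) hpos
    have h3 := (isUnit_iff_isUnit_det _).1 h2.isUnit
    rw [det_mul] at h3
    exact isUnit_of_mul_isUnit_right h3
  have hΦC : Φᴴ * C = -(Φᴴ * J) := by
    have := congrArg conjTranspose h
    rwa [conjTranspose_mul, conjTranspose_neg, conjTranspose_mul, hJH, hC.1.eq] at this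
  -- The columns of Φ exhaust the eigenspace: subtract a combination that kills the lower block. The
  -- remainder u' has u'*Cu' = −u'*ju' ≤ 0, so it is zero.
  have heig : ∀ u : Matrix (Fin m₁ ⊕ Fin m₂) (Fin m₁ ⊕ Fin m₂) ℂ, C * u = -(J * u) →
      u = Φ * (Φ.toRows₂⁻¹ * u.toRows₂) := by
    intro u hu
    set u' := u - Φ * (Φ.toRows₂⁻¹ * u.toRows₂) with hu'
    have h1 : C * u' = -(J * u') := by
      rw [hu', Matrix.mul_sub, Matrix.mul_sub, hu, ← Matrix.mul_assoc, h, ← Matrix.mul_assoc J,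
        Matrix.neg_mul]
      abel
    have h2 : u'.toRows₂ = 0 := by
      have h3 : u'.toRows₂ = u.toRows₂ - Φ.toRows₂ * (Φ.toRows₂⁻¹ * u.toRows₂) := rfl
      rw [h3, ← Matrix.mul_assoc, mul_nonsing_inv _ hΦ2, Matrix.one_mul, sub_self]
    have h3 : u'ᴴ * C * u' = -(u'.toRows₁ᴴ * u'.toRows₁) := by
      have := conj_sig u'
      rw [h2, Matrix.mul_zero, sub_zero] at this
      rw [← this, Matrix.mul_assoc, h1, Matrix.mul_neg, ← hJdef, Matrix.mul_assoc]
    have h4 : (-(u'ᴴ * C * u')).PosSemidef := by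
      rw [h3, neg_neg]
      exact posSemidef_conjTranspose_mul_self _
    have h5 := (hC.posSemidef.conjTranspose_mul_mul_same u').eq_zero_of_neg h4
    exact sub_eq_zero.1 (hC.eq_zero_of_conj_eq_zero h5)
  have hJJ : ∀ M : Matrix (Fin m₁ ⊕ Fin m₂) (Fin m₁ ⊕ Fin m₂) ℂ, J * (J * M) = M := fun M => by
    rw [← Matrix.mul_assoc, hJ, Matrix.one_mul]
  -- Q projects along Φ onto its j-orthogonal complement. The columns of (1 − jC)Q lie in the
  -- eigenspace spanned by Φ and are j-orthogonal to Φ, so they vanish; expanding (1 − jC)Q = 0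
  -- gives C.
  obtain ⟨Q, hQ⟩ : ∃ Q, Q = 1 - Φ * ((Φᴴ * J * Φ)⁻¹ * (Φᴴ * J)) := ⟨_, rfl⟩
  have hΦQ : Φᴴ * J * Q = 0 := by
    rw [hQ, Matrix.mul_sub, Matrix.mul_one, ← Matrix.mul_assoc, ← Matrix.mul_assoc,
      mul_nonsing_inv _ hKu, Matrix.one_mul, sub_self]
  have hY := heig ((1 - J * C) * Q) (by
    rw [← Matrix.mul_assoc, ← Matrix.mul_assoc, Matrix.mul_sub, Matrix.mul_sub, Matrix.mul_one,
      Matrix.mul_one, hJJ, ← Matrix.mul_assoc, hCJ, ← Matrix.neg_mul, neg_sub])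
  have hV : Φ.toRows₂⁻¹ * ((1 - J * C) * Q).toRows₂ = 0 := by
    have h1 : Φᴴ * J * ((1 - J * C) * Q) = 0 := by
      have h2 : Φᴴ * J * (1 - J * C) = (2 : ℂ) • (Φᴴ * J) := by
        rw [Matrix.mul_sub, Matrix.mul_one, Matrix.mul_assoc, hJJ, hΦC]
        module
      rw [← Matrix.mul_assoc, h2, Matrix.smul_mul, hΦQ, smul_zero]
    rw [hY, ← Matrix.mul_assoc] at h1
    have h3 := congrArg ((Φᴴ * J * Φ)⁻¹ * ·) h1
    beta_reduce at h3
    rw [← Matrix.mul_assoc, nonsing_inv_mul _ hKu, Matrix.one_mul, Matrix.mul_zero] at h3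
    exact h3
  rw [hV, Matrix.mul_zero] at hY
  have h1 : J * ((1 - J * C) * Q) = 0 := by rw [hY, Matrix.mul_zero]
  have h2 : J * (J * C * Φ) = -(J * Φ) := by
    rw [Matrix.mul_assoc, ← Matrix.mul_assoc J J, hJ, Matrix.one_mul, h]
  rw [← Matrix.mul_assoc, Matrix.mul_sub, Matrix.mul_one, hJJ, hQ, Matrix.mul_sub, Matrix.mul_one,
    ← Matrix.mul_assoc (J - C), Matrix.sub_mul J C Φ, h, sub_neg_eq_add, ← two_smul ℂ (J * Φ),
    Matrix.smul_mul, Matrix.mul_assoc J Φ] at h1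
  rw [eq_sub_iff_add_eq, ← sub_eq_zero, ← neg_eq_zero, ← h1]
  abel

end Reconstruction

/-! ### Step-by-step recovery of the potential -/

section Uniqueness

variable {m₁ m₂ : ℕ} {C : ℕ → Matrix (Fin m₁ ⊕ Fin m₂) (Fin m₁ ⊕ Fin m₂) ℂ}

/-- Summability of the Weyl series for the solution with initial value `Φ`. -/
def WeylSummable (C : ℕ → Matrix (Fin m₁ ⊕ Fin m₂) (Fin m₁ ⊕ Fin m₂) ℂ) (z : ℂ)
    (Φ : Matrix (Fin m₁ ⊕ Fin m₂) (Fin m₂) ℂ) : Prop :=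
  Summable fun k : ℕ => (((1 + ‖z‖ ^ 2)⁻¹ ^ k : ℝ) : ℂ) •
    (Φᴴ * ((fundSol C k z)ᴴ * C k * fundSol C k z) * Φ)

/-- The scaled energies e_k increase and satisfy e_k ≤ t_k since j ≤ C_k, while the terms t_k of the
convergent series tend to 0. Hence e_1 ≤ 0, and (1 + |z|²)e_1 is the matrix in question. -/
lemma IsDiracPotential.posSemidef_of_weylSummable (hC : IsDiracPotential C) {z : ℂ} (hz : z.im < 0)
    {Φ : Matrix (Fin m₁ ⊕ Fin m₂) (Fin m₂) ℂ} (hΦ : WeylSummable C z Φ) :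
    (-(Φᴴ * ((((1 + ‖z‖ ^ 2 : ℝ)) : ℂ) • sig m₁ m₂ + (((-2 * z.im : ℝ)) : ℂ) • C 0) *
      Φ)).PosSemidef := by
  let t : ℕ → Matrix (Fin m₂) (Fin m₂) ℂ := fun k => (((1 + ‖z‖ ^ 2)⁻¹ ^ k : ℝ) : ℂ) •
    (Φᴴ * ((fundSol C k z)ᴴ * C k * fundSol C k z) * Φ)
  let e : ℕ → Matrix (Fin m₂) (Fin m₂) ℂ := fun k => (((1 + ‖z‖ ^ 2)⁻¹ ^ k : ℝ) : ℂ) •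
    (Φᴴ * ((fundSol C k z)ᴴ * sig m₁ m₂ * fundSol C k z) * Φ)
  have hq : (0 : ℝ) < 1 + ‖z‖ ^ 2 := by positivity
  have ha : 0 < -2 * z.im := by linarith
  have htpos : ∀ k, (t k).PosSemidef := fun k =>
    ((((hC k).1.posSemidef.conjTranspose_mul_mul_same _).conjTranspose_mul_mul_same _)).smul
      (Complex.zero_le_real.2 (by positivity))
  have hte : ∀ k, (t k - e k).PosSemidef := fun k => by
    have h1 := ((((posSemidef_sub_of_mul_mul_eq sig_mul_sig conjTranspose_sig (hC k).1
      (hC k).2).conjTranspose_mul_mul_same (fundSol C k z)).conjTranspose_mul_mul_same Φ)).smul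
        (Complex.zero_le_real.2 (by positivity : 0 ≤ (1 + ‖z‖ ^ 2)⁻¹ ^ k))
    simpa only [Matrix.mul_sub, Matrix.sub_mul, smul_sub] using h1
  have hstep : ∀ k, e (k + 1) = e k + (((-2 * z.im) * (1 + ‖z‖ ^ 2)⁻¹ : ℝ) : ℂ) • t k := by
    intro k
    simp only [e, t]
    rw [hC.fundSol_succ_conj]
    simp only [Matrix.mul_add, Matrix.add_mul, Matrix.mul_smul, Matrix.smul_mul, smul_add,
      smul_smul, ← Complex.ofReal_mul]
    have h1 : (1 + ‖z‖ ^ 2)⁻¹ ^ (k + 1) * (1 + ‖z‖ ^ 2) = (1 + ‖z‖ ^ 2)⁻¹ ^ k := by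
      rw [pow_succ, mul_assoc, inv_mul_cancel₀ hq.ne', mul_one]
    have h2 : (1 + ‖z‖ ^ 2)⁻¹ ^ (k + 1) * (-2 * z.im) =
        -2 * z.im * (1 + ‖z‖ ^ 2)⁻¹ * (1 + ‖z‖ ^ 2)⁻¹ ^ k := by
      rw [pow_succ]; ring
    rw [h1, h2]
  have hmono : ∀ k, (e (k + 1) - e 1).PosSemidef := by
    intro k
    induction k with
    | zero => rw [sub_self]; exact .zero
    | succ k ih =>
      rw [hstep (k + 1), add_sub_right_comm]
      exact ih.add ((htpos _).smul (Complex.zero_le_real.2 (by positivity)))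
  have hlim : Tendsto (fun k => t (k + 1) - e 1) atTop (𝓝 (0 - e 1)) :=
    ((tendsto_add_atTop_iff_nat 1).2 hΦ.tendsto_atTop_zero).sub tendsto_const_nhds
  have h1 : (0 - e 1).PosSemidef := by
    refine isClosed_posSemidef.mem_of_tendsto hlim (Eventually.of_forall fun k => ?_)
    have := (hte (k + 1)).add (hmono k)
    rwa [sub_add_sub_cancel] at this
  have h2 := h1.smul (Complex.zero_le_real.2 hq.le)
  convert h2 using 1
  rw [hstep 0]
  simp only [e, t, fundSol, pow_zero, Complex.ofReal_one, one_smul, conjTranspose_one,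
    Matrix.one_mul, Matrix.mul_one, zero_sub, smul_neg, smul_add, smul_smul, ← Complex.ofReal_mul,
    Matrix.mul_add, Matrix.add_mul, Matrix.mul_smul, Matrix.smul_mul]
  have h3 : (1 + ‖z‖ ^ 2) * (-2 * z.im * (1 + ‖z‖ ^ 2)⁻¹) = -2 * z.im := by field_simp
  rw [h3]

lemma fundSol_succ_eq (C : ℕ → Matrix (Fin m₁ ⊕ Fin m₂) (Fin m₁ ⊕ Fin m₂) ℂ) (k : ℕ) (z : ℂ) :
    fundSol C (k + 1) z =
      fundSol (fun r => C (r + 1)) k z * (1 + (Complex.I * z) • (sig m₁ m₂ * C 0)) := by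
  induction k with
  | zero => simp [fundSol]
  | succ k ih => rw [fundSol, ih, ← Matrix.mul_assoc]; rfl

/-- The first factor of the fundamental solution is absorbed into the initial value; the free scalar
c leaves room for the division by z + i. -/
lemma WeylSummable.shift {z : ℂ} {Φ : Matrix (Fin m₁ ⊕ Fin m₂) (Fin m₂) ℂ}
    (h : WeylSummable C z Φ) (c : ℂ) :
    WeylSummable (fun k => C (k + 1)) z
      (c • ((1 + (Complex.I * z) • (sig m₁ m₂ * C 0)) * Φ)) := by
  have hq : (1 + ‖z‖ ^ 2 : ℝ) ≠ 0 := by positivity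
  have h1 := ((summable_nat_add_iff 1).2 h).const_smul
    ((star c * c * (((1 + ‖z‖ ^ 2 : ℝ)) : ℂ)))
  refine h1.congr fun k => ?_
  rw [fundSol_succ_eq]
  simp only [conjTranspose_smul, conjTranspose_mul, Matrix.smul_mul, Matrix.mul_smul, smul_smul,
    Matrix.mul_assoc]
  congr 1
  have h2 : (1 + ‖z‖ ^ 2) * (1 + ‖z‖ ^ 2)⁻¹ ^ (k + 1) = (1 + ‖z‖ ^ 2)⁻¹ ^ k := by
    rw [pow_succ' _ k, ← mul_assoc, mul_inv_cancel₀ hq, one_mul]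
  rw [mul_assoc, ← Complex.ofReal_mul, h2]
  ring

/-- Data from which the potential can be recovered step by step: a potential `C` and a holomorphic
family of initial values, non-degenerate at `-i`, whose Weyl series converge. -/
structure IsWeylFamily (C : ℕ → Matrix (Fin m₁ ⊕ Fin m₂) (Fin m₁ ⊕ Fin m₂) ℂ)
    (Φ : ℂ → Matrix (Fin m₁ ⊕ Fin m₂) (Fin m₂) ℂ) : Prop where
  potential : IsDiracPotential C
  differentiableOn : DifferentiableOn ℂ Φ {z | z.im < 0}
  injective : Function.Injective (Φ (-Complex.I)).mulVec
  summable : ∀ z : ℂ, z.im < 0 → z ≠ -Complex.I → WeylSummable C z (Φ z)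

lemma isOpen_lowerHalfPlane : IsOpen {z : ℂ | z.im < 0} :=
  isOpen_lt Complex.continuous_im continuous_const

lemma lowerHalfPlane_mem_nhds : {z : ℂ | z.im < 0} ∈ 𝓝 (-Complex.I) :=
  isOpen_lowerHalfPlane.mem_nhds (by simp)

namespace IsWeylFamily

variable {Φ : ℂ → Matrix (Fin m₁ ⊕ Fin m₂) (Fin m₂) ℂ}

/-- As z → −i both weights 1 + |z|² and −2 Im z tend to 2, so Φ*(C_0 + j)Φ ≤ 0 at −i; since C_0 + j
≥ 0, equality holds. A limit is taken because summability is not assumed at −i itself, where the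
values of later families are derivatives. -/
lemma mul_eq (h : IsWeylFamily C Φ) :
    C 0 * Φ (-Complex.I) = -(sig m₁ m₂ * Φ (-Complex.I)) := by
  have hcont : ContinuousAt Φ (-Complex.I) :=
    (h.differentiableOn.differentiableAt lowerHalfPlane_mem_nhds).continuousAt
  have hF : Continuous fun p : ℂ × Matrix (Fin m₁ ⊕ Fin m₂) (Fin m₂) ℂ =>
      -(p.2ᴴ * ((((1 + ‖p.1‖ ^ 2 : ℝ)) : ℂ) • sig m₁ m₂ + (((-2 * p.1.im : ℝ)) : ℂ) • C 0) *
        p.2) := by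
    have h1 : Continuous fun p : ℂ × Matrix (Fin m₁ ⊕ Fin m₂) (Fin m₂) ℂ =>
        (((1 + ‖p.1‖ ^ 2 : ℝ)) : ℂ) := Complex.continuous_ofReal.comp (by fun_prop)
    have h2 : Continuous fun p : ℂ × Matrix (Fin m₁ ⊕ Fin m₂) (Fin m₂) ℂ =>
        (((-2 * p.1.im : ℝ)) : ℂ) :=
      Complex.continuous_ofReal.comp (continuous_const.mul (Complex.continuous_im.comp continuous_fst))
    fun_prop
  have h0 : Tendsto (fun z : ℂ => (z, Φ z)) (𝓝[≠] (-Complex.I))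
      (𝓝 (-Complex.I, Φ (-Complex.I))) :=
    (tendsto_id.mono_left nhdsWithin_le_nhds).prodMk_nhds
      (hcont.tendsto.mono_left nhdsWithin_le_nhds)
  have hlim := (hF.tendsto (-Complex.I, Φ (-Complex.I))).comp h0
  have h1 : Matrix.PosSemidef _ := isClosed_posSemidef.mem_of_tendsto hlim (by
    filter_upwards [self_mem_nhdsWithin, mem_nhdsWithin_of_mem_nhds lowerHalfPlane_mem_nhds]
      with z hz1 hz2
    exact h.potential.posSemidef_of_weylSummable hz2 (h.summable z hz2 hz1))
  have h2 : (-((2 : ℂ) • ((Φ (-Complex.I))ᴴ * (C 0 + sig m₁ m₂) * Φ (-Complex.I)))).PosSemidef := by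
    convert h1 using 1
    simp only [norm_neg, Complex.norm_I, Complex.neg_im, Complex.I_im, Matrix.mul_add,
      Matrix.add_mul, Matrix.mul_smul, Matrix.smul_mul]
    push_cast
    module
  have h3 := posSemidef_add_of_mul_mul_eq sig_mul_sig conjTranspose_sig (h.potential 0).1
    (h.potential 0).2
  have h4 := ((h3.conjTranspose_mul_mul_same (Φ (-Complex.I))).smul
    (by norm_num : (0 : ℂ) ≤ 2)).eq_zero_of_neg h2
  rw [smul_eq_zero, or_iff_right two_ne_zero] at h4
  have h5 := h3.mul_eq_zero_of_conj_eq_zero h4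
  rw [Matrix.add_mul] at h5
  exact eq_neg_of_add_eq_zero_left h5

lemma hasDerivAt_mul {κ ν : Type*} [Fintype κ] [DecidableEq κ] [Fintype ν] [DecidableEq ν]
    (M : Matrix κ κ ℂ) {Ψ : ℂ → Matrix κ ν ℂ} {Ψ' : Matrix κ ν ℂ} {z : ℂ}
    (h : HasDerivAt Ψ Ψ' z) :
    HasDerivAt (fun w => (1 + (Complex.I * w) • M) * Ψ w)
      (Ψ' + ((Complex.I * z) • (M * Ψ') + Complex.I • (M * Ψ z))) z := by
  let L : Matrix κ ν ℂ →L[ℂ] Matrix κ ν ℂ := LinearMap.toContinuousLinearMap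
    { toFun := fun X => M * X
      map_add' := fun X Y => Matrix.mul_add _ _ _
      map_smul' := fun c X => Matrix.mul_smul _ _ _ }
  have h1 : HasDerivAt (fun w => M * Ψ w) (M * Ψ') z := L.hasFDerivAt.comp_hasDerivAt z h
  have h2 : HasDerivAt (fun w : ℂ => Complex.I * w) Complex.I z := by
    simpa using (hasDerivAt_id z).const_mul Complex.I
  have h3 := h.add (h2.smul h1)
  refine h3.congr_of_eventuallyEq (Eventually.of_forall fun w => ?_)
  simp [Matrix.add_mul]

/-- F(z) = (I + izjC_0)Φ(z) vanishes at −i, so F(z)/(z + i) is holomorphic and gives Weyl solutions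
of the shifted system. It stays injective at −i because (I − jC_0)F'(−i) = −2iΦ(−i), by (jC_0)² = I.
-/
lemma next (h : IsWeylFamily C Φ) :
    IsWeylFamily (fun k => C (k + 1))
      (dslope (fun w => (1 + (Complex.I * w) • (sig m₁ m₂ * C 0)) * Φ w) (-Complex.I)) := by
  obtain ⟨F, hF⟩ : ∃ F, F = fun w => (1 + (Complex.I * w) • (sig m₁ m₂ * C 0)) * Φ w := ⟨_, rfl⟩
  rw [← hF]
  have hd : ∀ z : ℂ, z.im < 0 → HasDerivAt Φ (deriv Φ z) z := fun z hz =>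
    (h.differentiableOn.differentiableAt (isOpen_lowerHalfPlane.mem_nhds hz)).hasDerivAt
  have hF0 : F (-Complex.I) = 0 := by
    have h1 : Complex.I * -Complex.I = 1 := by rw [mul_neg, Complex.I_mul_I, neg_neg]
    rw [hF]
    simp only [h1, one_smul, Matrix.add_mul, Matrix.one_mul]
    rw [Matrix.mul_assoc, h.mul_eq, Matrix.mul_neg, ← Matrix.mul_assoc, sig_mul_sig, Matrix.one_mul,
      add_neg_cancel]
  refine ⟨fun k => h.potential (k + 1), ?_, ?_, ?_⟩
  · rw [Complex.differentiableOn_dslope lowerHalfPlane_mem_nhds]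
    intro z hz
    rw [hF]
    exact (hasDerivAt_mul _ (hd z hz)).differentiableAt.differentiableWithinAt
  · rw [dslope_same]
    have h1 := (hasDerivAt_mul (sig m₁ m₂ * C 0) (hd (-Complex.I) (by simp))).deriv
    rw [← hF] at h1
    have hE := mul_eq_one_of_mul_mul_eq sig_mul_sig (h.potential 0).2
    have hEΦ : sig m₁ m₂ * C 0 * Φ (-Complex.I) = -Φ (-Complex.I) := by
      rw [Matrix.mul_assoc, h.mul_eq, Matrix.mul_neg, ← Matrix.mul_assoc, sig_mul_sig,
        Matrix.one_mul]
    obtain ⟨E, hEdef⟩ : ∃ E, E = sig m₁ m₂ * C 0 := ⟨_, rfl⟩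
    rw [← hEdef] at h1 hE hEΦ
    have hEE : ∀ M : Matrix (Fin m₁ ⊕ Fin m₂) (Fin m₂) ℂ, E * (E * M) = M := fun M => by
      rw [← Matrix.mul_assoc, hE, Matrix.one_mul]
    have h2 : (1 - E) * deriv F (-Complex.I) = (-2 * Complex.I) • Φ (-Complex.I) := by
      rw [h1, hEΦ]
      have h3 : Complex.I * -Complex.I = 1 := by rw [mul_neg, Complex.I_mul_I, neg_neg]
      simp only [h3, one_smul, Matrix.sub_mul, Matrix.one_mul, Matrix.mul_add, hEE,
        Matrix.mul_smul, Matrix.mul_neg, hEΦ]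
      module
    intro x y hxy
    have h3 : (1 - E) *ᵥ (deriv F (-Complex.I) *ᵥ x) = (1 - E) *ᵥ (deriv F (-Complex.I) *ᵥ y) :=
      congrArg _ hxy
    rw [mulVec_mulVec, mulVec_mulVec, h2, smul_mulVec, smul_mulVec] at h3
    exact h.injective (smul_right_injective _ (by simp) h3)
  · intro z hz hz'
    rw [dslope_of_ne _ hz', slope, hF0, vsub_eq_sub, sub_zero, hF]
    exact (h.summable z hz hz').shift _

lemma potential_unique {C C' : ℕ → Matrix (Fin m₁ ⊕ Fin m₂) (Fin m₁ ⊕ Fin m₂) ℂ}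
    (h : IsWeylFamily C Φ) (h' : IsWeylFamily C' Φ) (k : ℕ) : C k = C' k := by
  have h0 : C 0 = C' 0 := by
    rw [eq_of_mul_eq_neg_sig_mul h.injective (h.potential 0).1 (h.potential 0).2 h.mul_eq,
      eq_of_mul_eq_neg_sig_mul h'.injective (h'.potential 0).1 (h'.potential 0).2 h'.mul_eq]
  induction k generalizing C C' Φ with
  | zero => exact h0
  | succ k ih =>
    have h1 := h.next
    have h2 := h'.next
    rw [← h0] at h2
    refine ih h1 h2 ?_
    rw [eq_of_mul_eq_neg_sig_mul h1.injective (h1.potential 0).1 (h1.potential 0).2 h1.mul_eq,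
      eq_of_mul_eq_neg_sig_mul h2.injective (h2.potential 0).1 (h2.potential 0).2 h2.mul_eq]

end IsWeylFamily

namespace Realization

variable {n : ℕ}

lemma differentiableAt_transfer (T : Realization m₁ m₂ n) {w : ℂ} (hw : w ∉ spectrum ℂ T.a) :
    DifferentiableAt ℂ T.transfer w := by
  have h1 : DifferentiableAt ℂ (fun z : ℂ => (z • (1 : Matrix (Fin n) (Fin n) ℂ) - T.a)⁻¹) w :=
    DifferentiableAt.comp (f := fun z : ℂ => z • (1 : Matrix (Fin n) (Fin n) ℂ) - T.a) w
      (differentiableAt_matrix_inv (isUnit_det_of_notMem_spectrum hw)) (by fun_prop)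
  let L : Matrix (Fin n) (Fin n) ℂ →L[ℂ] Matrix (Fin m₁) (Fin m₂) ℂ :=
    LinearMap.toContinuousLinearMap
      { toFun := fun X => T.c * X * T.b
        map_add' := fun X Y => by rw [Matrix.mul_add, Matrix.add_mul]
        map_smul' := fun c X => by simp }
  exact L.differentiableAt.comp w h1

lemma isWeylFamily_of_isWeylFunction {T : Realization m₁ m₂ n} (hT : T ∈ classG m₁ m₂ n)
    (hC : IsDiracPotential C) (hW : IsWeylFunction C (fun z => T.transfer (-1 / z))) :
    IsWeylFamily C (fun z => fromRows (T.transfer (-1 / z)) 1) := by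
  refine ⟨hC, fun z hz => ?_, ?_, fun z hz _ => ?_⟩
  · have hz : z.im < 0 := hz
    have hz0 : z ≠ 0 := by rintro rfl; simp at hz
    have hlim : (-1 / z).im ≤ 0 := by
      rw [neg_div, one_div, Complex.neg_im, Complex.inv_im, neg_div, neg_neg]
      exact (div_neg_of_neg_of_pos hz (Complex.normSq_pos.2 hz0)).le
    have h1 : DifferentiableAt ℂ (fun z : ℂ => T.transfer (-1 / z)) z :=
      DifferentiableAt.comp (f := fun z : ℂ => -1 / z) z
        (T.differentiableAt_transfer (notMem_spectrum_of_im_nonpos hT hlim))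
        ((differentiableAt_const _).div differentiableAt_id hz0)
    let L : Matrix (Fin m₁) (Fin m₂) ℂ →L[ℂ] Matrix (Fin m₁ ⊕ Fin m₂) (Fin m₂) ℂ :=
      LinearMap.toContinuousLinearMap
        { toFun := fun X => fromRows X 0
          map_add' := fun X Y => by ext (i | i) j <;> simp
          map_smul' := fun c X => by ext (i | i) j <;> simp }
    have h2 : DifferentiableAt ℂ (fun z : ℂ => L (T.transfer (-1 / z)) +
        fromRows (0 : Matrix (Fin m₁) (Fin m₂) ℂ) 1) z :=
      (L.differentiableAt.comp z h1).add_const _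
    refine (h2.congr_of_eventuallyEq (Eventually.of_forall fun w => ?_)).differentiableWithinAt
    ext (i | i) j <;> simp [L]
  · intro x y hxy
    have h1 : ∀ v : Fin m₂ → ℂ, ∀ i, (fromRows (T.transfer (-1 / -Complex.I))
        (1 : Matrix (Fin m₂) (Fin m₂) ℂ) *ᵥ v) (Sum.inr i) = v i := fun v i => by
      simp
    ext i
    rw [← h1 x i, ← h1 y i]
    exact congrFun hxy _
  · refine (hW z hz).congr fun k => ?_
    simp only [Matrix.mul_assoc]

theorem potential_unique_of_isWeylFunction {T : Realization m₁ m₂ n} (hT : T ∈ classG m₁ m₂ n)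
    {C C' : ℕ → Matrix (Fin m₁ ⊕ Fin m₂) (Fin m₁ ⊕ Fin m₂) ℂ}
    (hC : IsDiracPotential C) (hC' : IsDiracPotential C')
    (hW : IsWeylFunction C (fun z => T.transfer (-1 / z)))
    (hW' : IsWeylFunction C' (fun z => T.transfer (-1 / z))) : C = C' :=
  funext fun k => (isWeylFamily_of_isWeylFunction hT hC hW).potential_unique
    (isWeylFamily_of_isWeylFunction hT hC' hW') k

end Realization

end Uniqueness

/-! ### Stability -/

section Estimates

variable {ι κ ν : Type*} [Fintype ι] [DecidableEq ι] [Fintype κ] [DecidableEq κ]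
  [Fintype ν] [DecidableEq ν]

open scoped MatrixOrder in
lemma norm_le_norm_of_posSemidef {M N : Matrix ι ι ℂ} (hM : M.PosSemidef)
    (h : (N - M).PosSemidef) : ‖M‖ ≤ ‖N‖ :=
  CStarAlgebra.norm_le_norm_of_nonneg_of_le (Matrix.nonneg_iff_posSemidef.2 hM)
    (Matrix.le_iff.2 h)

/-- Hypothesis and conclusion say that the two Schur complements of one block matrix, with diagonal
S', S⁻¹ and corner U, are nonnegative. -/
lemma posSemidef_inv_sub_conj {S : Matrix ι ι ℂ} {S' : Matrix κ κ ℂ} (U : Matrix κ ι ℂ)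
    (hS : S.PosDef) (hS' : S'.PosDef) (h : (S' - U * S * Uᴴ).PosSemidef) :
    (S⁻¹ - Uᴴ * S'⁻¹ * U).PosSemidef := by
  have := hS'.isUnit.invertible
  have := hS.inv.isUnit.invertible
  refine (PosDef.fromBlocks₁₁ U S⁻¹ hS').1 ((PosDef.fromBlocks₂₂ S' U hS.inv).2 ?_)
  rwa [nonsing_inv_nonsing_inv _ ((isUnit_iff_isUnit_det _).1 hS.isUnit)]

/-- (M² − 1)² − (M − 1)² = (M − 1)(2M + M²)(M − 1) ≥ 0. -/
lemma norm_sub_one_le_norm_mul_self_sub_one {M : Matrix ι ι ℂ} (hM : M.PosSemidef) :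
    ‖M - 1‖ ≤ ‖M * M - 1‖ := by
  have h1 : (M - 1)ᴴ = M - 1 := by rw [conjTranspose_sub, hM.1.eq, conjTranspose_one]
  have h2 : ((M * M - 1)ᴴ * (M * M - 1) - (M - 1)ᴴ * (M - 1)).PosSemidef := by
    have h3 := ((hM.add hM).add (posSemidef_conjTranspose_mul_self M)).conjTranspose_mul_mul_same
      (M - 1)
    convert h3 using 1
    rw [h1, conjTranspose_sub, conjTranspose_mul, conjTranspose_one, hM.1.eq]
    noncomm_ring
  have h4 := norm_le_norm_of_posSemidef (posSemidef_conjTranspose_mul_self (M - 1)) h2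
  rw [l2_opNorm_conjTranspose_mul_self, l2_opNorm_conjTranspose_mul_self] at h4
  exact abs_le_of_sq_le_sq' (by nlinarith) (norm_nonneg _) |>.2

lemma norm_mul_self_sub_one_le (M : Matrix ι ι ℂ) :
    ‖M * M - 1‖ ≤ ‖M - 1‖ * ‖M - 1‖ + 2 * ‖M - 1‖ := by
  have h1 : M * M - 1 = (M - 1) * (M - 1) + ((M - 1) + (M - 1)) := by noncomm_ring
  rw [h1, two_mul]
  exact (norm_add_le _ _).trans (add_le_add (norm_mul_le _ _) (norm_add_le _ _))

lemma exists_forall_norm_blocks_lt {ρ : ℝ} (hρ : 0 < ρ) :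
    ∃ η > 0, ∀ (a : Matrix ι ι ℂ) (b : Matrix ι κ ℂ) (d : Matrix κ κ ℂ), d.PosSemidef →
      a * a = 1 + b * bᴴ → d * d = 1 + bᴴ * b → ‖a - 1‖ < η →
      ‖a - 1‖ < ρ ∧ ‖b‖ < ρ ∧ ‖d - 1‖ < ρ := by
  obtain ⟨r, hr, hr1, hrρ⟩ : ∃ r : ℝ, 0 < r ∧ r ≤ 1 ∧ r ≤ ρ :=
    ⟨min 1 ρ, lt_min one_pos hρ, min_le_left _ _, min_le_right _ _⟩
  -- With this η ≤ 1, ‖b‖² = ‖a² − 1‖ ≤ 3η < r², and then ‖d − 1‖ ≤ ‖d² − 1‖ = ‖b‖² < r² ≤ r.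
  refine ⟨r ^ 2 / 4, by positivity, fun a b d hd ha hdd hη => ?_⟩
  have h0 := norm_nonneg (a - 1)
  have h1 : ‖b‖ * ‖b‖ ≤ 3 * (r ^ 2 / 4) := by
    have h2 : b * bᴴ = a * a - 1 := by rw [ha, add_sub_cancel_left]
    have h3 := l2_opNorm_conjTranspose_mul_self bᴴ
    rw [conjTranspose_conjTranspose, l2_opNorm_conjTranspose, h2] at h3
    rw [← h3]
    have h4 : ‖a - 1‖ ≤ 1 := by nlinarith
    nlinarith [norm_mul_self_sub_one_le a]
  have h4 : ‖d - 1‖ ≤ ‖b‖ * ‖b‖ := by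
    rw [← l2_opNorm_conjTranspose_mul_self b, ← add_sub_cancel_left 1 (bᴴ * b), ← hdd]
    exact norm_sub_one_le_norm_mul_self_sub_one hd
  refine ⟨by nlinarith, ?_, by nlinarith⟩
  refine lt_of_lt_of_le (lt_of_pow_lt_pow_left₀ 2 hr.le ?_) hrρ
  nlinarith

end Estimates

/-! ### One diagonal block controls a positive j-unitary matrix -/

section JUnitary

variable {m₁ m₂ : ℕ}

lemma exists_forall_norm_fromBlocks_sub_one_lt {ε : ℝ} (hε : 0 < ε) :
    ∃ ρ > 0, ∀ (a : Matrix (Fin m₁) (Fin m₁) ℂ) (b : Matrix (Fin m₁) (Fin m₂) ℂ)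
      (d : Matrix (Fin m₂) (Fin m₂) ℂ), ‖a - 1‖ < ρ → ‖b‖ < ρ → ‖d - 1‖ < ρ →
      ‖fromBlocks a b bᴴ d - 1‖ < ε := by
  have h1 : Continuous fun p : Matrix (Fin m₁) (Fin m₁) ℂ × Matrix (Fin m₁) (Fin m₂) ℂ ×
      Matrix (Fin m₂) (Fin m₂) ℂ => fromBlocks p.1 p.2.1 p.2.1ᴴ p.2.2 :=
    Continuous.matrix_fromBlocks continuous_fst (by fun_prop)
      (Continuous.matrix_conjTranspose (by fun_prop)) (by fun_prop)
  obtain ⟨ρ, hρ, h⟩ := Metric.continuous_iff.1 h1 (1, 0, 1) ε hε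
  refine ⟨ρ, hρ, fun a b d ha hb hd => ?_⟩
  have h2 := h (a, b, d) (by
    rw [Prod.dist_eq, Prod.dist_eq, dist_eq_norm, dist_eq_norm, dist_eq_norm, sub_zero]
    exact max_lt ha (max_lt hb hd))
  rwa [dist_eq_norm, conjTranspose_zero, fromBlocks_one] at h2

/-- A `j`-unitary positive definite matrix with one of its diagonal blocks close to the identity is
itself close to the identity. -/
lemma exists_forall_norm_sub_one_lt {ε : ℝ} (hε : 0 < ε) :
    ∃ η > 0, ∀ C : Matrix (Fin m₁ ⊕ Fin m₂) (Fin m₁ ⊕ Fin m₂) ℂ, C.PosDef →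
      C * sig m₁ m₂ * C = sig m₁ m₂ →
      ‖C.toBlocks₁₁ - 1‖ < η ∨ ‖C.toBlocks₂₂ - 1‖ < η → ‖C - 1‖ < ε := by
  obtain ⟨ρ, hρ, hC⟩ := exists_forall_norm_fromBlocks_sub_one_lt (m₁ := m₁) (m₂ := m₂) hε
  obtain ⟨η₁, hη₁, h₁⟩ := exists_forall_norm_blocks_lt (ι := Fin m₁) (κ := Fin m₂) hρ
  obtain ⟨η₂, hη₂, h₂⟩ := exists_forall_norm_blocks_lt (ι := Fin m₂) (κ := Fin m₁) hρ
  refine ⟨min η₁ η₂, lt_min hη₁ hη₂, fun C hpos hJ h => ?_⟩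
  obtain ⟨a, b, c, d, rfl⟩ : ∃ a b c d, C = fromBlocks a b c d :=
    ⟨_, _, _, _, (fromBlocks_toBlocks C).symm⟩
  have hH := hpos.1
  rw [isHermitian_fromBlocks_iff] at hH
  obtain ⟨haH, hcb, -, hdH⟩ := hH
  obtain rfl : c = bᴴ := hcb.symm
  have ha : a.PosSemidef := hpos.posSemidef.submatrix Sum.inl
  have hd : d.PosSemidef := hpos.posSemidef.submatrix Sum.inr
  rw [sig, fromBlocks_multiply, fromBlocks_multiply, fromBlocks_inj] at hJ
  simp only [Matrix.mul_one, Matrix.mul_zero, add_zero, zero_add, Matrix.mul_neg, Matrix.neg_mul]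
    at hJ
  have haa : a * a = 1 + b * bᴴ := by rw [← hJ.1]; abel
  have hdd : d * d = 1 + bᴴ * b := by rw [← neg_neg (1 : Matrix (Fin m₂) (Fin m₂) ℂ), ← hJ.2.2.2]; abel
  rw [toBlocks_fromBlocks₁₁, toBlocks_fromBlocks₂₂] at h
  rcases h with h | h
  · obtain ⟨h3, h4, h5⟩ := h₁ a b d hd haa hdd (lt_of_lt_of_le h (min_le_left _ _))
    exact hC a b d h3 h4 h5
  · obtain ⟨h3, h4, h5⟩ := h₂ d bᴴ a ha (by rw [conjTranspose_conjTranspose, hdd])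
      (by rw [conjTranspose_conjTranspose, haa]) (lt_of_lt_of_le h (min_le_right _ _))
    rw [l2_opNorm_conjTranspose] at h4
    exact hC a b d h5 h4 h3

end JUnitary

/-! ### Monotonicity of compressions of Π_k* S_k⁻¹ Π_k -/

section Gram

variable {m₁ m₂ n : ℕ} {A S₀ : Matrix (Fin n) (Fin n) ℂ} {P₀ : Matrix (Fin n) (Fin m₁ ⊕ Fin m₂) ℂ}

/-- `Π_k* S_k⁻¹ Π_k`. -/
noncomputable def seqGram (A S₀ : Matrix (Fin n) (Fin n) ℂ)
    (P₀ : Matrix (Fin n) (Fin m₁ ⊕ Fin m₂) ℂ) (k : ℕ) :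
    Matrix (Fin m₁ ⊕ Fin m₂) (Fin m₁ ⊕ Fin m₂) ℂ :=
  (seqP A P₀ k)ᴴ * (seqS A S₀ P₀ k)⁻¹ * seqP A P₀ k

lemma seqC_eq_seqGram (k : ℕ) :
    seqC A S₀ P₀ k = 1 + (seqGram A S₀ P₀ k - seqGram A S₀ P₀ (k + 1)) := by
  rw [← add_sub_assoc]; rfl

variable {ν : Type*} [Fintype ν] [DecidableEq ν] {σ : ℝ} {E : Matrix (Fin m₁ ⊕ Fin m₂) ν ℂ}

lemma seqP_mul (hE : sig m₁ m₂ * E = (σ : ℂ) • E) (k : ℕ) :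
    seqP A P₀ k * E = (1 + (Complex.I * σ) • A⁻¹) ^ k * (P₀ * E) := by
  induction k with
  | zero => simp [seqP]
  | succ k ih =>
    rw [seqP, Matrix.add_mul, Matrix.smul_mul, Matrix.mul_assoc, hE, Matrix.mul_smul,
      Matrix.mul_assoc, ih, pow_succ']
    simp only [Matrix.add_mul, Matrix.one_mul, Matrix.smul_mul, Matrix.mul_assoc, smul_smul]

namespace IsAdmissible

/-- By the identity for A, S_k, Π_k the difference equals A⁻¹Π_k(I − σj)Π_k*(A*)⁻¹, and I − σj = ½(I
− σj)² ≥ 0. The sign σ = 1 corresponds to R_k, σ = −1 to Q_k. -/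
lemma posSemidef_seqS_succ_sub (h : IsAdmissible A S₀ P₀) (hσ : σ ^ 2 = 1) (k : ℕ) :
    (seqS A S₀ P₀ (k + 1) - (1 + (Complex.I * σ) • A⁻¹) * seqS A S₀ P₀ k *
      (1 + (Complex.I * σ) • A⁻¹)ᴴ).PosSemidef := by
  obtain ⟨S, hS⟩ : ∃ S, S = seqS A S₀ P₀ k := ⟨_, rfl⟩
  obtain ⟨P, hP⟩ : ∃ P, P = seqP A P₀ k := ⟨_, rfl⟩
  have hid := h.seq_identity k
  rw [seqS_succ, stepS_eq, ← hS, ← hP]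
  rw [← hS, ← hP] at hid
  have hBA : A⁻¹ * A = 1 := nonsing_inv_mul _ h.isUnit_det
  obtain ⟨B, hB⟩ : ∃ B, B = A⁻¹ := ⟨_, rfl⟩
  rw [← hB] at hBA ⊢
  have hBA' : Aᴴ * Bᴴ = 1 := by rw [← conjTranspose_mul, hBA, conjTranspose_one]
  have h' : S * Bᴴ - B * S = Complex.I • (B * P * sig m₁ m₂ * (Pᴴ * Bᴴ)) := by
    have h1 := congrArg (fun M => B * M * Bᴴ) hid
    simp only [Matrix.mul_sub, Matrix.sub_mul, Matrix.mul_smul, Matrix.smul_mul] at h1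
    rw [← Matrix.mul_assoc B A S, hBA, Matrix.one_mul, Matrix.mul_assoc B (S * Aᴴ),
      Matrix.mul_assoc S, hBA', Matrix.mul_one] at h1
    rw [h1]
    simp only [Matrix.mul_assoc]
  have h2 := ((posSemidef_self_mul_conjTranspose (1 - (σ : ℂ) • sig m₁ m₂)).mul_mul_conjTranspose_same
    (B * P)).smul (Complex.zero_le_real.2 (by norm_num : (0 : ℝ) ≤ 1 / 2))
  have hσ' : (σ : ℂ) ^ 2 = 1 := by exact_mod_cast hσ
  convert h2 using 1
  rw [conjTranspose_sub, conjTranspose_smul, conjTranspose_sig, conjTranspose_one]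
  simp only [conjTranspose_add, conjTranspose_one, conjTranspose_smul, star_mul', RCLike.star_def,
    Complex.conj_I, Complex.conj_ofReal, Matrix.add_mul, Matrix.mul_add, Matrix.one_mul,
    Matrix.mul_one, Matrix.smul_mul, Matrix.mul_smul, Matrix.sub_mul, Matrix.mul_sub, sig_mul_sig,
    conjTranspose_mul, Matrix.mul_assoc] at h' ⊢
  linear_combination (norm := skip) (Complex.I * (σ : ℂ)) • h'
  match_scalars <;> ring_nf <;> simp only [Complex.I_sq, hσ'] <;> ring

lemma posSemidef_seqGram (h : IsAdmissible A S₀ P₀) (k : ℕ) : (seqGram A S₀ P₀ k).PosSemidef :=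
  (h.posDef_seqS k).inv.posSemidef.conjTranspose_mul_mul_same _

/-- On the σ-eigenspace of j the step of Π is multiplication by I + iσA⁻¹, the same factor by which
S grows at least; inversion reverses the inequality. -/
lemma posSemidef_seqGram_sub (h : IsAdmissible A S₀ P₀) (hσ : σ ^ 2 = 1)
    (hE : sig m₁ m₂ * E = (σ : ℂ) • E) (k : ℕ) :
    (Eᴴ * (seqGram A S₀ P₀ k - seqGram A S₀ P₀ (k + 1)) * E).PosSemidef := by
  have h1 := (posSemidef_inv_sub_conj _ (h.posDef_seqS k) (h.posDef_seqS (k + 1))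
    (h.posSemidef_seqS_succ_sub hσ k)).conjTranspose_mul_mul_same (seqP A P₀ k * E)
  have h2 : seqP A P₀ (k + 1) * E = (1 + (Complex.I * σ) • A⁻¹) * (seqP A P₀ k * E) := by
    rw [seqP_mul hE, seqP_mul hE, pow_succ', Matrix.mul_assoc]
  have h3 : ∀ j, Eᴴ * seqGram A S₀ P₀ j * E =
      (seqP A P₀ j * E)ᴴ * (seqS A S₀ P₀ j)⁻¹ * (seqP A P₀ j * E) := fun j => by
    rw [seqGram, conjTranspose_mul]; simp only [Matrix.mul_assoc]
  convert h1 using 1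
  rw [Matrix.mul_sub, Matrix.sub_mul, h3, h3, h2, Matrix.mul_sub, Matrix.sub_mul,
    conjTranspose_mul _ (seqP A P₀ k * E)]
  simp only [Matrix.mul_assoc]

/-- The distance of the compression of `C_k` from the identity is controlled, for all `k ≥ N`, by
the compression of `Π_N* S_N⁻¹ Π_N`. -/
lemma norm_conj_seqC_sub_one_le (h : IsAdmissible A S₀ P₀) (hσ : σ ^ 2 = 1)
    (hE : sig m₁ m₂ * E = (σ : ℂ) • E) {N k : ℕ} (hk : N ≤ k) :
    ‖Eᴴ * (seqC A S₀ P₀ k - 1) * E‖ ≤ ‖Eᴴ * seqGram A S₀ P₀ N * E‖ := by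
  have hmono : ∀ j, ‖Eᴴ * seqGram A S₀ P₀ (j + 1) * E‖ ≤ ‖Eᴴ * seqGram A S₀ P₀ j * E‖ := fun j =>
    norm_le_norm_of_posSemidef ((h.posSemidef_seqGram (j + 1)).conjTranspose_mul_mul_same E)
      (by simpa only [Matrix.mul_sub, Matrix.sub_mul] using h.posSemidef_seqGram_sub hσ hE j)
  refine le_trans ?_ (antitone_nat_of_succ_le (f := fun j => ‖Eᴴ * seqGram A S₀ P₀ j * E‖) hmono hk)
  -- The compression of C_k − I = G_k − G_{k+1} lies between 0 and that of G_k, which is at most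
  -- that of G_N in norm.
  rw [seqC_eq_seqGram, add_sub_cancel_left]
  refine norm_le_norm_of_posSemidef (h.posSemidef_seqGram_sub hσ hE k) ?_
  rw [← Matrix.sub_mul, ← Matrix.mul_sub, sub_sub_cancel]
  exact (h.posSemidef_seqGram (k + 1)).conjTranspose_mul_mul_same E

/-- The powers of I + iσA⁻¹ in Π_N E cancel against those in R_N or Q_N, so the compression of G_N
is at most c⁻¹(Π_0E)*Π_0E as soon as that matrix is at least c. -/
lemma exists_norm_conj_seqGram_lt (h : IsAdmissible A S₀ P₀)
    (hE : sig m₁ m₂ * E = (σ : ℂ) • E) (hU : IsUnit (1 + (Complex.I * σ) • A⁻¹).det)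
    (hlim : TendsToPosInfinity fun r => ((1 + (Complex.I * σ) • A⁻¹) ^ r)⁻¹ * seqS A S₀ P₀ r *
      (((1 + (Complex.I * σ) • A⁻¹) ^ r)ᴴ)⁻¹) {η : ℝ} (hη : 0 < η) :
    ∃ N, ‖Eᴴ * seqGram A S₀ P₀ N * E‖ < η := by
  obtain ⟨c, hc, hcη⟩ : ∃ c : ℝ, 0 < c ∧ c⁻¹ * ‖(P₀ * E)ᴴ * (P₀ * E)‖ < η := by
    have h1 := norm_nonneg ((P₀ * E)ᴴ * (P₀ * E))
    refine ⟨(‖(P₀ * E)ᴴ * (P₀ * E)‖ + 1) / η, by positivity, ?_⟩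
    rw [inv_div, div_mul_eq_mul_div, div_lt_iff₀ (by positivity)]
    nlinarith
  obtain ⟨N, hN⟩ := (hlim c).exists
  refine ⟨N, lt_of_le_of_lt ?_ hcη⟩
  obtain ⟨U, hUdef⟩ : ∃ U, U = (1 + (Complex.I * σ) • A⁻¹) ^ N := ⟨_, rfl⟩
  have hP := seqP_mul (A := A) (P₀ := P₀) hE N
  have hUu : IsUnit U.det := by rw [hUdef, det_pow]; exact hU.pow N
  have hUHu : IsUnit (Uᴴ).det := by rw [det_conjTranspose]; exact hUu.star
  beta_reduce at hN
  rw [← hUdef] at hN hP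
  have h1 : (seqS A S₀ P₀ N - U * ((c : ℂ) • (1 : Matrix (Fin n) (Fin n) ℂ)) * Uᴴ).PosSemidef := by
    have h2 := hN.mul_mul_conjTranspose_same U
    convert h2 using 1
    rw [Matrix.mul_sub, Matrix.sub_mul, Matrix.mul_assoc U⁻¹, ← Matrix.mul_assoc U U⁻¹,
      mul_nonsing_inv _ hUu, Matrix.one_mul, Matrix.mul_assoc _ (Uᴴ)⁻¹ Uᴴ, nonsing_inv_mul _ hUHu,
      Matrix.mul_one]
  have hc1 : ((c : ℂ) • (1 : Matrix (Fin n) (Fin n) ℂ)).PosDef :=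
    PosDef.one.smul (Complex.zero_lt_real.2 hc)
  have hcinv : ((c : ℂ) • (1 : Matrix (Fin n) (Fin n) ℂ))⁻¹ = ((c⁻¹ : ℝ) : ℂ) • 1 := by
    refine inv_eq_right_inv ?_
    have : (c : ℂ) ≠ 0 := by exact_mod_cast hc.ne'
    rw [Matrix.smul_mul, Matrix.one_mul, smul_smul, Complex.ofReal_inv, mul_inv_cancel₀ this,
      one_smul]
  have h2 := (posSemidef_inv_sub_conj U hc1 (h.posDef_seqS N) h1).conjTranspose_mul_mul_same
    (P₀ * E)
  have h3 : Eᴴ * seqGram A S₀ P₀ N * E =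
      (P₀ * E)ᴴ * (Uᴴ * (seqS A S₀ P₀ N)⁻¹ * U) * (P₀ * E) := by
    have h4 : Eᴴ * seqGram A S₀ P₀ N * E =
        (seqP A P₀ N * E)ᴴ * (seqS A S₀ P₀ N)⁻¹ * (seqP A P₀ N * E) := by
      rw [seqGram, conjTranspose_mul]; simp only [Matrix.mul_assoc]
    rw [h4, hP, conjTranspose_mul U]
    simp only [Matrix.mul_assoc]
  have h5 : ‖((c⁻¹ : ℝ) : ℂ) • ((P₀ * E)ᴴ * (P₀ * E))‖ = c⁻¹ * ‖(P₀ * E)ᴴ * (P₀ * E)‖ := by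
    rw [norm_smul, Complex.norm_real, Real.norm_of_nonneg (by positivity)]
  rw [← h5]
  refine norm_le_norm_of_posSemidef ((h.posSemidef_seqGram N).conjTranspose_mul_mul_same E) ?_
  rw [h3]
  rwa [hcinv, Matrix.mul_sub, Matrix.sub_mul, Matrix.mul_smul, Matrix.mul_one,
    Matrix.smul_mul] at h2

end IsAdmissible

end Gram

/-! ### Continuous dependence at fixed k and uniform tails -/

section Continuity

variable {α : Type*} {l : Filter α}

lemma tendsto_matrix_mul {ι κ ν : Type*} [Fintype ι] [DecidableEq ι] [Fintype κ] [DecidableEq κ]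
    [Fintype ν] [DecidableEq ν] {f : α → Matrix ι κ ℂ} {g : α → Matrix κ ν ℂ} {M : Matrix ι κ ℂ}
    {N : Matrix κ ν ℂ} (hf : Tendsto f l (𝓝 M)) (hg : Tendsto g l (𝓝 N)) :
    Tendsto (fun x => f x * g x) l (𝓝 (M * N)) := by
  rw [tendsto_iff_norm_sub_tendsto_zero] at hf ⊢
  have h1 : Tendsto (fun x => ‖f x - M‖ * ‖g x‖ + ‖M‖ * ‖g x - N‖) l (𝓝 0) := by
    simpa using (hf.mul hg.norm).add
      ((tendsto_iff_norm_sub_tendsto_zero.1 hg).const_mul ‖M‖)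
  refine squeeze_zero (fun _ => norm_nonneg _) (fun x => ?_) h1
  have h2 : f x * g x - M * N = (f x - M) * g x + M * (g x - N) := by
    rw [Matrix.sub_mul, Matrix.mul_sub, sub_add_sub_cancel]
  rw [h2]
  exact (norm_add_le _ _).trans (add_le_add (l2_opNorm_mul _ _) (l2_opNorm_mul _ _))

lemma tendsto_conjTranspose {ι κ : Type*} [Fintype ι] [DecidableEq ι] [Fintype κ] [DecidableEq κ]
    {f : α → Matrix ι κ ℂ} {M : Matrix ι κ ℂ} (hf : Tendsto f l (𝓝 M)) :
    Tendsto (fun x => (f x)ᴴ) l (𝓝 Mᴴ) :=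
  ((Continuous.matrix_conjTranspose continuous_id).tendsto M).comp hf

lemma tendsto_matrix_inv {ι : Type*} [Fintype ι] [DecidableEq ι]
    {f : α → Matrix ι ι ℂ} {M : Matrix ι ι ℂ} (hM : IsUnit M.det) (hf : Tendsto f l (𝓝 M)) :
    Tendsto (fun x => (f x)⁻¹) l (𝓝 M⁻¹) :=
  (continuousAt_matrix_inv hM).tendsto.comp hf

variable {m₁ m₂ n : ℕ} {A S₀ : Matrix (Fin n) (Fin n) ℂ} {P₀ : Matrix (Fin n) (Fin m₁ ⊕ Fin m₂) ℂ}
  {A' S' : α → Matrix (Fin n) (Fin n) ℂ} {P' : α → Matrix (Fin n) (Fin m₁ ⊕ Fin m₂) ℂ}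

lemma tendsto_seqP (hdet : IsUnit A.det) (hA : Tendsto A' l (𝓝 A)) (hP : Tendsto P' l (𝓝 P₀))
    (k : ℕ) : Tendsto (fun x => seqP (A' x) (P' x) k) l (𝓝 (seqP A P₀ k)) := by
  induction k with
  | zero => exact hP
  | succ k ih =>
    exact ih.add ((tendsto_matrix_mul (tendsto_matrix_mul (tendsto_matrix_inv hdet hA) ih)
      tendsto_const_nhds).const_smul Complex.I)

lemma tendsto_seqS (hdet : IsUnit A.det) (hA : Tendsto A' l (𝓝 A)) (hS : Tendsto S' l (𝓝 S₀))
    (hP : Tendsto P' l (𝓝 P₀)) (k : ℕ) :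
    Tendsto (fun x => seqS (A' x) (S' x) (P' x) k) l (𝓝 (seqS A S₀ P₀ k)) := by
  induction k with
  | zero => exact hS
  | succ k ih =>
    have h1 := tendsto_matrix_inv hdet hA
    have h2 := tendsto_matrix_inv (by rw [det_conjTranspose]; exact hdet.star)
      (tendsto_conjTranspose hA)
    have h3 := tendsto_seqP hdet hA hP k
    exact (ih.add (tendsto_matrix_mul (tendsto_matrix_mul h1 ih) h2)).add
      (tendsto_matrix_mul (tendsto_matrix_mul (tendsto_matrix_mul h1 h3)
        (tendsto_conjTranspose h3)) h2)

namespace IsAdmissible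

lemma tendsto_seqGram (h : IsAdmissible A S₀ P₀) (hA : Tendsto A' l (𝓝 A))
    (hS : Tendsto S' l (𝓝 S₀)) (hP : Tendsto P' l (𝓝 P₀)) (k : ℕ) :
    Tendsto (fun x => seqGram (A' x) (S' x) (P' x) k) l (𝓝 (seqGram A S₀ P₀ k)) := by
  have h1 := tendsto_seqP h.isUnit_det hA hP k
  exact tendsto_matrix_mul (tendsto_matrix_mul (tendsto_conjTranspose h1)
    (tendsto_matrix_inv ((isUnit_iff_isUnit_det _).1 (h.posDef_seqS k).isUnit)
      (tendsto_seqS h.isUnit_det hA hS hP k))) h1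

lemma tendsto_seqC (h : IsAdmissible A S₀ P₀) (hA : Tendsto A' l (𝓝 A))
    (hS : Tendsto S' l (𝓝 S₀)) (hP : Tendsto P' l (𝓝 P₀)) (k : ℕ) :
    Tendsto (fun x => seqC (A' x) (S' x) (P' x) k) l (𝓝 (seqC A S₀ P₀ k)) := by
  simp only [seqC_eq_seqGram]
  exact tendsto_const_nhds.add
    ((h.tendsto_seqGram hA hS hP k).sub (h.tendsto_seqGram hA hS hP (k + 1)))

/-- If a compression of `Π_N* S_N⁻¹ Π_N` can be made small, the potentials of the admissible
triples near a given one are close to its potential, uniformly on the half-axis. -/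
lemma eventually_norm_seqC_sub_lt {ν : Type*} [Fintype ν] [DecidableEq ν] {σ : ℝ}
    {E : Matrix (Fin m₁ ⊕ Fin m₂) ν ℂ} (h : IsAdmissible A S₀ P₀) (hσ : σ ^ 2 = 1)
    (hE : sig m₁ m₂ * E = (σ : ℂ) • E)
    (hblock : ∀ ε > 0, ∃ η > 0, ∀ C : Matrix (Fin m₁ ⊕ Fin m₂) (Fin m₁ ⊕ Fin m₂) ℂ, C.PosDef →
      C * sig m₁ m₂ * C = sig m₁ m₂ → ‖Eᴴ * (C - 1) * E‖ < η → ‖C - 1‖ < ε)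
    (hgram : ∀ η > 0, ∃ N, ‖Eᴴ * seqGram A S₀ P₀ N * E‖ < η) (hA : Tendsto A' l (𝓝 A))
    (hS : Tendsto S' l (𝓝 S₀)) (hP : Tendsto P' l (𝓝 P₀)) {ε : ℝ} (hε : 0 < ε) :
    ∀ᶠ x in l, IsAdmissible (A' x) (S' x) (P' x) →
      ∀ k, ‖seqC A S₀ P₀ k - seqC (A' x) (S' x) (P' x) k‖ < ε := by
  obtain ⟨η, hη, hC⟩ := hblock (ε / 2) (by positivity)
  obtain ⟨N, hN⟩ := hgram η hη
  -- The tail bound holds for any admissible triple meeting the one strict inequality at N. N comes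
  -- from the unperturbed triple, and the inequality survives small perturbations.
  have htail : ∀ {A S : Matrix (Fin n) (Fin n) ℂ} {P : Matrix (Fin n) (Fin m₁ ⊕ Fin m₂) ℂ},
      IsAdmissible A S P → ‖Eᴴ * seqGram A S P N * E‖ < η → ∀ k, N ≤ k →
      ‖seqC A S P k - 1‖ < ε / 2 := fun hadm hlt k hk =>
    hC _ (hadm.isDiracPotential k).1 (hadm.isDiracPotential k).2
      ((hadm.norm_conj_seqC_sub_one_le hσ hE hk).trans_lt hlt)
  have h1 : ∀ᶠ x in l, ‖Eᴴ * seqGram (A' x) (S' x) (P' x) N * E‖ < η :=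
    (tendsto_matrix_mul (tendsto_matrix_mul tendsto_const_nhds (h.tendsto_seqGram hA hS hP N))
      tendsto_const_nhds).norm.eventually_lt_const hN
  have h2 : ∀ᶠ x in l, ∀ k ∈ Finset.range N,
      ‖seqC A S₀ P₀ k - seqC (A' x) (S' x) (P' x) k‖ < ε := by
    rw [Filter.eventually_all_finset]
    intro k _
    refine (tendsto_const_nhds.sub (h.tendsto_seqC hA hS hP k)).norm.eventually_lt_const ?_
    rwa [sub_self, norm_zero]
  filter_upwards [h1, h2] with x hx1 hx2 hadm k
  rcases lt_or_ge k N with hk | hk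
  · exact hx2 k (Finset.mem_range.2 hk)
  · have h3 := htail h hN k hk
    have h4 := htail hadm hx1 k hk
    calc ‖seqC A S₀ P₀ k - seqC (A' x) (S' x) (P' x) k‖
        = ‖(seqC A S₀ P₀ k - 1) - (seqC (A' x) (S' x) (P' x) k - 1)‖ := by rw [sub_sub_sub_cancel_right]
      _ ≤ _ := norm_sub_le _ _
      _ < ε := by linarith

end IsAdmissible

end Continuity

/-! ### The two eigenspaces of j -/

section Compression

variable {m₁ m₂ : ℕ}

/-- The embedding of the eigenspace of `j` for the eigenvalue `1`. -/
def posColumns (m₁ m₂ : ℕ) : Matrix (Fin m₁ ⊕ Fin m₂) (Fin m₁) ℂ := fromRows 1 0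

/-- The embedding of the eigenspace of `j` for the eigenvalue `-1`. -/
def negColumns (m₁ m₂ : ℕ) : Matrix (Fin m₁ ⊕ Fin m₂) (Fin m₂) ℂ := fromRows 0 1

lemma sig_mul_posColumns : sig m₁ m₂ * posColumns m₁ m₂ = ((1 : ℝ) : ℂ) • posColumns m₁ m₂ := by
  rw [sig, posColumns, fromBlocks_mul_fromRows]; simp

lemma sig_mul_negColumns : sig m₁ m₂ * negColumns m₁ m₂ = ((-1 : ℝ) : ℂ) • negColumns m₁ m₂ := by
  rw [sig, negColumns, fromBlocks_mul_fromRows]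
  ext (i | i) j <;> simp

lemma conj_posColumns (C : Matrix (Fin m₁ ⊕ Fin m₂) (Fin m₁ ⊕ Fin m₂) ℂ) :
    (posColumns m₁ m₂)ᴴ * (C - 1) * posColumns m₁ m₂ = C.toBlocks₁₁ - 1 := by
  obtain ⟨a, b, c, d, rfl⟩ : ∃ a b c d, C = fromBlocks a b c d :=
    ⟨_, _, _, _, (fromBlocks_toBlocks C).symm⟩
  rw [Matrix.mul_assoc, Matrix.sub_mul, posColumns, fromBlocks_mul_fromRows,
    conjTranspose_fromRows_eq_fromCols_conjTranspose, Matrix.mul_sub, fromCols_mul_fromRows,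
    Matrix.one_mul, fromCols_mul_fromRows]
  simp

lemma conj_negColumns (C : Matrix (Fin m₁ ⊕ Fin m₂) (Fin m₁ ⊕ Fin m₂) ℂ) :
    (negColumns m₁ m₂)ᴴ * (C - 1) * negColumns m₁ m₂ = C.toBlocks₂₂ - 1 := by
  obtain ⟨a, b, c, d, rfl⟩ : ∃ a b c d, C = fromBlocks a b c d :=
    ⟨_, _, _, _, (fromBlocks_toBlocks C).symm⟩
  rw [Matrix.mul_assoc, Matrix.sub_mul, negColumns, fromBlocks_mul_fromRows,
    conjTranspose_fromRows_eq_fromCols_conjTranspose, Matrix.mul_sub, fromCols_mul_fromRows,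
    Matrix.one_mul, fromCols_mul_fromRows]
  simp

lemma isUnit_det_one_add_smul_inv {ι : Type*} [Fintype ι] [DecidableEq ι] {A : Matrix ι ι ℂ}
    (hA : IsUnit A.det) {s : ℂ} (hs : -s ∉ spectrum ℂ A) : IsUnit (1 + s • A⁻¹).det := by
  have h1 := isUnit_det_of_notMem_spectrum hs
  have h2 : 1 + s • A⁻¹ = -A⁻¹ * ((-s) • (1 : Matrix ι ι ℂ) - A) := by
    rw [Matrix.mul_sub, Matrix.neg_mul A⁻¹ A, nonsing_inv_mul _ hA, Matrix.mul_smul,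
      Matrix.mul_one, smul_neg, neg_smul, neg_neg, sub_neg_eq_add, add_comm]
  rw [h2, det_mul]
  refine IsUnit.mul ?_ h1
  rw [← isUnit_iff_isUnit_det]
  exact ((isUnit_iff_isUnit_det _).2 (isUnit_nonsing_inv_det _ hA)).neg

end Compression

/-! ### Stability of the recovery procedure -/

namespace Realization

variable {m₁ m₂ n : ℕ} {T : Realization m₁ m₂ n} {X : Matrix (Fin n) (Fin n) ℂ}

lemma exists_forall_stable (hX : T.IsSpectralSolution X) (hdet : (T.recA X).det ≠ 0)
    (hlim : TendsToPosInfinity (T.recR X) ∨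
      (Complex.I ∉ spectrum ℂ (T.recA X) ∧ TendsToPosInfinity (T.recQ X))) {ε : ℝ} (hε : 0 < ε) :
    ∃ δ > 0, ∀ U ∈ classG m₁ m₂ n, T.distance U < δ → ∀ Y : Matrix (Fin n) (Fin n) ℂ,
      Y.IsHermitian → U.Riccati Y → ‖X - Y‖ < δ →
      U.RecAdmissible Y ∧ ∀ k, ‖T.recC X k - U.recC Y k‖ < ε := by
  have hadm := recAdmissible hX.posDef hX.riccati hdet
  -- The filter `comap f (𝓝 0)` expresses joint convergence of realization and solution, so the
  -- limit lemmas apply directly and a single δ is extracted at the end.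
  let f : Realization m₁ m₂ n × Matrix (Fin n) (Fin n) ℂ → ℝ := fun p =>
    max (T.distance p.1) ‖X - p.2‖
  have hf : Tendsto f (comap f (𝓝 0)) (𝓝 0) := tendsto_comap
  have hd : Tendsto (fun p : Realization m₁ m₂ n × Matrix (Fin n) (Fin n) ℂ => T.distance p.1)
      (comap f (𝓝 0)) (𝓝 0) :=
    squeeze_zero (fun _ => distance_nonneg _ _) (fun _ => le_max_left _ _) hf
  obtain ⟨ha, hb, hc⟩ := tendsto_of_tendsto_distance hd
  have hY : Tendsto (fun p : Realization m₁ m₂ n × Matrix (Fin n) (Fin n) ℂ => p.2)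
      (comap f (𝓝 0)) (𝓝 X) := by
    rw [tendsto_iff_norm_sub_tendsto_zero]
    exact squeeze_zero (fun _ => norm_nonneg _)
      (fun p => by rw [norm_sub_rev]; exact le_max_right _ _) hf
  have hA : Tendsto (fun p : Realization m₁ m₂ n × Matrix (Fin n) (Fin n) ℂ => p.1.recA p.2)
      (comap f (𝓝 0)) (𝓝 (T.recA X)) :=
    ha.sub ((tendsto_matrix_mul (tendsto_matrix_mul hb (tendsto_conjTranspose hb)) hY).const_smul
      Complex.I)
  have hS : Tendsto (fun p : Realization m₁ m₂ n × Matrix (Fin n) (Fin n) ℂ => p.2⁻¹)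
      (comap f (𝓝 0)) (𝓝 X⁻¹) :=
    tendsto_matrix_inv ((isUnit_iff_isUnit_det _).1 hX.posDef.isUnit) hY
  have hP : Tendsto (fun p : Realization m₁ m₂ n × Matrix (Fin n) (Fin n) ℂ => p.1.recP p.2)
      (comap f (𝓝 0)) (𝓝 (T.recP X)) := by
    have h1 : Continuous fun q : Matrix (Fin n) (Fin m₁) ℂ × Matrix (Fin n) (Fin m₂) ℂ =>
        fromCols q.1 q.2 := by
      refine continuous_matrix fun i j => ?_
      rcases j with j | j
      · exact (continuous_apply_apply i j).comp continuous_fst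
      · exact (continuous_apply_apply i j).comp continuous_snd
    exact (h1.tendsto (_, _)).comp (((tendsto_matrix_mul hS (tendsto_conjTranspose hc)).const_smul
      Complex.I).prodMk_nhds hb)
  have hdet' : ∀ᶠ p in comap f (𝓝 0), (p.1.recA p.2).det ≠ 0 :=
    ((continuous_id.matrix_det.tendsto _).comp hA).eventually_ne hdet
  have hCev : ∀ᶠ p in comap f (𝓝 0), p.1.RecAdmissible p.2 →
      ∀ k, ‖T.recC X k - p.1.recC p.2 k‖ < ε := by
    rcases hlim with h | ⟨hI, h⟩
    · refine hadm.eventually_norm_seqC_sub_lt (one_pow 2) sig_mul_posColumns ?_ ?_ hA hS hP hε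
      · intro ε hε
        obtain ⟨η, hη, hC⟩ := exists_forall_norm_sub_one_lt (m₁ := m₁) (m₂ := m₂) hε
        exact ⟨η, hη, fun C h1 h2 h3 => hC C h1 h2 (Or.inl (by rwa [conj_posColumns] at h3))⟩
      · intro η hη
        refine hadm.exists_norm_conj_seqGram_lt sig_mul_posColumns
          -- Here I + iA⁻¹ is invertible because −i ∉ σ(A), by the spectral condition. For Q_k the
          -- point is i, which that condition does not exclude, hence the extra assumption.
          (isUnit_det_one_add_smul_inv hadm.isUnit_det fun hmem => ?_) ?_ hη
        · have := hX.spectrum_subset hmem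
          norm_num at this
        · convert h using 1
          funext r
          rw [recR, seqR, conjTranspose_pow, conjTranspose_add, conjTranspose_one,
            conjTranspose_smul, conjTranspose_nonsing_inv]
          simp [sub_eq_add_neg]
    · refine hadm.eventually_norm_seqC_sub_lt (σ := -1) (by norm_num) sig_mul_negColumns
        ?_ ?_ hA hS hP hε
      · intro ε hε
        obtain ⟨η, hη, hC⟩ := exists_forall_norm_sub_one_lt (m₁ := m₁) (m₂ := m₂) hε
        exact ⟨η, hη, fun C h1 h2 h3 => hC C h1 h2 (Or.inr (by rwa [conj_negColumns] at h3))⟩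
      · intro η hη
        refine hadm.exists_norm_conj_seqGram_lt sig_mul_negColumns
          (isUnit_det_one_add_smul_inv hadm.isUnit_det ?_) ?_ hη
        · simpa using hI
        · convert h using 1
          funext r
          rw [recQ, seqQ, conjTranspose_pow, conjTranspose_add, conjTranspose_one,
            conjTranspose_smul, conjTranspose_nonsing_inv]
          simp [sub_eq_add_neg]
  obtain ⟨δ, hδ, h⟩ := ((Metric.nhds_basis_ball (x := (0 : ℝ))).comap f).eventually_iff.1
    (hdet'.and hCev)
  refine ⟨δ, hδ, fun U hU hd Y hYH hYR hXY => ?_⟩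
  have hmem : (U, Y) ∈ f ⁻¹' Metric.ball 0 δ := by
    rw [Set.mem_preimage, Metric.mem_ball, Real.dist_0_eq_abs,
      abs_of_nonneg (le_max_of_le_right (norm_nonneg _))]
    exact max_lt hd hXY
  obtain ⟨h1, h2⟩ := h hmem
  have h3 := recAdmissible (posDef_of_riccati hU hYH hYR) hYR h1
  exact ⟨h3, h2 h3⟩

theorem stableRecovery (hT : T ∈ classG m₁ m₂ n) (hX : T.IsSpectralSolution X)
    (hdet : (T.recA X).det ≠ 0)
    (hlim : TendsToPosInfinity (T.recR X) ∨
      (Complex.I ∉ spectrum ℂ (T.recA X) ∧ TendsToPosInfinity (T.recQ X))) :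
    T.StableRecovery X := by
  intro ε hε
  obtain ⟨δ₁, hδ₁, h₁⟩ := exists_forall_stable hX hdet hlim hε
  -- Closeness within δ₁, not just ε, brings the spectrally chosen perturbed solution under the
  -- statement for arbitrary nearby Hermitian solutions.
  obtain ⟨δ₂, hδ₂, h₂⟩ := exists_forall_norm_sub_lt hT.1 hX (lt_min hε hδ₁)
  refine ⟨min δ₁ δ₂, lt_min hδ₁ hδ₂, fun U hU hd => ⟨existsUnique_isSpectralSolution hU, ?_, ?_⟩⟩
  · intro Y hY
    have h3 := h₂ U (hd.trans_le (min_le_right _ _)) Y hY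
    exact ⟨h3.trans_le (min_le_left _ _), h₁ U hU (hd.trans_le (min_le_left _ _)) Y hY.posDef.1
      hY.riccati (h3.trans_le (min_le_right _ _))⟩
  · intro Y hYH hYR hXY
    exact h₁ U hU (hd.trans_le (min_le_left _ _)) Y hYH hYR (hXY.trans_le (min_le_left _ _))

end Realization

end DiscreteDirac
theorem theorem4p4 {m₁ m₂ n : ℕ} (T : DiscreteDirac.Realization m₁ m₂ n)
    (hT : T ∈ DiscreteDirac.Realization.classG m₁ m₂ n) :
    -- the choice of `X` by the spectral condition is always possible, in a unique way
    (∃! X : Matrix (Fin n) (Fin n) ℂ, T.IsSpectralSolution X) ∧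
    ∀ X : Matrix (Fin n) (Fin n) ℂ, T.IsSpectralSolution X → (T.recA X).det ≠ 0 →
      -- the procedure recovers the one and only system whose Weyl function is `φ(z) = ψ(-1/z)`
      (T.RecAdmissible X ∧ DiscreteDirac.IsDiracPotential (T.recC X) ∧
        DiscreteDirac.IsWeylFunction (T.recC X) (fun z => T.transfer (-1 / z)) ∧
        ∀ C : ℕ → Matrix (Fin m₁ ⊕ Fin m₂) (Fin m₁ ⊕ Fin m₂) ℂ,
          DiscreteDirac.IsDiracPotential C →
          DiscreteDirac.IsWeylFunction C (fun z => T.transfer (-1 / z)) → C = T.recC X) ∧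
      -- and it is stable when `R_k → +∞`, or when `i ∉ σ(A)` and `Q_k → +∞`
      ((DiscreteDirac.TendsToPosInfinity (T.recR X) ∨
          (Complex.I ∉ spectrum ℂ (T.recA X) ∧ DiscreteDirac.TendsToPosInfinity (T.recQ X))) →
        T.StableRecovery X) := by
  have hex := DiscreteDirac.Realization.existsUnique_isSpectralSolution hT
  refine ⟨hex, fun X hX hdet => ?_⟩
  have hadm := DiscreteDirac.Realization.recAdmissible hX.posDef hX.riccati hdet
  have hpot : DiscreteDirac.IsDiracPotential (T.recC X) := hadm.isDiracPotential
  have hweyl := DiscreteDirac.Realization.isWeylFunction_recC hT hX hadm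
  exact ⟨⟨hadm, hpot, hweyl, fun C hC hW =>
    DiscreteDirac.Realization.potential_unique_of_isWeylFunction hT hC hpot hW hweyl⟩,
    DiscreteDirac.Realization.stableRecovery hT hX hdet⟩
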